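/- **Setting.** Let $f\in\mathbb{R}[x,y]$ have degree $n$ in $y$, let $S=\{f=0\}\subset\mathbb{C}^2$, and for $x\in\mathbb{C}$ let $K(x)=\{y\in\mathbb{C} : f(x,y)=0\}$. Put $$N=\{x\in\mathbb{C} : |K(x)|<n\},\qquad B=\{x\in\mathbb{R} : \exists\, z_1\ne z_2\in K(x)\setminus\mathbb{R},\ \Im z_1=\Im z_2\}.$$ Assume that $N\subset\mathbb{R}$, that $B$ is finite, that $B\cap N=\emptyset$, and that for every $x\in B$ there are exactly two unordered pairs of distinct points of $K(x)\setminus\mathbb{R}$ with equal imaginary parts (one pair and its complex conjugate). Let $E$ be a closed disc with $N\subset E\setminus\partial E$, let $D$ be a closed disc with $K(x)\subset D$ for all $x\in E$, and let $x_0\in B$ lie in the interior of $E$. Let $y_0,y_0'\in K(x_0)$ be the two distinct points with $0<\Im y_0=\Im y_0'$, and let $d$ be the number of non-real points of $K(x_0)$. For real $x\ne x_0$ near $x_0$ let $z_1(x),\dots,z_{d/2}(x)$ be the points of $K(x)$ in the open upper half plane, ordered by increasing imaginary part. The *complex Lefschetz pair* of $x_0$ is the pair $(k,l)$, $k\le l$,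 such that for all sufficiently small $\varepsilon>0$ and all real $x\neq x_0$ sufficiently close to $x_0$ (depending on $\varepsilon$) the numbers among the $\Im z_j(x)$ lying in $(\Im y_0-\varepsilon,\Im y_0+\varepsilon)$ are exactly $\Im z_k(x)$ and $\Im z_l(x)$ (then $l=k+1$). The *orientation* is $\mathcal{O}(x_0)=1$ if $\Re z_k>\Re z_l$ just to the left of $x_0$ and $\Re z_k<\Re z_l$ just to the right; $\mathcal{O}(x_0)=-1$ if $\Re z_k<\Re z_l$ just to the left and $\Re z_k>\Re z_l$ just to the right; and $\mathcal{O}(x_0)=0$ otherwise. **Model.** Let $\widetilde D$ be the closed disc with centre $n+1$ and radius $n+1$, and $K_d=\{1,\dots,n-d\}\cup\{n+1\pm ij : 1\le j\le d/2\}$. For real $x\notin N\cup B$ in $E$ the *model point* of $y\in K(x)$ is $j$ if $y$ is the $j$-th real point of $K(x)$ in increasing order, and $n+1+ij$ (resp. $n+1-ij$) if $y$ is the $j$-th point of $K(x)$ above (resp. below) the real axis in the order of increasing $|\Im y|$. A *fibre model* is a diffeomorphism $\beta_x:D\to\widetilde D$ with $\beta_x(D\cap\mathbb{R})=\widetilde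 D\cap\mathbb{R}$ induced by moving the points of $K(x)$ along straight segments to their model points: there is a continuous family of diffeomorphisms $F_t:D\to D_t$, $t\in[0,1]$, where $D_t$ is the disc whose centre and radius interpolate linearly between those of $D$ and $\widetilde D$, with $F_0=\mathrm{id}$, $F_1=\beta_x$, $F_t(y)=(1-t)y+t\cdot(\text{model point of }y)$ for $y\in K(x)$, and $F_t|_{\partial D}=b_t$ for a family of maps $b_t:\partial D\to\partial D_t$ which does not depend on $x$. A *Lefschetz diffeomorphism* $\Psi_s:D\to D$ of a path $s:[0,1]\to E\setminus N$ is the end $\Phi_1$ of a continuous family of diffeomorphisms $\Phi_t$ of $D$ that are the identity on $\partial D$, with $\Phi_0=\mathrm{id}$ and $\Phi_t(K(s(0)))=K(s(t))$ for all $t\in[0,1]$. Let $R^{a}\langle s,r\rangle$ be the diffeomorphism that rotates the closed disc with centre $s$ and radius $r$ counterclockwise by the angle $2\pi a$ and is the identity outside a slightly larger concentric disc, the rotation angle tapering smoothly from $2\pi a$ to $0$ in the annulus between them; put $$\Delta_{com}\langle k,l\rangle=R^{1/2}\langle n+1+(k+\tfrac12)i,\tfrac12\rangle\circ R^{-1/2}\langle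 n+1-(k+\tfrac12)i,\tfrac12\rangle .$$ **Proposition.** Let $(k,l)$ be the complex Lefschetz pair of $x_0$. For all sufficiently small $\alpha>0$, if $\Psi_u$ is a Lefschetz diffeomorphism of the segment $u(t)=x_0-\alpha+2\alpha t$, and $\beta_{x_0-\alpha},\beta_{x_0+\alpha}$ are fibre models with a common boundary family $b_t$, then (diffeomorphisms being composed from left to right) $$\beta_{x_0-\alpha}^{-1}\,\Psi_u\,\beta_{x_0+\alpha}=\Delta_{com}^{\mathcal{O}(x_0)}\langle k,l\rangle$$ as mapping classes of $(\widetilde D,K_d)$: the two sides are joined by a continuous family of diffeomorphisms of $\widetilde D$ that are the identity on $\partial\widetilde D$ and map $K_d$ onto itself. -/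

import Mathlib

open Set Filter Topology
open scoped ContDiff

noncomputable section

namespace RealCurve

/-! ### The curve, its fibres and its special points

The curve `S ⊆ ℂ²` is the zero set of a polynomial `f(x)(y)` with real coefficients; the outer
variable is `y`, so that `f.natDegree` is the degree `n` of `S` with respect to `(x, y) ↦ x`. -/

/-- `K(x)`: the second coordinates of the points of the curve above `x`. -/
def fibre (f : Polynomial (Polynomial ℝ)) (x : ℂ) : Set ℂ :=
  {y | (f.map (Polynomial.mapRingHom (algebraMap ℝ ℂ))).evalEval x y = 0}

/-- `N = {x ∈ ℂ : |K(x)| < n}`. -/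
def branchSet (f : Polynomial (Polynomial ℝ)) : Set ℂ :=
  {x | (fibre f x).encard < (f.natDegree : ℕ∞)}

/-- The unordered pairs of distinct non-real points of `K(x)` with equal imaginary parts
(the point with the smaller real part is listed first). -/
def levelPairs (f : Polynomial (Polynomial ℝ)) (x : ℂ) : Set (ℂ × ℂ) :=
  {p | p.1 ∈ fibre f x ∧ p.2 ∈ fibre f x ∧ p.1.im ≠ 0 ∧ p.1.im = p.2.im ∧ p.1.re < p.2.re}

/-- `B`: the complex-switching points. -/
def switchSet (f : Polynomial (Polynomial ℝ)) : Set ℝ :=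
  {x | (levelPairs f (x : ℂ)).Nonempty}

/-- The standing assumptions on the curve. -/
structure IsAdmissible (f : Polynomial (Polynomial ℝ)) : Prop where
  /-- the curve is a real singular curve -/
  branchSet_real : ∀ x ∈ branchSet f, x.im = 0
  /-- `B` is finite -/
  switchSet_finite : (switchSet f).Finite
  /-- above a point of `B` there are exactly two pairs at a common level -/
  two_pairs : ∀ x ∈ switchSet f, (levelPairs f (x : ℂ)).ncard = 2
  /-- `B ∩ N = ∅` -/
  disjoint : ∀ x ∈ switchSet f, (x : ℂ) ∉ branchSet f

/-- The number `d` of non-real points of `K(x)`. -/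
def numNonreal (f : Polynomial (Polynomial ℝ)) (x : ℝ) : ℕ :=
  {y | y ∈ fibre f x ∧ y.im ≠ 0}.ncard

/-! ### The complex Lefschetz pair and the orientation -/

/-- The set of positive imaginary parts of the points of `K(x)`. -/
def posIm (f : Polynomial (Polynomial ℝ)) (x : ℝ) : Set ℝ :=
  {r | 0 < r ∧ ∃ y ∈ fibre f x, y.im = r}

/-- `r` is the `j`-th smallest element (`j ≥ 1`) of `A`. -/
def IsNth (A : Set ℝ) (j : ℕ) (r : ℝ) : Prop :=
  r ∈ A ∧ {s | s ∈ A ∧ s ≤ r}.Finite ∧ {s | s ∈ A ∧ s ≤ r}.ncard = j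

/-- `(k, l)` is the complex Lefschetz pair of `x₀`: if `y₀, y₀' ∈ K(x₀)` are the points with
`0 < Im y₀ = Im y₀'` then, for small `ε > 0` and real `x' ≠ x₀` close to `x₀`, the levels in
`posIm f x' = {r₁ < ⋯ < r_{d/2}}` at distance less than `ε` from `Im y₀` are `r_k` and `r_l`. -/
def IsComplexLefschetzPair (f : Polynomial (Polynomial ℝ)) (x₀ : ℝ) (k l : ℕ) : Prop :=
  k ≤ l ∧ ∃ y₀ y₀' : ℂ, (y₀, y₀') ∈ levelPairs f (x₀ : ℂ) ∧ 0 < y₀.im ∧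
    ∀ᶠ ε : ℝ in 𝓝[>] 0, ∀ᶠ x' : ℝ in 𝓝[≠] x₀, ∃ r s : ℝ,
      IsNth (posIm f x') k r ∧ IsNth (posIm f x') l s ∧
      posIm f x' ∩ Ioo (y₀.im - ε) (y₀.im + ε) = {r, s}

/-- `z` is the point `z_j` in the enumeration `z₁, …, z_{d/2}`, by increasing imaginary part, of
the points of `K(x)` in the open upper half plane. -/
def IsUpperPoint (f : Polynomial (Polynomial ℝ)) (x : ℝ) (j : ℕ) (z : ℂ) : Prop :=
  z ∈ fibre f x ∧ 0 < z.im ∧ {w | w ∈ fibre f x ∧ 0 < w.im ∧ w.im ≤ z.im}.ncard = j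

/-- `Re z_i < Re z_j` above `x`. -/
def UpperReLT (f : Polynomial (Polynomial ℝ)) (x : ℝ) (i j : ℕ) : Prop :=
  ∃ z w : ℂ, IsUpperPoint f x i z ∧ IsUpperPoint f x j w ∧ z.re < w.re

open Classical in
/-- The orientation `O(x₀) ∈ {1, -1, 0}` of a point with complex Lefschetz pair `(k, l)`. -/
def orientation (f : Polynomial (Polynomial ℝ)) (x₀ : ℝ) (k l : ℕ) : ℤ :=
  if (∀ᶠ x in 𝓝[<] x₀, UpperReLT f x l k) ∧ (∀ᶠ x in 𝓝[>] x₀, UpperReLT f x k l) then 1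
  else if (∀ᶠ x in 𝓝[<] x₀, UpperReLT f x k l) ∧ (∀ᶠ x in 𝓝[>] x₀, UpperReLT f x l k) then -1
  else 0

/-! ### Diffeomorphisms and isotopies -/

/-- `e` is a `C^∞` diffeomorphism from `U` onto `V`. -/
structure IsDiffeo (e : PartialEquiv ℂ ℂ) (U V : Set ℂ) : Prop where
  source_eq : e.source = U
  target_eq : e.target = V
  smooth : ContDiffOn ℝ ∞ e U
  smooth_symm : ContDiffOn ℝ ∞ e.symm V

/-- Two maps of the closed disc with centre `c` and radius `r` define the same mapping class
relative to `P`: they are the ends of a continuous family of diffeomorphisms of the disc which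
are the identity on the boundary circle and map `P` onto itself. -/
def SameMappingClass (c : ℂ) (r : ℝ) (P : Set ℂ) (g h : ℂ → ℂ) : Prop :=
  ∃ G : ℝ → PartialEquiv ℂ ℂ,
    (∀ t ∈ Icc (0 : ℝ) 1,
      IsDiffeo (G t) (Metric.closedBall c r) (Metric.closedBall c r) ∧
      (∀ z ∈ Metric.sphere c r, G t z = z) ∧ G t '' P = P) ∧
    ContinuousOn (fun p : ℝ × ℂ => G p.1 p.2) (Icc (0 : ℝ) 1 ×ˢ Metric.closedBall c r) ∧
    EqOn (G 0) g (Metric.closedBall c r) ∧ EqOn (G 1) h (Metric.closedBall c r)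

/-- `ψ` represents the Lefschetz diffeomorphism of the path `s : [0, 1] → ℂ`: it is the end of a
continuous family of diffeomorphisms of `D`, fixed on `∂D` and starting at the identity, that
carries `K(s(0))` along the lifts of `s`. -/
def IsLefschetzDiffeo (f : Polynomial (Polynomial ℝ)) (c : ℂ) (r : ℝ) (s : ℝ → ℂ)
    (ψ : PartialEquiv ℂ ℂ) : Prop :=
  IsDiffeo ψ (Metric.closedBall c r) (Metric.closedBall c r) ∧
  ∃ Φ : ℝ → PartialEquiv ℂ ℂ,
    (∀ t ∈ Icc (0 : ℝ) 1,
      IsDiffeo (Φ t) (Metric.closedBall c r) (Metric.closedBall c r) ∧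
      (∀ z ∈ Metric.sphere c r, Φ t z = z) ∧
      Φ t '' fibre f (s 0) = fibre f (s t)) ∧
    ContinuousOn (fun p : ℝ × ℂ => Φ p.1 p.2) (Icc (0 : ℝ) 1 ×ˢ Metric.closedBall c r) ∧
    EqOn (Φ 0) id (Metric.closedBall c r) ∧ EqOn (Φ 1) ψ (Metric.closedBall c r)

/-! ### The model of the fibre

The model disc has centre `n + 1` and radius `n + 1`. -/

/-- `K_d = {1, …, n - d, (n + 1) ± i, …, (n + 1) ± (d / 2) i}`. -/
def modelConfig (n d : ℕ) : Set ℂ :=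
  {z | ∃ j : ℕ, 1 ≤ j ∧ j + d ≤ n ∧ z = j} ∪
  {z | ∃ j : ℕ, 1 ≤ j ∧ 2 * j ≤ d ∧
    (z = (n + 1 : ℂ) + j * Complex.I ∨ z = (n + 1 : ℂ) - j * Complex.I)}

open Classical in
/-- The model point of `y ∈ K(x)`: the `j`-th real point (in increasing order) corresponds to `j`,
and the `j`-th non-real point above (below) the real axis, counted from the axis by its imaginary
part, corresponds to `n + 1 + j i` (to `n + 1 - j i`). -/
def modelPoint (f : Polynomial (Polynomial ℝ)) (x : ℝ) (y : ℂ) : ℂ :=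
  if y.im = 0 then
    ({w | w ∈ fibre f x ∧ w.im = 0 ∧ w.re ≤ y.re}.ncard : ℂ)
  else if 0 < y.im then
    (f.natDegree + 1 : ℂ) + ({w | w ∈ fibre f x ∧ 0 < w.im ∧ w.im ≤ y.im}.ncard : ℂ) * Complex.I
  else
    (f.natDegree + 1 : ℂ) - ({w | w ∈ fibre f x ∧ w.im < 0 ∧ y.im ≤ w.im}.ncard : ℂ) * Complex.I

/-- `β` is a model `β_x : D → D̃` of the fibre above `x`, where `D` has centre `c` and radius `r`.
It preserves the real axis, and it is the end of a continuous family `F_t` of diffeomorphisms,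
starting at the identity, from `D` onto the discs interpolating linearly between `D` and `D̃`, such
that every point of `K(x)` moves along the straight segment to its model point. On the boundary,
`F_t` is prescribed by `b_t`, which does not depend on `x`. -/
def IsFibreModel (f : Polynomial (Polynomial ℝ)) (c : ℂ) (r : ℝ) (b : ℝ → ℂ → ℂ) (x : ℝ)
    (β : PartialEquiv ℂ ℂ) : Prop :=
  IsDiffeo β (Metric.closedBall c r)
    (Metric.closedBall (f.natDegree + 1 : ℂ) (f.natDegree + 1 : ℝ)) ∧
  β '' (Metric.closedBall c r ∩ {z | z.im = 0}) =
    Metric.closedBall (f.natDegree + 1 : ℂ) (f.natDegree + 1 : ℝ) ∩ {z | z.im = 0} ∧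
  ∃ F : ℝ → PartialEquiv ℂ ℂ,
    (∀ t ∈ Icc (0 : ℝ) 1,
      IsDiffeo (F t) (Metric.closedBall c r)
        (Metric.closedBall ((1 - t) * c + t * (f.natDegree + 1 : ℂ))
          ((1 - t) * r + t * (f.natDegree + 1 : ℝ))) ∧
      (∀ z ∈ Metric.sphere c r, F t z = b t z ∧
        b t z ∈ Metric.sphere ((1 - t) * c + t * (f.natDegree + 1 : ℂ))
          ((1 - t) * r + t * (f.natDegree + 1 : ℝ))) ∧
      (∀ y ∈ fibre f x, F t y = (1 - t) * y + t * modelPoint f x y)) ∧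
    ContinuousOn (fun p : ℝ × ℂ => F p.1 p.2) (Icc (0 : ℝ) 1 ×ˢ Metric.closedBall c r) ∧
    EqOn (F 0) id (Metric.closedBall c r) ∧ EqOn (F 1) β (Metric.closedBall c r)

/-- The angle profile of a rotation: it is `1` for `ρ ≤ r` and `0` for `ρ ≥ r + 1 / 4`. -/
def rotProfile (r ρ : ℝ) : ℝ := Real.smoothTransition (4 * (r + 1 / 4 - ρ))

/-- The map underlying `R^a⟨s, r⟩`. -/
def rotFun (a : ℝ) (s : ℂ) (r : ℝ) (z : ℂ) : ℂ :=
  s + Complex.exp ((2 * Real.pi * a * rotProfile r ‖z - s‖ : ℝ) * Complex.I) * (z - s)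

theorem rotFun_neg_rotFun (a : ℝ) (s : ℂ) (r : ℝ) (z : ℂ) :
    rotFun (-a) s r (rotFun a s r z) = z := by
  have h : ‖rotFun a s r z - s‖ = ‖z - s‖ := by
    simp only [rotFun, add_sub_cancel_left, norm_mul, Complex.norm_exp_ofReal_mul_I, one_mul]
  have h' : rotFun (-a) s r (rotFun a s r z) = s +
      Complex.exp ((2 * Real.pi * (-a) * rotProfile r ‖rotFun a s r z - s‖ : ℝ) * Complex.I) *
        (rotFun a s r z - s) := rfl
  rw [h', h, rotFun, add_sub_cancel_left, ← mul_assoc, ← Complex.exp_add, ← add_mul,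
    ← Complex.ofReal_add]
  have h0 : 2 * Real.pi * -a * rotProfile r ‖z - s‖ + 2 * Real.pi * a * rotProfile r ‖z - s‖
      = 0 := by ring
  rw [h0]
  simp

/-- `R^a⟨s, r⟩`: the diffeomorphism that rotates the closed disc with centre `s` and radius `r`
counterclockwise by the angle `2πa` and is the identity outside a slightly larger disc. -/
def rotation (a : ℝ) (s : ℂ) (r : ℝ) : Equiv.Perm ℂ where
  toFun := rotFun a s r
  invFun := rotFun (-a) s r
  left_inv := rotFun_neg_rotFun a s r
  right_inv z := by simpa using rotFun_neg_rotFun (-a) s r z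

/-- `Δ_com⟨k, l⟩`, where `l = k + 1`: simultaneous half rotations, counterclockwise about
`n + 1 + (k + 1/2) i` and clockwise about `n + 1 - (k + 1/2) i`, of discs of radius `1/2`. -/
def deltaCom (n k _l : ℕ) : Equiv.Perm ℂ :=
  rotation (1 / 2) ((n + 1 : ℂ) + (k + 1 / 2 : ℂ) * Complex.I) (1 / 2) *
    rotation (-(1 / 2)) ((n + 1 : ℂ) - (k + 1 / 2 : ℂ) * Complex.I) (1 / 2)

end RealCurve

end

noncomputable section

namespace RealCurve

/-! Both sides of the asserted identity move the model configuration at `x₀ - α` to the one at `x₀ +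
α`. Run the motion of the right side backwards, from the twisted model points to the model points,
and follow it by the motion of the left side: back along the segments of `β₁`, along the fibres over
the segment, out along the segments of `β₂`. This is a closed motion of `n` labelled points, and the
identity says that it is trivial as a braid.

It is trivial because it contracts linearly to one fixed configuration, the fibre over `x₀`. The
contraction `(1 - u) q + u c` avoids collisions as soon as no difference `q i - q j` is a
nonpositive real multiple of `c i - c j`, that is, as soon as the quotient lies in the slit plane
(`add_ne_zero_of_div_mem_slitPlane`). For points at different heights over `x₀` this holds since the
order of their heights never changes; for two real points, since the order of their real parts never
changes. What remains is the switching pair `a`, `b` and its conjugate. There `c a - c b` is a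
negative real, so `q a - q b` only has to avoid the positive reals. Over the interval its real part
is negative, along the model segments its imaginary part does not vanish, and during the twist it
turns through half a circle on the negative side exactly because the exponent is the orientation
(`twisted_difference`). If the orientation is `0`, nothing turns.

`sameMappingClass_of_motion` converts the contraction into an isotopy. `exists_family_of_motion`
realises the contraction at each time `t` by a diffeomorphism `B t` which depends only on the
motion, so `B 0 = B 1`; correcting the evident, but not configuration-preserving, family `J t` by
`(B 0)⁻¹ B t` fixes what it does to the points and leaves its ends unchanged. The input on the curve
is the continuity of the roots (`exists_local_roots`), the monotonicity of model points in height
(`modelPoint_im_lt`) and the reading of levels and orientation from the local roots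
(`eventually_levelsAt`, `LocalRoots.orientation_eq`). -/

/-! ### Pushing points by half twists -/

/-- The half twist exchanging `p` and `q`, supported near the segment between them. -/
def halfTwistFun (a : ℝ) (p q z : ℂ) : ℂ :=
  (p + q) / 2 + Complex.exp ((a * Real.smoothTransition
    ((2 * ‖q - p‖ ^ 2 - ‖z - (p + q) / 2‖ ^ 2) / ‖q - p‖ ^ 2) : ℝ) * Complex.I) *
      (z - (p + q) / 2)

/-- The cutoff depends only on the distance to the midpoint, which the rotation preserves, so
negating the angle inverts the map. -/
theorem halfTwistFun_neg_halfTwistFun (a : ℝ) (p q z : ℂ) :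
    halfTwistFun (-a) p q (halfTwistFun a p q z) = z := by
  have h : ‖halfTwistFun a p q z - (p + q) / 2‖ = ‖z - (p + q) / 2‖ := by
    simp only [halfTwistFun, add_sub_cancel_left, norm_mul, Complex.norm_exp_ofReal_mul_I, one_mul]
  rw [halfTwistFun, h, halfTwistFun, add_sub_cancel_left, ← mul_assoc, ← Complex.exp_add,
    ← add_mul, ← Complex.ofReal_add, ← add_mul]
  simp

def halfTwist (p q : ℂ) : Equiv.Perm ℂ where
  toFun := halfTwistFun Real.pi p q
  invFun := halfTwistFun (-Real.pi) p q
  left_inv := halfTwistFun_neg_halfTwistFun Real.pi p q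
  right_inv z := by simpa using halfTwistFun_neg_halfTwistFun (-Real.pi) p q z

/-- The cutoff is a function of the squared distance and is therefore smooth at the centre too. For
`p = q` the quotient is `0` by the convention on division, and the map is the identity. -/
theorem contDiff_halfTwistFun (a : ℝ) (p q : ℂ) : ContDiff ℝ ∞ (halfTwistFun a p q) := by
  unfold halfTwistFun
  have h1 : ContDiff ℝ ∞ fun z : ℂ => z - (p + q) / 2 := contDiff_id.sub contDiff_const
  have h2 : ContDiff ℝ ∞ fun z : ℂ => ‖z - (p + q) / 2‖ ^ 2 := h1.norm_sq ℝ
  have h3 : ContDiff ℝ ∞ fun z : ℂ => a * Real.smoothTransition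
    ((2 * ‖q - p‖ ^ 2 - ‖z - (p + q) / 2‖ ^ 2) / ‖q - p‖ ^ 2) :=
    contDiff_const.mul
      (Real.smoothTransition.contDiff.comp ((contDiff_const.sub h2).div_const _))
  have h4 := Complex.ofRealCLM.contDiff.comp h3
  exact contDiff_const.add (((h4.mul contDiff_const).cexp).mul h1)

/-- Such a `z` is at distance at least `3/2 * ‖q - p‖` from the midpoint, and `(3/2)² > 2` makes the
argument of the cutoff nonpositive. The degenerate case `p = q` is covered. -/
theorem halfTwistFun_of_le (a : ℝ) {p q z : ℂ} (h : 2 * ‖q - p‖ ≤ ‖z - p‖) :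
    halfTwistFun a p q z = z := by
  have h1 : ‖z - p‖ ≤ ‖z - (p + q) / 2‖ + ‖q - p‖ / 2 := by
    have e : z - p = (z - (p + q) / 2) + (q - p) / 2 := by ring
    have e2 : ‖(q - p) / 2‖ = ‖q - p‖ / 2 := by simp
    calc ‖z - p‖ = ‖(z - (p + q) / 2) + (q - p) / 2‖ := by rw [← e]
      _ ≤ _ := norm_add_le _ _
      _ = _ := by rw [e2]
  have h2 : (2 * ‖q - p‖ ^ 2 - ‖z - (p + q) / 2‖ ^ 2) / ‖q - p‖ ^ 2 ≤ 0 := by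
    apply div_nonpos_of_nonpos_of_nonneg _ (by positivity)
    nlinarith [norm_nonneg (q - p), norm_nonneg (z - (p + q) / 2)]
  rw [halfTwistFun, Real.smoothTransition.zero_of_nonpos h2]
  simp

theorem halfTwist_apply_left (p q : ℂ) : halfTwist p q p = q := by
  change halfTwistFun Real.pi p q p = q
  by_cases hpq : p = q
  · subst hpq; exact halfTwistFun_of_le _ (by simp)
  have h0 : 0 < ‖q - p‖ := norm_pos_iff.2 (sub_ne_zero.2 (Ne.symm hpq))
  have e : ‖p - (p + q) / 2‖ = ‖q - p‖ / 2 := by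
    rw [show p - (p + q) / 2 = -((q - p) / 2) by ring]; simp
  have h2 : 1 ≤ (2 * ‖q - p‖ ^ 2 - ‖p - (p + q) / 2‖ ^ 2) / ‖q - p‖ ^ 2 := by
    rw [e, le_div_iff₀ (by positivity)]; nlinarith
  rw [halfTwistFun, Real.smoothTransition.one_of_one_le h2, mul_one, Complex.exp_pi_mul_I]
  ring

/-- Gives continuity in `(p, q, z)` on the diagonal `p = q`, where the quotient inside the cutoff
has no limit. -/
theorem norm_halfTwistFun_sub_le (a : ℝ) (p q z : ℂ) :
    ‖halfTwistFun a p q z - z‖ ≤ 6 * ‖q - p‖ := by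
  rcases le_or_gt (2 * ‖q - p‖) ‖z - p‖ with h | h
  · rw [halfTwistFun_of_le a h]; simp
  · have hn : ‖halfTwistFun a p q z - (p + q) / 2‖ = ‖z - (p + q) / 2‖ := by
      simp only [halfTwistFun, add_sub_cancel_left, norm_mul, Complex.norm_exp_ofReal_mul_I,
        one_mul]
    have h1 : ‖z - (p + q) / 2‖ ≤ ‖z - p‖ + ‖q - p‖ / 2 := by
      have e : z - (p + q) / 2 = (z - p) - (q - p) / 2 := by ring
      have e2 : ‖(q - p) / 2‖ = ‖q - p‖ / 2 := by simp
      rw [e, ← e2]; exact norm_sub_le _ _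
    have h2 : ‖halfTwistFun a p q z - z‖ ≤
        ‖halfTwistFun a p q z - (p + q) / 2‖ + ‖z - (p + q) / 2‖ := by
      rw [← sub_sub_sub_cancel_right _ z ((p + q) / 2)]; exact norm_sub_le _ _
    linarith [norm_nonneg (q - p)]

theorem continuous_halfTwistFun (a : ℝ) :
    Continuous fun t : (ℂ × ℂ) × ℂ => halfTwistFun a t.1.1 t.1.2 t.2 := by
  rw [continuous_iff_continuousAt]
  rintro ⟨⟨p, q⟩, z⟩
  by_cases hpq : p = q
  · subst hpq
    have h0 : halfTwistFun a p p z = z := halfTwistFun_of_le _ (by simp)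
    have h1 : Tendsto (fun t : (ℂ × ℂ) × ℂ => halfTwistFun a t.1.1 t.1.2 t.2 - t.2)
        (𝓝 ((p, p), z)) (𝓝 0) := by
      refine squeeze_zero_norm (fun t => norm_halfTwistFun_sub_le a t.1.1 t.1.2 t.2) ?_
      have : Continuous fun t : (ℂ × ℂ) × ℂ => 6 * ‖t.1.2 - t.1.1‖ := by fun_prop
      simpa using this.tendsto ((p, p), z)
    have h2 : Tendsto (fun t : (ℂ × ℂ) × ℂ => t.2) (𝓝 ((p, p), z)) (𝓝 z) :=
      continuous_snd.tendsto _
    have h3 := h1.add h2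
    simp only [sub_add_cancel, zero_add] at h3
    simpa [ContinuousAt, h0] using h3
  · have hne : ‖q - p‖ ^ 2 ≠ 0 := by
      have := norm_pos_iff.2 (sub_ne_zero.2 (Ne.symm hpq)); positivity
    unfold halfTwistFun
    have h3 : ContinuousAt (fun t : (ℂ × ℂ) × ℂ =>
        (2 * ‖t.1.2 - t.1.1‖ ^ 2 - ‖t.2 - (t.1.1 + t.1.2) / 2‖ ^ 2) / ‖t.1.2 - t.1.1‖ ^ 2)
        ((p, q), z) :=
      ContinuousAt.div (by fun_prop) (by fun_prop) hne
    have h4 := (Real.smoothTransition.continuous.continuousAt.comp h3)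
    have h5 : ContinuousAt (fun t : (ℂ × ℂ) × ℂ =>
        ((a * Real.smoothTransition ((2 * ‖t.1.2 - t.1.1‖ ^ 2 -
          ‖t.2 - (t.1.1 + t.1.2) / 2‖ ^ 2) / ‖t.1.2 - t.1.1‖ ^ 2) : ℝ) : ℂ)) ((p, q), z) :=
      Complex.continuous_ofReal.continuousAt.comp (continuousAt_const.mul h4)
    exact ContinuousAt.add (by fun_prop)
      ((Complex.continuous_exp.continuousAt.comp (h5.mul continuousAt_const)).mul (by fun_prop))

/-- A continuous family of smooth permutations of the plane that are the identity off `U`. -/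
structure IsSupportedFamily {X : Type*} [TopologicalSpace X] (U : Set ℂ)
    (B : X → Equiv.Perm ℂ) : Prop where
  contDiff : ∀ s, ContDiff ℝ ∞ (B s)
  contDiff_symm : ∀ s, ContDiff ℝ ∞ (B s).symm
  eq_self : ∀ s, ∀ z ∉ U, B s z = z
  continuous : Continuous fun t : X × ℂ => B t.1 t.2

theorem IsSupportedFamily.one {X : Type*} [TopologicalSpace X] (U : Set ℂ) :
    IsSupportedFamily U (fun _ : X => (1 : Equiv.Perm ℂ)) :=
  ⟨fun _ => contDiff_id, fun _ => contDiff_id, fun _ _ _ => rfl, continuous_snd⟩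

theorem IsSupportedFamily.mul {X : Type*} [TopologicalSpace X] {U : Set ℂ}
    {A B : X → Equiv.Perm ℂ} (hA : IsSupportedFamily U A) (hB : IsSupportedFamily U B) :
    IsSupportedFamily U (fun s => A s * B s) where
  contDiff s := (hA.contDiff s).comp (hB.contDiff s)
  contDiff_symm s := (hB.contDiff_symm s).comp (hA.contDiff_symm s)
  eq_self s z hz := by rw [Equiv.Perm.mul_apply, hB.eq_self s z hz, hA.eq_self s z hz]
  continuous := hA.continuous.comp (continuous_fst.prodMk hB.continuous)

theorem isSupportedFamily_halfTwist {X : Type*} [TopologicalSpace X] {U : Set ℂ}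
    {p q : X → ℂ} (hp : Continuous p) (hq : Continuous q)
    (h : ∀ s, ∀ z ∉ U, 2 * ‖q s - p s‖ ≤ ‖z - p s‖) :
    IsSupportedFamily U (fun s => halfTwist (p s) (q s)) where
  contDiff _ := contDiff_halfTwistFun _ _ _
  contDiff_symm _ := contDiff_halfTwistFun _ _ _
  eq_self s z hz := halfTwistFun_of_le _ (h s z hz)
  continuous := (continuous_halfTwistFun Real.pi).comp
    (((hp.comp continuous_fst).prodMk (hq.comp continuous_fst)).prodMk continuous_snd)

/-- The points are moved one at a time. When the `j`-th moves, each other point is at `p s i` or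
already at `q s i`, hence at distance at least `3δ - δ = 2δ` from `p s j` and outside the support of
the twist. The last clause records that the construction sees only the positions, so that a closed
motion will give equal diffeomorphisms at its two ends. -/
theorem exists_family_of_close {X ι : Type*} [TopologicalSpace X] [Fintype ι] {U : Set ℂ}
    {δ : ℝ} {p q : X → ι → ℂ} (hp : Continuous p) (hq : Continuous q)
    (hU : ∀ s i, ∀ z ∉ U, 2 * δ ≤ ‖z - p s i‖)
    (hsep : ∀ s i j, i ≠ j → 3 * δ ≤ ‖p s i - p s j‖)
    (hclose : ∀ s i, ‖q s i - p s i‖ ≤ δ) :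
    ∃ B : X → Equiv.Perm ℂ, IsSupportedFamily U B ∧ (∀ s i, B s (p s i) = q s i) ∧
      ∀ s s', p s = p s' → q s = q s' → B s = B s' := by
  classical
  suffices H : ∀ J : Finset ι, ∃ B : X → Equiv.Perm ℂ, IsSupportedFamily U B ∧
      (∀ s i, B s (p s i) = if i ∈ J then q s i else p s i) ∧
      ∀ s s', p s = p s' → q s = q s' → B s = B s' by
    simpa using H Finset.univ
  intro J
  induction J using Finset.induction_on with
  | empty => exact ⟨fun _ => 1, IsSupportedFamily.one U, by simp, fun _ _ _ _ => rfl⟩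
  | insert j J hj ih =>
    obtain ⟨B, hB, hB1, hB2⟩ := ih
    refine ⟨fun s => halfTwist (p s j) (q s j) * B s, ?_, ?_, ?_⟩
    · refine IsSupportedFamily.mul (isSupportedFamily_halfTwist
        ((continuous_apply j).comp hp) ((continuous_apply j).comp hq) fun s z hz => ?_) hB
      linarith [hU s j z hz, hclose s j]
    · intro s i
      rw [Equiv.Perm.mul_apply, hB1]
      by_cases hij : i = j
      · subst hij
        simp [hj, halfTwist_apply_left]
      · simp only [Finset.mem_insert, hij, false_or]
        have h1 := hsep s i j hij
        have h2 := hclose s j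
        have h3 := hclose s i
        apply halfTwistFun_of_le
        split_ifs with hi
        · have : ‖p s i - p s j‖ ≤ ‖q s i - p s j‖ + ‖q s i - p s i‖ := by
            rw [← sub_sub_sub_cancel_left _ _ (q s i)]
            exact (norm_sub_le _ _).trans_eq (by rfl)
          linarith
        · linarith [norm_nonneg (q s j - p s j)]
    · intro s s' h1 h2
      simp only [h1, h2, hB2 s s' h1 h2]

/-- A continuous motion of finitely many distinct points inside an open set, parametrised by a
compact space, is followed by a continuous family of diffeomorphisms supported in that set. -/
theorem exists_family_of_motion {X ι : Type*} [TopologicalSpace X] [CompactSpace X] [Fintype ι]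
    {U : Set ℂ} (hUo : IsOpen U) {h : X → unitInterval → ι → ℂ}
    (hc : Continuous fun t : X × unitInterval => h t.1 t.2)
    (hinj : ∀ s u, Function.Injective (h s u)) (hU : ∀ s u i, h s u i ∈ U) :
    ∃ B : X → Equiv.Perm ℂ, IsSupportedFamily U B ∧ (∀ s i, B s (h s 0 i) = h s 1 i) ∧
      ∀ s s', h s = h s' → B s = B s' := by
  classical
  have hci : ∀ i, Continuous fun t : X × unitInterval => h t.1 t.2 i :=
    fun i => (continuous_apply i).comp hc
  have hsep : ∃ δ > 0, ∀ s u i j, i ≠ j → 3 * δ ≤ ‖h s u i - h s u j‖ := by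
    have H : ∀ ij : ι × ι, ∃ δ > 0, ij.1 ≠ ij.2 →
        ∀ t : X × unitInterval, 3 * δ ≤ ‖h t.1 t.2 ij.1 - h t.1 t.2 ij.2‖ := by
      rintro ⟨i, j⟩
      by_cases hij : i = j
      · exact ⟨1, one_pos, fun h => absurd hij h⟩
      obtain ⟨ε, hε, hε'⟩ := isCompact_univ.exists_forall_le'
        (f := fun t : X × unitInterval => ‖h t.1 t.2 i - h t.1 t.2 j‖) (a := 0)
        (((hci i).sub (hci j)).norm.continuousOn)
        (fun t _ => norm_pos_iff.2 (sub_ne_zero.2 fun e => hij (hinj _ _ e)))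
      exact ⟨ε / 3, by positivity, fun _ t => by
        have := hε' t (mem_univ _); simp only at this ⊢; linarith⟩
    choose d hd0 hd using H
    rcases isEmpty_or_nonempty ι with hι | hι
    · exact ⟨1, one_pos, fun _ _ i => hι.elim i⟩
    obtain ⟨m, hm⟩ := Finite.exists_min d
    refine ⟨d m, hd0 m, fun s u i j hij => ?_⟩
    linarith [hd (i, j) hij (s, u), hm (i, j)]
  have hbd : ∃ δ > 0, ∀ s u i, ∀ z ∉ U, 2 * δ ≤ ‖z - h s u i‖ := by
    let K : Set ℂ := range fun t : (X × unitInterval) × ι => h t.1.1 t.1.2 t.2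
    have hK : IsCompact K := by
      have : K = ⋃ i, range fun t : X × unitInterval => h t.1 t.2 i := by
        ext z; simp only [K, mem_range, mem_iUnion, Prod.exists]
        constructor
        · rintro ⟨s, u, i, e⟩; exact ⟨i, s, u, e⟩
        · rintro ⟨i, s, u, e⟩; exact ⟨s, u, i, e⟩
      rw [this]
      exact isCompact_iUnion fun i => isCompact_range (hci i)
    have hKU : K ⊆ U := by rintro _ ⟨t, rfl⟩; exact hU _ _ _
    obtain ⟨δ, hδ, hδ'⟩ := hK.exists_thickening_subset_open hUo hKU
    refine ⟨δ / 2, by positivity, fun s u i z hz => ?_⟩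
    by_contra! hlt
    refine hz (hδ' (Metric.mem_thickening_iff.2 ⟨h s u i, ⟨((s, u), i), rfl⟩, ?_⟩))
    rw [dist_eq_norm]; linarith
  obtain ⟨δ₁, hδ₁, hsep⟩ := hsep
  obtain ⟨δ₂, hδ₂, hbd⟩ := hbd
  set δ := min δ₁ δ₂
  have hδ : 0 < δ := lt_min hδ₁ hδ₂
  -- a uniform time step during which no point moves by more than `δ`
  have hstep : ∃ N : ℕ, 0 < N ∧ ∀ (u u' : unitInterval), |(u : ℝ) - u'| ≤ 1 / N →
      ∀ s i, ‖h s u' i - h s u i‖ ≤ δ := by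
    -- As a path in the space of continuous maps on the compact `X`, the motion is uniformly
    -- continuous in the sup norm, so one `N` serves every `s`.
    let g : unitInterval → C(X, ι → ℂ) := fun u =>
      ⟨fun s => h s u, hc.comp (continuous_id.prodMk continuous_const)⟩
    have hg : Continuous g :=
      ContinuousMap.continuous_of_continuous_uncurry g (hc.comp continuous_swap)
    have hgu := CompactSpace.uniformContinuous_of_continuous hg
    obtain ⟨η, hη, hη'⟩ := Metric.uniformContinuous_iff.1 hgu δ hδ
    obtain ⟨N, hN⟩ := exists_nat_one_div_lt hη
    refine ⟨N + 1, N.succ_pos, fun u u' huu s i => ?_⟩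
    have h1 : dist u' u < η := by
      rw [Subtype.dist_eq, dist_comm, Real.dist_eq]; push_cast at huu; linarith
    have h2 := ContinuousMap.dist_lt_iff hδ |>.1 (hη' h1) s
    have h3 := dist_le_pi_dist (g u' s) (g u s) i
    rw [dist_eq_norm] at h3
    exact h3.trans h2.le
  obtain ⟨N, hN, hstep⟩ := hstep
  have hN' : (0 : ℝ) < N := Nat.cast_pos.2 hN
  -- Clamping makes `v` constant from `N` on, so the induction below needs no bound on `k`.
  let v : ℕ → unitInterval := fun k => projIcc 0 1 zero_le_one ((k : ℝ) / N)
  have hv : ∀ k, |(v k : ℝ) - v (k + 1)| ≤ 1 / N := by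
    intro k
    have := abs_projIcc_sub_projIcc (a := (0 : ℝ)) (b := 1) (c := (k : ℝ) / N)
      (d := ((k + 1 : ℕ) : ℝ) / N) zero_le_one
    refine this.trans (le_of_eq ?_)
    rw [← sub_div, abs_div, abs_of_pos hN']; simp
  have H : ∀ k : ℕ, ∃ B : X → Equiv.Perm ℂ, IsSupportedFamily U B ∧
      (∀ s i, B s (h s (v 0) i) = h s (v k) i) ∧ ∀ s s', h s = h s' → B s = B s' := by
    intro k
    induction k with
    | zero => exact ⟨fun _ => 1, IsSupportedFamily.one U, fun _ _ => rfl, fun _ _ _ => rfl⟩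
    | succ k ih =>
      obtain ⟨B, hB, hB1, hB2⟩ := ih
      have hcv : ∀ k, Continuous fun s => h s (v k) := fun k =>
        hc.comp (continuous_id.prodMk continuous_const)
      obtain ⟨A, hA, hA1, hA2⟩ := exists_family_of_close (U := U) (δ := δ) (hcv k) (hcv (k + 1))
        (fun s i z hz => (mul_le_mul_of_nonneg_left (min_le_right δ₁ δ₂) two_pos.le).trans
          (hbd s _ i z hz))
        (fun s i j hij => (mul_le_mul_of_nonneg_left (min_le_left δ₁ δ₂) three_pos.le).trans
          (hsep s _ i j hij))
        (fun s i => hstep _ _ (hv k) s i)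
      refine ⟨fun s => A s * B s, hA.mul hB, fun s i => ?_, fun s s' e => ?_⟩
      · rw [Equiv.Perm.mul_apply, hB1, hA1]
      · simp only [hB2 s s' e, hA2 s s' (congrFun e _) (congrFun e _)]
  obtain ⟨B, hB, hB1, hB2⟩ := H N
  have hv0 : v 0 = 0 := by simp [v]
  have hvN : v N = 1 := by simp [v, hN'.ne']
  exact ⟨B, hB, by simpa [hv0, hvN] using hB1, hB2⟩

/-! ### Diffeomorphisms of discs -/

theorem IsDiffeo.symm {e : PartialEquiv ℂ ℂ} {U V : Set ℂ} (h : IsDiffeo e U V) :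
    IsDiffeo e.symm V U :=
  ⟨h.target_eq, h.source_eq, h.smooth_symm, by simpa using h.smooth⟩

theorem IsDiffeo.mapsTo {e : PartialEquiv ℂ ℂ} {U V : Set ℂ} (h : IsDiffeo e U V) :
    MapsTo e U V := by
  have := e.mapsTo
  rwa [h.source_eq, h.target_eq] at this

theorem IsDiffeo.left_inv {e : PartialEquiv ℂ ℂ} {U V : Set ℂ} (h : IsDiffeo e U V) {z : ℂ}
    (hz : z ∈ U) : e.symm (e z) = z :=
  e.left_inv (by rwa [h.source_eq])

theorem IsDiffeo.right_inv {e : PartialEquiv ℂ ℂ} {U V : Set ℂ} (h : IsDiffeo e U V) {z : ℂ}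
    (hz : z ∈ V) : e (e.symm z) = z :=
  e.right_inv (by rwa [h.target_eq])

theorem IsDiffeo.injOn {e : PartialEquiv ℂ ℂ} {U V : Set ℂ} (h : IsDiffeo e U V) :
    InjOn e U := by
  have := e.injOn
  rwa [h.source_eq] at this

theorem IsDiffeo.trans {e e' : PartialEquiv ℂ ℂ} {U V W : Set ℂ} (h : IsDiffeo e U V)
    (h' : IsDiffeo e' V W) : IsDiffeo (e.trans e') U W where
  source_eq := by
    rw [PartialEquiv.trans_source, h.source_eq, h'.source_eq]
    exact inter_eq_left.2 h.mapsTo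
  target_eq := by
    rw [PartialEquiv.trans_target, h.target_eq, h'.target_eq]
    exact inter_eq_left.2 h'.symm.mapsTo
  smooth := h'.smooth.comp h.smooth h.mapsTo
  smooth_symm := h.smooth_symm.comp h'.smooth_symm h'.symm.mapsTo

/-- The derivative of `e` at an interior point is invertible, so `e` is open there by the inverse
function theorem and its value has a neighbourhood inside the target disc. -/
theorem IsDiffeo.mem_ball {e : PartialEquiv ℂ ℂ} {c c' : ℂ} {r r' : ℝ} (hr' : 0 < r')
    (h : IsDiffeo e (Metric.closedBall c r) (Metric.closedBall c' r')) {z : ℂ}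
    (hz : z ∈ Metric.ball c r) : e z ∈ Metric.ball c' r' := by
  have hnhds : Metric.closedBall c r ∈ 𝓝 z :=
    mem_of_superset (Metric.isOpen_ball.mem_nhds hz) Metric.ball_subset_closedBall
  have hzc : z ∈ Metric.closedBall c r := Metric.ball_subset_closedBall hz
  have hs : ContDiffAt ℝ ∞ e z := h.smooth.contDiffAt hnhds
  have h1 : HasStrictFDerivAt e (fderiv ℝ e z) z := hs.hasStrictFDerivAt (by simp)
  -- A priori `e z` may lie on the boundary circle, so only a derivative within the closed disc is
  -- available; it is enough for a left inverse of `fderiv ℝ e z`.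
  have h2 : HasFDerivWithinAt e.symm (fderivWithin ℝ e.symm (Metric.closedBall c' r') (e z))
      (Metric.closedBall c' r') (e z) :=
    ((h.smooth_symm.differentiableOn (by simp)) _ (h.mapsTo hzc)).hasFDerivWithinAt
  have h3 := h2.comp z (h1.hasFDerivAt.hasFDerivWithinAt (s := Metric.closedBall c r)) h.mapsTo
  have h4 : HasFDerivAt (e.symm ∘ e) (ContinuousLinearMap.id ℝ ℂ) z :=
    (hasFDerivAt_id z).congr_of_eventuallyEq
      (mem_of_superset hnhds fun w hw => h.left_inv hw)
  have h5 := (h3.hasFDerivAt hnhds).unique h4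
  have hinj : Function.Injective (fderiv ℝ e z : ℂ →ₗ[ℝ] ℂ) := by
    refine Function.LeftInverse.injective
      (g := fderivWithin ℝ e.symm (Metric.closedBall c' r') (e z)) fun w => ?_
    exact DFunLike.congr_fun h5 w
  have hsurj : (fderiv ℝ e z).range = ⊤ :=
    LinearMap.range_eq_top.2 (LinearMap.injective_iff_surjective.1 hinj)
  have h6 := h1.map_nhds_eq_of_surj hsurj
  rw [← interior_closedBall _ hr'.ne', mem_interior_iff_mem_nhds, ← h6]
  exact mem_map.2 (mem_of_superset hnhds h.mapsTo)

theorem IsDiffeo.mem_sphere {e : PartialEquiv ℂ ℂ} {c c' : ℂ} {r r' : ℝ} (hr : 0 < r)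
    (h : IsDiffeo e (Metric.closedBall c r) (Metric.closedBall c' r')) {z : ℂ}
    (hz : z ∈ Metric.sphere c r) : e z ∈ Metric.sphere c' r' := by
  have hzc := Metric.sphere_subset_closedBall hz
  have h1 := h.mapsTo hzc
  rw [Metric.mem_sphere]
  refine le_antisymm h1 (not_lt.1 fun hlt => ?_)
  have h2 := h.symm.mem_ball hr (z := e z) hlt
  rw [h.left_inv hzc, Metric.mem_ball, Metric.mem_sphere.1 hz] at h2
  exact lt_irrefl _ h2

/-! ### Families of diffeomorphisms of discs -/

/-- A continuous family, parametrised by `S`, of diffeomorphisms of a closed disc that are the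
identity on the boundary. -/
structure IsDiscFamily (c : ℂ) (r : ℝ) (S : Set ℝ) (F : ℝ → PartialEquiv ℂ ℂ) : Prop where
  isDiffeo : ∀ s ∈ S, IsDiffeo (F s) (Metric.closedBall c r) (Metric.closedBall c r)
  boundary : ∀ s ∈ S, ∀ z ∈ Metric.sphere c r, F s z = z
  continuousOn : ContinuousOn (fun p : ℝ × ℂ => F p.1 p.2) (S ×ˢ Metric.closedBall c r)

theorem IsDiscFamily.trans {c : ℂ} {r : ℝ} {S : Set ℝ} {F G : ℝ → PartialEquiv ℂ ℂ}
    (hF : IsDiscFamily c r S F) (hG : IsDiscFamily c r S G) :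
    IsDiscFamily c r S (fun s => (F s).trans (G s)) where
  isDiffeo s hs := (hF.isDiffeo s hs).trans (hG.isDiffeo s hs)
  boundary s hs z hz := by
    rw [PartialEquiv.coe_trans, Function.comp_apply, hF.boundary s hs z hz,
      hG.boundary s hs z hz]
  continuousOn := hG.continuousOn.comp (continuousOn_fst.prodMk hF.continuousOn)
    fun p hp => ⟨hp.1, (hF.isDiffeo p.1 hp.1).mapsTo hp.2⟩

theorem IsDiscFamily.comp {c : ℂ} {r : ℝ} {S T : Set ℝ} {F : ℝ → PartialEquiv ℂ ℂ}
    (hF : IsDiscFamily c r S F) {φ : ℝ → ℝ} (hφ : ContinuousOn φ T) (h : MapsTo φ T S) :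
    IsDiscFamily c r T (fun s => F (φ s)) where
  isDiffeo _ hs := hF.isDiffeo _ (h hs)
  boundary _ hs := hF.boundary _ (h hs)
  continuousOn := hF.continuousOn.comp
    ((hφ.comp continuousOn_fst fun _ hp => hp.1).prodMk continuousOn_snd)
    fun _ hp => ⟨h hp.1, hp.2⟩

theorem IsDiscFamily.conj {c c' : ℂ} {r r' : ℝ} (hr : 0 < r) {S : Set ℝ}
    {F : ℝ → PartialEquiv ℂ ℂ} (hF : IsDiscFamily c' r' S F) {e : PartialEquiv ℂ ℂ}
    (he : IsDiffeo e (Metric.closedBall c r) (Metric.closedBall c' r')) :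
    IsDiscFamily c r S (fun s => (e.trans (F s)).trans e.symm) where
  isDiffeo s hs := (he.trans (hF.isDiffeo s hs)).trans he.symm
  boundary s hs z hz := by
    simp only [PartialEquiv.coe_trans, Function.comp_apply]
    rw [hF.boundary s hs _ (he.mem_sphere hr hz),
      he.left_inv (Metric.sphere_subset_closedBall hz)]
  continuousOn := by
    refine he.smooth_symm.continuousOn.comp (hF.continuousOn.comp
      (continuousOn_fst.prodMk (he.smooth.continuousOn.comp continuousOn_snd fun p hp => hp.2))
      fun p hp => ⟨hp.1, he.mapsTo hp.2⟩) fun p hp => ?_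
    exact (hF.isDiffeo p.1 hp.1).mapsTo (he.mapsTo hp.2)

theorem isDiffeo_toPartialEquivOfImageEq {g : Equiv.Perm ℂ} {U : Set ℂ} (h : g '' U = U)
    (h1 : ContDiff ℝ ∞ g) (h2 : ContDiff ℝ ∞ g.symm) :
    IsDiffeo (g.toPartialEquivOfImageEq U U h) U U :=
  ⟨rfl, rfl, h1.contDiffOn, h2.contDiffOn⟩

theorem image_eq_of_eq_self {g : Equiv.Perm ℂ} {U V : Set ℂ} (hUV : U ⊆ V)
    (h : ∀ z ∉ U, g z = z) : g '' V = V := by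
  have key : ∀ z, z ∈ V ↔ g z ∈ V := by
    intro z
    by_cases hz : z ∈ U
    · refine iff_of_true (hUV hz) (hUV ?_)
      by_contra hgz
      exact hgz (by rwa [g.injective (h _ hgz)])
    · rw [h z hz]
  ext w
  constructor
  · rintro ⟨z, hz, rfl⟩; exact (key z).1 hz
  · intro hw; exact ⟨g.symm w, (key _).2 (by simpa using hw), by simp⟩

theorem IsSupportedFamily.image_closedBall {X : Type*} [TopologicalSpace X] {c : ℂ} {r : ℝ}
    {B : X → Equiv.Perm ℂ} (hB : IsSupportedFamily (Metric.ball c r) B) (s : X) :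
    B s '' Metric.closedBall c r = Metric.closedBall c r :=
  image_eq_of_eq_self Metric.ball_subset_closedBall (hB.eq_self s)

theorem IsSupportedFamily.isDiscFamily {X : Type*} [TopologicalSpace X] {c : ℂ} {r : ℝ}
    {B : X → Equiv.Perm ℂ} (hB : IsSupportedFamily (Metric.ball c r) B) {φ : ℝ → X}
    (hφ : Continuous φ) (S : Set ℝ) :
    IsDiscFamily c r S (fun s => (B (φ s)).toPartialEquivOfImageEq _ _
      (hB.image_closedBall (φ s))) where
  isDiffeo _ _ := isDiffeo_toPartialEquivOfImageEq _ (hB.contDiff _) (hB.contDiff_symm _)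
  boundary s _ z hz := hB.eq_self (φ s) z fun h => (Metric.mem_ball.1 h).ne hz
  continuousOn := (hB.continuous.comp
    ((hφ.comp continuous_fst).prodMk continuous_snd)).continuousOn

/-- The inverses of a continuous family of homeomorphisms of a compact set onto varying sets form
a continuous family. -/
theorem continuousOn_symm_family {K : Set ℂ} (hK : IsCompact K) {I : Set ℝ} (hI : IsCompact I)
    {F : ℝ → PartialEquiv ℂ ℂ} (hsrc : ∀ t ∈ I, (F t).source = K)
    (hc : ContinuousOn (fun p : ℝ × ℂ => F p.1 p.2) (I ×ˢ K)) :
    ContinuousOn (fun p : ℝ × ℂ => (F p.1).symm p.2) {p | p.1 ∈ I ∧ p.2 ∈ (F p.1).target} := by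
  have hcomp : CompactSpace ↥(I ×ˢ K) := isCompact_iff_compactSpace.1 (hI.prod hK)
  let G : ↥(I ×ˢ K) → ℝ × ℂ := fun p => (p.1.1, F p.1.1 p.1.2)
  have hG : Continuous G :=
    (continuous_fst.comp continuous_subtype_val).prodMk (continuousOn_iff_continuous_domRestrict.1 hc)
  have hinj : Function.Injective G := by
    rintro ⟨⟨t, z⟩, ht, hz⟩ ⟨⟨t', z'⟩, ht', hz'⟩ h
    obtain rfl : t = t' := congrArg Prod.fst h
    obtain rfl : z = z' := (F t).injOn (by rw [hsrc t ht]; exact hz)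
      (by rw [hsrc t ht]; exact hz') (congrArg Prod.snd h)
    rfl
  -- A continuous injection of a compact space into a Hausdorff space is an embedding, so continuity
  -- of the inverse family may be tested after composing with `G`.
  have hemb := (hG.isClosedEmbedding hinj).isEmbedding
  rw [continuousOn_iff_continuous_domRestrict]
  let φ : ↥{p : ℝ × ℂ | p.1 ∈ I ∧ p.2 ∈ (F p.1).target} → ↥(I ×ˢ K) := fun p =>
    ⟨(p.1.1, (F p.1.1).symm p.1.2), p.2.1, by
      rw [← hsrc _ p.2.1]; exact (F p.1.1).map_target p.2.2⟩
  have hφ : Continuous φ := by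
    rw [hemb.continuous_iff]
    have : G ∘ φ = Subtype.val := by
      funext p
      exact Prod.ext rfl ((F p.1.1).right_inv p.2.2)
    rw [this]; exact continuous_subtype_val
  exact continuous_snd.comp (continuous_subtype_val.comp hφ)

/-- A continuous family of diffeomorphisms from a disc onto the discs interpolating between it and
a second disc, with prescribed values on the boundary. -/
structure IsDiscPath (c : ℂ) (r : ℝ) (m : ℂ) (R : ℝ) (b : ℝ → ℂ → ℂ)
    (F : ℝ → PartialEquiv ℂ ℂ) : Prop where
  isDiffeo : ∀ t ∈ Icc (0 : ℝ) 1, IsDiffeo (F t) (Metric.closedBall c r)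
    (Metric.closedBall ((1 - t) * c + t * m) ((1 - t) * r + t * R))
  boundary : ∀ t ∈ Icc (0 : ℝ) 1, ∀ z ∈ Metric.sphere c r, F t z = b t z
  continuousOn : ContinuousOn (fun p : ℝ × ℂ => F p.1 p.2)
    (Icc (0 : ℝ) 1 ×ˢ Metric.closedBall c r)
  start : EqOn (F 0) id (Metric.closedBall c r)

theorem IsDiscPath.continuousOn_symm {c m : ℂ} {r R : ℝ} {b : ℝ → ℂ → ℂ}
    {F : ℝ → PartialEquiv ℂ ℂ} (hF : IsDiscPath c r m R b F) :
    ContinuousOn (fun p : ℝ × ℂ => (F p.1).symm p.2) {p | p.1 ∈ Icc (0 : ℝ) 1 ∧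
      p.2 ∈ Metric.closedBall ((1 - p.1) * c + p.1 * m) ((1 - p.1) * r + p.1 * R)} := by
  refine (continuousOn_symm_family (isCompact_closedBall c r) isCompact_Icc
    (fun t ht => (hF.isDiffeo t ht).source_eq) hF.continuousOn).mono ?_
  rintro p ⟨hp1, hp2⟩
  exact ⟨hp1, by rw [(hF.isDiffeo _ hp1).target_eq]; exact hp2⟩

theorem IsDiscPath.symm_zero {c m : ℂ} {r R : ℝ} {b : ℝ → ℂ → ℂ}
    {F : ℝ → PartialEquiv ℂ ℂ} (hF : IsDiscPath c r m R b F) {z : ℂ}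
    (hz : z ∈ Metric.closedBall c r) : (F 0).symm z = z := by
  have h := (hF.isDiffeo 0 (by simp)).left_inv hz
  rwa [hF.start hz] at h

/-- This is the use of the common boundary family `b`: it cancels, and the comparison of two models
fixes the circle. -/
theorem IsDiscPath.trans_symm {c m : ℂ} {r R : ℝ} {b : ℝ → ℂ → ℂ} {F G : ℝ → PartialEquiv ℂ ℂ}
    (hF : IsDiscPath c r m R b F) (hG : IsDiscPath c r m R b G) :
    IsDiscFamily c r (Icc 0 1) (fun t => (G t).trans (F t).symm) where
  isDiffeo t ht := (hG.isDiffeo t ht).trans (hF.isDiffeo t ht).symm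
  boundary t ht z hz := by
    rw [PartialEquiv.coe_trans, Function.comp_apply, hG.boundary t ht z hz,
      ← hF.boundary t ht z hz,
      (hF.isDiffeo t ht).left_inv (Metric.sphere_subset_closedBall hz)]
  continuousOn := hF.continuousOn_symm.comp (continuousOn_fst.prodMk hG.continuousOn)
    fun p hp => ⟨hp.1, (hG.isDiffeo p.1 hp.1).mapsTo hp.2⟩

theorem combo_mem_ball {c m p q : ℂ} {r R t : ℝ} (ht : t ∈ Icc (0 : ℝ) 1)
    (hp : p ∈ Metric.ball c r) (hq : q ∈ Metric.ball m R) :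
    (1 - t) * p + t * q ∈ Metric.ball ((1 - t) * c + t * m) ((1 - t) * r + t * R) := by
  rw [Metric.mem_ball, dist_eq_norm] at *
  have e : (1 - t) * p + t * q - ((1 - t) * c + t * m) =
      ((1 - t : ℝ) : ℂ) * (p - c) + (t : ℂ) * (q - m) := by push_cast; ring
  have h1 := norm_add_le (((1 - t : ℝ) : ℂ) * (p - c)) ((t : ℂ) * (q - m))
  rw [norm_mul, norm_mul, Complex.norm_real, Complex.norm_real, Real.norm_of_nonneg ht.1,
    Real.norm_of_nonneg (by linarith [ht.2])] at h1
  rw [e]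
  -- The strict inequality comes from `p` alone when `t = 0`.
  rcases eq_or_lt_of_le ht.1 with h0 | h0
  · subst h0; simp only [sub_zero, one_mul, zero_mul, add_zero] at h1 ⊢; linarith
  · nlinarith [ht.2]

/-! ### Contracting a closed motion of points -/

/-- The value of `x` clamped to the unit interval. -/
def clamp (x : ℝ) : ℝ := max 0 (min 1 x)

theorem clamp_mem (x : ℝ) : clamp x ∈ Icc (0 : ℝ) 1 :=
  ⟨le_max_left _ _, max_le zero_le_one (min_le_left _ _)⟩

theorem continuous_clamp : Continuous clamp :=
  continuous_const.max (continuous_const.min continuous_id)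

theorem clamp_of_nonpos {x : ℝ} (h : x ≤ 0) : clamp x = 0 := by
  rw [clamp, min_eq_right (by linarith), max_eq_left h]

theorem clamp_of_one_le {x : ℝ} (h : 1 ≤ x) : clamp x = 1 := by
  rw [clamp, min_eq_left h, max_eq_right zero_le_one]

/-- The slit plane is star-shaped about `1` and omits `0`; divide by `v`. -/
theorem add_ne_zero_of_div_mem_slitPlane {w v : ℂ} {u : ℝ} (hu : u ∈ Icc (0 : ℝ) 1)
    (h : w / v ∈ Complex.slitPlane) : (1 - u) * w + u * v ≠ 0 := by
  have hv : v ≠ 0 := by rintro rfl; simp at h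
  have h1 : (1 - u) • (w / v) + u • (1 : ℂ) ∈ Complex.slitPlane := by
    have := Complex.starConvex_one_slitPlane h hu.1 (sub_nonneg.2 hu.2) (by ring)
    rwa [add_comm] at this
  intro h0
  refine Complex.slitPlane_ne_zero h1 ?_
  have : (1 - u) • (w / v) + u • (1 : ℂ) = ((1 - u) * w + u * v) / v := by
    rw [Complex.real_smul, Complex.real_smul, add_div, mul_div_assoc, mul_div_assoc,
      div_self hv]
    push_cast; ring
  rw [this, h0, zero_div]

/-- Suppose that `F₁`, `F₂` move `n` points in a disc along straight segments to model points, that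
`Φ` carries the first set of points to the second and that `Q` is a motion of the model disc. If
along the resulting closed motion no difference of two points becomes a nonpositive multiple of a
fixed reference difference, then the closed motion is trivial as a mapping class. -/
theorem sameMappingClass_of_motion {ι : Type*} [Fintype ι] {c m : ℂ} {r R : ℝ} (hr : 0 < r)
    (hR : 0 < R) {b : ℝ → ℂ → ℂ} {F₁ F₂ Φ : ℝ → PartialEquiv ℂ ℂ} {Q : ℝ → Equiv.Perm ℂ}
    (hF₁ : IsDiscPath c r m R b F₁) (hF₂ : IsDiscPath c r m R b F₂)
    (hΦ : IsDiscFamily c r (Icc 0 1) Φ) (hΦ0 : EqOn (Φ 0) id (Metric.closedBall c r))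
    (hQ : IsSupportedFamily (Metric.ball m R) Q) (hQ0 : Q 0 = 1)
    {l : ℝ → ι → ℂ} {m₁ m₂ c₀ : ι → ℂ} (hl : ContinuousOn l (Icc 0 1))
    (hlD : ∀ t ∈ Icc (0 : ℝ) 1, ∀ i, l t i ∈ Metric.ball c r)
    (hc₀D : ∀ i, c₀ i ∈ Metric.ball c r)
    (hm₁D : ∀ i, m₁ i ∈ Metric.ball m R) (hm₂D : ∀ i, m₂ i ∈ Metric.ball m R)
    (hF₁l : ∀ t ∈ Icc (0 : ℝ) 1, ∀ i, F₁ t (l 0 i) = (1 - t) * l 0 i + t * m₁ i)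
    (hF₂l : ∀ t ∈ Icc (0 : ℝ) 1, ∀ i, F₂ t (l 1 i) = (1 - t) * l 1 i + t * m₂ i)
    (hΦl : ∀ t ∈ Icc (0 : ℝ) 1, ∀ i, Φ t (l 0 i) = l t i)
    (hQm : ∀ i, Q 1 (m₁ i) = m₂ i) (hrange : range m₁ = range m₂)
    (hs₀ : ∀ t ∈ Icc (0 : ℝ) 1, ∀ i j, i ≠ j →
      (Q t (m₁ i) - Q t (m₁ j)) / (c₀ i - c₀ j) ∈ Complex.slitPlane)
    (hs₁ : ∀ t ∈ Icc (0 : ℝ) 1, ∀ i j, i ≠ j →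
      ((1 - t) * (l 0 i - l 0 j) + t * (m₁ i - m₁ j)) / (c₀ i - c₀ j) ∈ Complex.slitPlane)
    (hs₂ : ∀ t ∈ Icc (0 : ℝ) 1, ∀ i j, i ≠ j →
      (l t i - l t j) / (c₀ i - c₀ j) ∈ Complex.slitPlane)
    (hs₃ : ∀ t ∈ Icc (0 : ℝ) 1, ∀ i j, i ≠ j →
      ((1 - t) * (l 1 i - l 1 j) + t * (m₂ i - m₂ j)) / (c₀ i - c₀ j) ∈ Complex.slitPlane) :
    SameMappingClass m R (range m₁) (Q 1) (((F₁ 1).symm.trans (Φ 1)).trans (F₂ 1)) := by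
  have h01 : (1 : ℝ) ∈ Icc (0 : ℝ) 1 := by simp
  have h00 : (0 : ℝ) ∈ Icc (0 : ℝ) 1 := by simp
  have hβ : IsDiffeo (F₁ 1) (Metric.closedBall c r) (Metric.closedBall m R) := by
    simpa using hF₁.isDiffeo 1 h01
  have hβ₂ : IsDiffeo (F₂ 1) (Metric.closedBall c r) (Metric.closedBall m R) := by
    simpa using hF₂.isDiffeo 1 h01
  have hsub : ∀ {x z : ℂ} {s : ℝ}, z ∈ Metric.ball x s → z ∈ Metric.closedBall x s :=
    fun h => Metric.ball_subset_closedBall h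
  -- Timetable in quarters: `ρ` falls and undoes `Q`; `τ` falls from the model disc to `D` along the
  -- segments of `F₁`; `σ` rises along `l`; `τ` rises, together with `τ₂`, along the segments of
  -- `F₂`. Here `τ` is the position between `D` at `0` and the model disc at `1`.
  set ρ : ℝ → ℝ := fun t => clamp (1 - 4 * t) with hρ
  set σ : ℝ → ℝ := fun t => clamp (4 * t - 2) with hσ
  set τ₂ : ℝ → ℝ := fun t => clamp (4 * t - 3) with hτ₂
  set τ : ℝ → ℝ := fun t => max (clamp (2 - 4 * t)) (clamp (4 * t - 3)) with hτ
  have hρc : Continuous ρ := continuous_clamp.comp (by fun_prop)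
  have hσc : Continuous σ := continuous_clamp.comp (by fun_prop)
  have hτ₂c : Continuous τ₂ := continuous_clamp.comp (by fun_prop)
  have hτc : Continuous τ :=
    (continuous_clamp.comp (by fun_prop)).max (continuous_clamp.comp (by fun_prop))
  have hρm : ∀ t, ρ t ∈ Icc (0 : ℝ) 1 := fun t => clamp_mem _
  have hσm : ∀ t, σ t ∈ Icc (0 : ℝ) 1 := fun t => clamp_mem _
  have hτ₂m : ∀ t, τ₂ t ∈ Icc (0 : ℝ) 1 := fun t => clamp_mem _
  have hτm : ∀ t, τ t ∈ Icc (0 : ℝ) 1 := fun t =>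
    ⟨(clamp_mem _).1.trans (le_max_left _ _), max_le (clamp_mem _).2 (clamp_mem _).2⟩
  -- the points of the closed motion
  set q : ℝ → ι → ℂ := fun t i =>
    (1 - τ t) * l (σ t) i + τ t * ((1 - σ t) * Q (ρ t) (m₁ i) + σ t * m₂ i) with hq
  have cases4 : ∀ t ∈ Icc (0 : ℝ) 1,
      (τ t = 1 ∧ σ t = 0 ∧ τ₂ t = 0) ∨ (ρ t = 0 ∧ σ t = 0 ∧ τ₂ t = 0) ∨
      (ρ t = 0 ∧ τ t = 0 ∧ τ₂ t = 0) ∨ (ρ t = 0 ∧ σ t = 1 ∧ τ₂ t = τ t) := by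
    intro t ht
    rcases le_total t (1 / 4) with h1 | h1
    · left
      have e1 : clamp (2 - 4 * t) = 1 := clamp_of_one_le (by linarith)
      have e2 : clamp (4 * t - 3) = 0 := clamp_of_nonpos (by linarith)
      have e3 : clamp (4 * t - 2) = 0 := clamp_of_nonpos (by linarith)
      simp [hτ, hσ, hτ₂, e1, e2, e3]
    have e0 : clamp (1 - 4 * t) = 0 := clamp_of_nonpos (by linarith)
    rcases le_total t (1 / 2) with h2 | h2
    · right; left
      have e2 : clamp (4 * t - 3) = 0 := clamp_of_nonpos (by linarith)
      have e3 : clamp (4 * t - 2) = 0 := clamp_of_nonpos (by linarith)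
      simp [hρ, hσ, hτ₂, e0, e2, e3]
    have e1 : clamp (2 - 4 * t) = 0 := clamp_of_nonpos (by linarith)
    rcases le_total t (3 / 4) with h3 | h3
    · right; right; left
      have e2 : clamp (4 * t - 3) = 0 := clamp_of_nonpos (by linarith)
      simp [hρ, hτ, hτ₂, e0, e1, e2]
    · right; right; right
      have e3 : clamp (4 * t - 2) = 1 := clamp_of_one_le (by linarith)
      simp [hρ, hσ, hτ, hτ₂, e0, e1, e3, (clamp_mem (4 * t - 3)).1]
  have hqs : ∀ t ∈ Icc (0 : ℝ) 1, ∀ i j, i ≠ j →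
      (q t i - q t j) / (c₀ i - c₀ j) ∈ Complex.slitPlane := by
    intro t ht i j hij
    simp only [hq]
    rcases cases4 t ht with ⟨a1, a2, -⟩ | ⟨a1, a2, -⟩ | ⟨a1, a2, -⟩ | ⟨a1, a2, -⟩
    · simpa [a1, a2] using hs₀ (ρ t) (hρm t) i j hij
    · have := hs₁ (τ t) (hτm t) i j hij
      rw [a1, a2, hQ0]
      convert this using 2
      simp only [Equiv.Perm.one_apply]; push_cast; ring
    · simpa [a1, a2] using hs₂ (σ t) (hσm t) i j hij
    · have := hs₃ (τ t) (hτm t) i j hij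
      rw [a1, a2, hQ0]
      convert this using 2
      push_cast; ring
  have hQD : ∀ t i, Q t (m₁ i) ∈ Metric.ball m R := by
    intro t i
    by_contra h
    have := (Q t).injective (hQ.eq_self t _ h)
    rw [this] at h
    exact h (hm₁D i)
  have hqD : ∀ t, ∀ i, q t i ∈ Metric.ball ((1 - τ t) * c + τ t * m)
      ((1 - τ t) * r + τ t * R) := by
    intro t i
    refine combo_mem_ball (hτm t) (hlD _ (hσm t) i) ?_
    have := combo_mem_ball (hσm t) (hQD (ρ t) i) (hm₂D i)
    convert this using 1
    congr 1 <;> ring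
  have hqc : Continuous q := by
    refine continuous_pi fun i => ?_
    have h1 : Continuous fun t => l (σ t) i :=
      (continuous_apply i).comp (hl.comp_continuous hσc hσm)
    have h2 : Continuous fun t => Q (ρ t) (m₁ i) :=
      hQ.continuous.comp (hρc.prodMk continuous_const)
    have h3 : Continuous fun t => ((τ t : ℝ) : ℂ) := Complex.continuous_ofReal.comp hτc
    have h4 : Continuous fun t => ((σ t : ℝ) : ℂ) := Complex.continuous_ofReal.comp hσc
    exact ((continuous_const.sub h3).mul h1).add
      (h3.mul (((continuous_const.sub h4).mul h2).add (h4.mul continuous_const)))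
  -- contraction of the closed motion
  let pt : ℝ → unitInterval → ι → ℂ := fun t u i => (1 - (u : ℝ)) * q t i + (u : ℝ) * c₀ i
  -- As `q t` lies in the disc at position `τ t` and `c₀` in the disc at position `0`, their
  -- combination lies in the disc at this position, and the inverse of `F₁ (tm t u)` brings it back
  -- to `D`.
  let tm : ℝ → unitInterval → ℝ := fun t u => (1 - u) * τ t
  have htm : ∀ t u, tm t u ∈ Icc (0 : ℝ) 1 := fun t u =>
    ⟨mul_nonneg (sub_nonneg.2 u.2.2) (hτm t).1,
      mul_le_one₀ (by linarith [u.2.1]) (hτm t).1 (hτm t).2⟩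
  have hpt : ∀ t u i, pt t u i ∈ Metric.ball ((1 - tm t u) * c + tm t u * m)
      ((1 - tm t u) * r + tm t u * R) := by
    intro t u i
    convert combo_mem_ball u.2 (hqD t i) (hc₀D i) using 1
    congr 1
    · simp only [tm]; push_cast; ring
    · simp only [tm]; ring
  let h : unitInterval → unitInterval → ι → ℂ := fun t u i => (F₁ (tm t u)).symm (pt t u i)
  have hc : Continuous fun p : unitInterval × unitInterval => h p.1 p.2 := by
    refine continuous_pi fun i => ?_
    have h1 : Continuous fun p : unitInterval × unitInterval => tm p.1 p.2 := by
      simp only [tm]; fun_prop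
    have h2 : Continuous fun p : unitInterval × unitInterval => pt p.1 p.2 i := by
      have : Continuous fun p : unitInterval × unitInterval => q p.1 i :=
        (continuous_apply i).comp (hqc.comp (by fun_prop))
      simp only [pt]
      fun_prop
    exact hF₁.continuousOn_symm.comp_continuous (h1.prodMk h2)
      fun p => ⟨htm _ _, hsub (hpt _ _ _)⟩
  have hinj : ∀ t u, Function.Injective (h t u) := by
    intro t u i j hij
    by_contra hne
    have h1 := (hF₁.isDiffeo _ (htm t u)).symm.injOn (hsub (hpt t u i)) (hsub (hpt t u j)) hij
    -- A collision would make the convex combination of `q t i - q t j` and `c₀ i - c₀ j` vanish.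
    refine add_ne_zero_of_div_mem_slitPlane u.2 (hqs t t.2 i j hne) ?_
    simp only [pt] at h1
    linear_combination h1
  have hhD : ∀ t u i, h t u i ∈ Metric.ball c r := fun t u i =>
    (hF₁.isDiffeo _ (htm t u)).symm.mem_ball hr (hpt t u i)
  obtain ⟨B, hB, hB1, hB2⟩ := exists_family_of_motion Metric.isOpen_ball hc hinj hhD
  have hh0 : ∀ (t : unitInterval) i, h t 0 i = (F₁ (τ t)).symm (q t i) := by
    intro t i; simp [h, pt, tm]
  have hh1 : ∀ t i, h t 1 i = c₀ i := by
    intro t i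
    simp only [h, pt, tm, Set.Icc.coe_one, sub_self, zero_mul, Complex.ofReal_one, one_mul,
      zero_add]
    exact hF₁.symm_zero (hsub (hc₀D i))
  have hτ0 : τ 0 = 1 := by
    simp [hτ, clamp_of_one_le (show (1 : ℝ) ≤ 2 by norm_num),
      clamp_of_nonpos (show (-3 : ℝ) ≤ 0 by norm_num)]
  have hτ1 : τ 1 = 1 := by
    have e1 : clamp (2 - 4 * 1) = 0 := clamp_of_nonpos (by norm_num)
    have e2 : clamp (4 * 1 - 3) = 1 := clamp_of_one_le (by norm_num)
    simp only [hτ, e1, e2]; norm_num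
  have hσ0 : σ 0 = 0 := clamp_of_nonpos (by norm_num)
  have hσ1 : σ 1 = 1 := clamp_of_one_le (by norm_num)
  have hρ0 : ρ 0 = 1 := clamp_of_one_le (by norm_num)
  have hρ1 : ρ 1 = 0 := clamp_of_nonpos (by norm_num)
  have hτ₂0 : τ₂ 0 = 0 := clamp_of_nonpos (by norm_num)
  have hτ₂1 : τ₂ 1 = 1 := clamp_of_one_le (by norm_num)
  have hq0 : q 0 = m₂ := by
    funext i; simp [hq, hτ0, hσ0, hρ0, hQm]
  have hq1 : q 1 = m₂ := by
    funext i; simp [hq, hτ1, hσ1]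
  -- The closed motion begins and ends at `m₂` with `τ = 1`, so the two contractions coincide.
  have hB01 : B 0 = B 1 := by
    apply hB2
    funext u i
    simp only [h, pt, tm, Set.Icc.coe_zero, Set.Icc.coe_one, hτ0, hτ1, hq0, hq1]
  -- the motion of the first disc
  let Qr : ℝ → PartialEquiv ℂ ℂ := fun t =>
    (Q (ρ t)).toPartialEquivOfImageEq _ _ (hQ.image_closedBall (ρ t))
  let J : ℝ → PartialEquiv ℂ ℂ := fun t =>
    ((((F₁ 1).trans (Qr t)).trans (F₁ 1).symm).trans (Φ (σ t))).trans
      ((F₂ (τ₂ t)).trans (F₁ (τ₂ t)).symm)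
  have hJ : IsDiscFamily c r (Icc 0 1) J :=
    (((hQ.isDiscFamily hρc _).conj hr hβ).trans (hΦ.comp hσc.continuousOn fun t _ => hσm t)).trans
      ((hF₁.trans_symm hF₂).comp hτ₂c.continuousOn fun t _ => hτ₂m t)
  have hJdef : ∀ t z, J t z =
      (F₁ (τ₂ t)).symm (F₂ (τ₂ t) (Φ (σ t) ((F₁ 1).symm (Q (ρ t) (F₁ 1 z))))) :=
    fun t z => rfl
  have hE0 : ∀ z ∈ Metric.closedBall c r, (F₁ 0).symm (F₂ 0 z) = z := by
    intro z hz
    rw [hF₂.start hz]; exact hF₁.symm_zero hz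
  have hlC : ∀ t ∈ Icc (0 : ℝ) 1, ∀ i, l t i ∈ Metric.closedBall c r := fun t ht i =>
    hsub (hlD t ht i)
  have hF₁m : ∀ i, F₁ 1 (l 0 i) = m₁ i := by intro i; simpa using hF₁l 1 h01 i
  have hF₂m : ∀ i, F₂ 1 (l 1 i) = m₂ i := by intro i; simpa using hF₂l 1 h01 i
  -- `J t` carries `l 0` to the start of the contraction with parameter `t`. In the second quarter
  -- `J` rests at the identity on the disc while `τ` varies: there `q t` is the image of `l 0` under
  -- `F₁ (τ t)`.
  have hJq : ∀ t ∈ Icc (0 : ℝ) 1, ∀ i, J t (l 0 i) = (F₁ (τ t)).symm (q t i) := by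
    intro t ht i
    rw [hJdef]
    simp only [hq]
    have hF₁s : (F₁ 1).symm (m₁ i) = l 0 i := by
      rw [← hF₁m, hβ.left_inv (hlC 0 h00 i)]
    rcases cases4 t ht with ⟨a1, a2, a3⟩ | ⟨a1, a2, a3⟩ | ⟨a1, a2, a3⟩ | ⟨a1, a2, a3⟩
    · have h2 := hβ.symm.mapsTo (hsub (hQD (ρ t) i))
      rw [a1, a2, a3, hF₁m, hΦ0 h2]
      simp only [id]
      rw [hE0 _ h2]
      simp
    · rw [a1, a2, a3, hQ0, Equiv.Perm.one_apply, hF₁m, hF₁s, hΦ0 (hlC 0 h00 i)]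
      simp only [id]
      rw [hE0 _ (hlC 0 h00 i)]
      have := hF₁l (τ t) (hτm t) i
      simp only [Complex.ofReal_zero, sub_zero, one_mul, zero_mul, add_zero]
      rw [Equiv.Perm.one_apply, ← this, (hF₁.isDiffeo _ (hτm t)).left_inv (hlC 0 h00 i)]
    · rw [a1, a2, a3, hQ0, Equiv.Perm.one_apply, hF₁m, hF₁s, hΦl _ (hσm t), hE0 _ (hlC _ (hσm t) i)]
      simp only [Complex.ofReal_zero, sub_zero, one_mul, zero_mul, add_zero]
      rw [hF₁.symm_zero (hlC _ (hσm t) i)]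
    · rw [a1, a2, a3, hQ0, Equiv.Perm.one_apply, hF₁m, hF₁s, hΦl _ h01, hF₂l _ (hτm t)]
      simp
  -- the isotopy
  have hpc : Continuous (projIcc (0 : ℝ) 1 zero_le_one) := continuous_projIcc
  let Br : ℝ → PartialEquiv ℂ ℂ := fun t =>
    (B (projIcc 0 1 zero_le_one t)).toPartialEquivOfImageEq _ _ (hB.image_closedBall _)
  have hBr : IsDiscFamily c r (Icc 0 1) Br := hB.isDiscFamily hpc _
  have hBr0 : IsDiscFamily c r (Icc 0 1) fun _ => (Br 0).symm := by
    have hd := (hBr.isDiffeo 0 h00).symm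
    refine ⟨fun _ _ => hd, fun _ _ z hz => ?_, hd.smooth.continuousOn.comp continuousOn_snd
      fun p hp => hp.2⟩
    have := (hBr.isDiffeo 0 h00).left_inv (Metric.sphere_subset_closedBall hz)
    rwa [hBr.boundary 0 h00 z hz] at this
  -- `B t ∘ J t` sends `l 0` to `c₀` for every `t`, so after composition with the inverse of `B 0`
  -- the effect on the points is independent of `t`. At the ends `B 0 = B 1` cancels, leaving `J 0`
  -- and `J 1`, conjugated to the model disc.
  have hG := ((hJ.trans hBr).trans hBr0).conj hR hβ.symm
  refine ⟨_, fun t ht => ⟨hG.isDiffeo t ht, hG.boundary t ht, ?_⟩, hG.continuousOn, ?_, ?_⟩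
  · have key : ∀ i, (((F₁ 1).symm.trans (((J t).trans (Br t)).trans (Br 0).symm)).trans
        (F₁ 1).symm.symm) (m₁ i) = m₂ i := by
      intro i
      change F₁ 1 ((B (projIcc 0 1 zero_le_one 0)).symm (B (projIcc 0 1 zero_le_one t)
        (J t ((F₁ 1).symm (m₁ i))))) = m₂ i
      have e0 : projIcc (0 : ℝ) 1 zero_le_one 0 = 0 := projIcc_left _
      have et : projIcc (0 : ℝ) 1 zero_le_one t = ⟨t, ht⟩ := projIcc_of_mem _ ht
      have hF₁s : (F₁ 1).symm (m₁ i) = l 0 i := by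
        rw [← hF₁m, hβ.left_inv (hlC 0 h00 i)]
      have h2 := hh0 ⟨t, ht⟩ i
      have h3 := hh0 0 i
      simp only [Set.Icc.coe_zero, hτ0, hq0] at h2 h3
      rw [e0, et, hF₁s, hJq t ht, ← h2, hB1, hh1, ← hh1 0, ← hB1 0 i, Equiv.symm_apply_apply, h3,
        hβ.right_inv (hsub (hm₂D i))]
    rw [← range_comp]
    conv_rhs => rw [hrange]
    congr 1
    funext i
    exact key i
  · intro z hz
    change F₁ 1 ((B (projIcc 0 1 zero_le_one 0)).symm (B (projIcc 0 1 zero_le_one 0)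
      (J 0 ((F₁ 1).symm z)))) = Q 1 z
    have hQz : Q 1 z ∈ Metric.closedBall m R := by
      rw [← hQ.image_closedBall 1]; exact mem_image_of_mem _ hz
    rw [Equiv.symm_apply_apply, hJdef, hσ0, hτ₂0, hρ0, hβ.right_inv hz,
      hΦ0 (hβ.symm.mapsTo hQz)]
    simp only [id]
    rw [hE0 _ (hβ.symm.mapsTo hQz), hβ.right_inv hQz]
  · intro z hz
    change F₁ 1 ((B (projIcc 0 1 zero_le_one 0)).symm (B (projIcc 0 1 zero_le_one 1)
      (J 1 ((F₁ 1).symm z)))) = F₂ 1 (Φ 1 ((F₁ 1).symm z))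
    have e0 : projIcc (0 : ℝ) 1 zero_le_one 0 = 0 := projIcc_left _
    have e1 : projIcc (0 : ℝ) 1 zero_le_one 1 = 1 := projIcc_right _
    have h1 := hβ₂.mapsTo ((hΦ.isDiffeo 1 h01).mapsTo (hβ.symm.mapsTo hz))
    rw [e0, e1, hB01, Equiv.symm_apply_apply, hJdef, hσ1, hτ₂1, hρ1, hβ.right_inv hz, hQ0,
      Equiv.Perm.one_apply, hβ.right_inv h1]

/-! ### Continuity of the points of the fibres -/

/-- The polynomial `f(x, ·)`. -/
def fibrePoly (f : Polynomial (Polynomial ℝ)) (x : ℂ) : Polynomial ℂ :=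
  (f.map (Polynomial.mapRingHom (algebraMap ℝ ℂ))).map (Polynomial.evalRingHom x)

theorem mem_fibre_iff {f : Polynomial (Polynomial ℝ)} {x y : ℂ} :
    y ∈ fibre f x ↔ (fibrePoly f x).eval y = 0 := by
  rw [fibrePoly, Polynomial.map_evalRingHom_eval]; rfl

theorem natDegree_fibrePoly_le (f : Polynomial (Polynomial ℝ)) (x : ℂ) :
    (fibrePoly f x).natDegree ≤ f.natDegree :=
  Polynomial.natDegree_map_le.trans Polynomial.natDegree_map_le

theorem continuous_coeff_fibrePoly (f : Polynomial (Polynomial ℝ)) (k : ℕ) :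
    Continuous fun x => (fibrePoly f x).coeff k := by
  simp only [fibrePoly, Polynomial.coeff_map, Polynomial.coe_evalRingHom]
  exact Polynomial.continuous _

theorem continuous_eval_fibrePoly (f : Polynomial (Polynomial ℝ)) (w : ℂ) :
    Continuous fun x => (fibrePoly f x).eval w := by
  simp only [fibrePoly, Polynomial.map_evalRingHom_eval, Polynomial.evalEval]
  exact Polynomial.continuous _

theorem conj_mem_fibre {f : Polynomial (Polynomial ℝ)} {x : ℝ} {y : ℂ} (hy : y ∈ fibre f x) :
    (starRingEnd ℂ) y ∈ fibre f x := by
  have h : fibrePoly f (x : ℂ) = (f.map (Polynomial.evalRingHom x)).map (algebraMap ℝ ℂ) := by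
    rw [fibrePoly, Polynomial.map_map, Polynomial.map_map]
    congr 1
    ext a
    · simp
    · simp
  rw [mem_fibre_iff, h, Polynomial.eval_map_algebraMap] at hy ⊢
  rw [Polynomial.aeval_conj, hy, map_zero]

theorem fibre_eq_roots {f : Polynomial (Polynomial ℝ)} {x : ℂ} (h : fibrePoly f x ≠ 0) :
    fibre f x = ((fibrePoly f x).roots.toFinset : Set ℂ) := by
  ext y
  simp [mem_fibre_iff, h]

theorem fibrePoly_ne_zero_of_coeff {f : Polynomial (Polynomial ℝ)} {x : ℂ}
    (h : (fibrePoly f x).coeff f.natDegree ≠ 0) : fibrePoly f x ≠ 0 := by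
  intro h0; rw [h0] at h; simp at h

theorem finite_fibre {f : Polynomial (Polynomial ℝ)} {x : ℂ} (h : fibrePoly f x ≠ 0) :
    (fibre f x).Finite := by
  rw [fibre_eq_roots h]; exact Finset.finite_toSet _

theorem ncard_fibre_le {f : Polynomial (Polynomial ℝ)} {x : ℂ} (h : fibrePoly f x ≠ 0) :
    (fibre f x).ncard ≤ (fibrePoly f x).natDegree := by
  rw [fibre_eq_roots h, ncard_coe_finset]
  exact (Multiset.toFinset_card_le _).trans (Polynomial.card_roots' _)

/-- Off the branch set, a bounded fibre consists of `n` points and the degree does not drop. -/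
theorem regular_of_notMem_branchSet {f : Polynomial (Polynomial ℝ)} {x : ℂ}
    (hb : Bornology.IsBounded (fibre f x)) (hx : x ∉ branchSet f) :
    (fibrePoly f x).coeff f.natDegree ≠ 0 ∧ (fibre f x).ncard = f.natDegree := by
  have h0 : fibrePoly f x ≠ 0 := by
    intro h0
    have : fibre f x = univ := by ext y; simp [mem_fibre_iff, h0]
    rw [this] at hb
    exact NormedSpace.unbounded_univ ℝ ℂ hb
  have h1 : (f.natDegree : ℕ∞) ≤ (fibre f x).encard := not_lt.1 hx
  rw [← (finite_fibre h0).cast_ncard_eq, Nat.cast_le] at h1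
  have h2 := ncard_fibre_le h0
  have h3 := natDegree_fibrePoly_le f x
  have h4 : (fibrePoly f x).natDegree = f.natDegree := by omega
  refine ⟨?_, by omega⟩
  rw [← h4, Polynomial.coeff_natDegree]
  exact Polynomial.leadingCoeff_ne_zero.2 h0

/-- If every root were at distance at least `ε` from `w`, the factorisation over `ℂ` would bound the
value at `w` below by the leading coefficient times `ε ^ n`; that bound has a positive limit, while
the value tends to `0`. -/
theorem eventually_exists_root_near {f : Polynomial (Polynomial ℝ)} {x w : ℂ}
    (hx : (fibrePoly f x).coeff f.natDegree ≠ 0) (hw : w ∈ fibre f x) {ε : ℝ} (hε : 0 < ε) :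
    ∀ᶠ x' in 𝓝 x, ∃ y ∈ fibre f x', ‖y - w‖ < ε := by
  have h1 : Tendsto (fun x' => ‖(fibrePoly f x').eval w‖) (𝓝 x) (𝓝 0) := by
    have := (continuous_eval_fibrePoly f w).norm.tendsto x
    rwa [mem_fibre_iff.1 hw, norm_zero] at this
  have h2 : Tendsto (fun x' => ‖(fibrePoly f x').coeff f.natDegree‖ * ε ^ f.natDegree) (𝓝 x)
      (𝓝 (‖(fibrePoly f x).coeff f.natDegree‖ * ε ^ f.natDegree)) :=
    ((continuous_coeff_fibrePoly f _).norm.tendsto x).mul_const _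
  have hpos : 0 < ‖(fibrePoly f x).coeff f.natDegree‖ * ε ^ f.natDegree := by
    have := norm_pos_iff.2 hx; positivity
  filter_upwards [h1.eventually_lt h2 hpos,
    (continuous_coeff_fibrePoly f f.natDegree).continuousAt.eventually_ne hx] with x' h3 h4
  by_contra! hfar
  have h0 := fibrePoly_ne_zero_of_coeff h4
  have hdeg : (fibrePoly f x').natDegree = f.natDegree :=
    le_antisymm (natDegree_fibrePoly_le f x') (Polynomial.le_natDegree_of_ne_zero h4)
  have hsplit := IsAlgClosed.splits (fibrePoly f x')
  have hcard : (fibrePoly f x').roots.card = f.natDegree := by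
    rw [← hdeg]; exact hsplit.natDegree_eq_card_roots.symm
  refine absurd h3 (not_lt.2 ?_)
  rw [hsplit.eval_eq_prod_roots, norm_mul, Polynomial.leadingCoeff, hdeg]
  refine mul_le_mul_of_nonneg_left ?_ (norm_nonneg _)
  have key : ∀ s : Multiset ℂ, (∀ y ∈ s, ε ≤ ‖y - w‖) →
      ε ^ s.card ≤ ‖(s.map (w - ·)).prod‖ := by
    intro s
    induction s using Multiset.induction_on with
    | empty => simp
    | cons a s ih =>
      intro hs
      rw [Multiset.card_cons, Multiset.map_cons, Multiset.prod_cons, norm_mul, pow_succ', norm_sub_rev]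
      exact mul_le_mul (hs a (Multiset.mem_cons_self a s))
        (ih fun y hy => hs y (Multiset.mem_cons_of_mem hy)) (by positivity) (norm_nonneg _)
  rw [← hcard]
  exact key _ fun y hy => hfar y (mem_fibre_iff.2 (Polynomial.isRoot_of_mem_roots hy))

/-- Near a regular real point, the points of the fibre are given by continuous functions. -/
theorem exists_local_roots {f : Polynomial (Polynomial ℝ)} {x₀ : ℝ}
    (hlc : (fibrePoly f x₀).coeff f.natDegree ≠ 0) (hcard : (fibre f x₀).ncard = f.natDegree) :
    ∃ δ > 0, ∃ y : fibre f x₀ → ℝ → ℂ,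
      (∀ i, ContinuousOn (y i) (Ioo (x₀ - δ) (x₀ + δ))) ∧ (∀ i, y i x₀ = i) ∧
      ∀ x ∈ Ioo (x₀ - δ) (x₀ + δ), (Function.Injective fun i => y i x) ∧
        (range fun i => y i x) = fibre f x ∧
        ∀ i j : fibre f x₀, (j : ℂ) = (starRingEnd ℂ) i → y j x = (starRingEnd ℂ) (y i x) := by
  classical
  have hfin₀ := finite_fibre (fibrePoly_ne_zero_of_coeff hlc)
  have : Finite (fibre f x₀) := hfin₀
  obtain ⟨ε, hε, hsep⟩ : ∃ ε > 0, ∀ i j : fibre f x₀, i ≠ j → 2 * ε ≤ ‖(i : ℂ) - j‖ := by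
    have H : ∀ ij : fibre f x₀ × fibre f x₀, ∃ ε > 0, ij.1 ≠ ij.2 →
        2 * ε ≤ ‖(ij.1 : ℂ) - ij.2‖ := by
      rintro ⟨i, j⟩
      by_cases hij : i = j
      · exact ⟨1, one_pos, fun h => absurd hij h⟩
      · have : 0 < ‖(i : ℂ) - j‖ := norm_pos_iff.2 (sub_ne_zero.2 fun e => hij (Subtype.ext e))
        exact ⟨‖(i : ℂ) - j‖ / 2, by positivity, fun _ => by simp only; linarith⟩
    choose d hd0 hd using H
    rcases isEmpty_or_nonempty (fibre f x₀ × fibre f x₀) with he | he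
    · exact ⟨1, one_pos, fun i j => (he.false (i, j)).elim⟩
    obtain ⟨k, hk⟩ := Finite.exists_min d
    exact ⟨d k, hd0 k, fun i j hij => by linarith [hd (i, j) hij, hk (i, j)]⟩
  have hcont : Tendsto (fun x : ℝ => (x : ℂ)) (𝓝 x₀) (𝓝 (x₀ : ℂ)) :=
    Complex.continuous_ofReal.tendsto x₀
  have hev : ∀ᶠ x : ℝ in 𝓝 x₀, (fibrePoly f x).coeff f.natDegree ≠ 0 ∧
      ∀ i : fibre f x₀, ∃ y ∈ fibre f x, ‖y - i‖ < ε :=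
    (hcont.eventually ((continuous_coeff_fibrePoly f f.natDegree).continuousAt.eventually_ne
      hlc)).and (eventually_all.2 fun i =>
        hcont.eventually (eventually_exists_root_near hlc i.2 hε))
  obtain ⟨δ, hδ, hδ'⟩ := Metric.eventually_nhds_iff_ball.1 hev
  rw [Real.ball_eq_Ioo] at hδ'
  -- Outside the interval the chosen value is irrelevant.
  have hy : ∀ (i : fibre f x₀) (x : ℝ), ∃ y : ℂ, x ∈ Ioo (x₀ - δ) (x₀ + δ) →
      y ∈ fibre f x ∧ ‖y - i‖ < ε := by
    intro i x
    by_cases hx : x ∈ Ioo (x₀ - δ) (x₀ + δ)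
    · obtain ⟨y, h1, h2⟩ := (hδ' x hx).2 i
      exact ⟨y, fun _ => ⟨h1, h2⟩⟩
    · exact ⟨0, fun h => absurd h hx⟩
  choose y hy using hy
  have huniq : ∀ (i j : fibre f x₀) (z : ℂ), ‖z - i‖ < ε → ‖z - j‖ < ε → i = j := by
    intro i j z h1 h2
    by_contra hij
    have h3 := hsep i j hij
    have h4 : ‖(i : ℂ) - j‖ ≤ ‖z - j‖ + ‖z - i‖ := by
      rw [← sub_sub_sub_cancel_left _ _ z]; exact norm_sub_le _ _
    linarith
  have hinj : ∀ x ∈ Ioo (x₀ - δ) (x₀ + δ), Function.Injective fun i => y i x := by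
    intro x hx i j hij
    refine huniq i j (y i x) (hy i x hx).2 ?_
    simp only at hij
    rw [hij]; exact (hy j x hx).2
  -- The `n` chosen roots are distinct and a polynomial of degree at most `n` has no others.
  have hrange : ∀ x ∈ Ioo (x₀ - δ) (x₀ + δ), (range fun i => y i x) = fibre f x := by
    intro x hx
    have h0 := fibrePoly_ne_zero_of_coeff (hδ' x hx).1
    refine Set.eq_of_subset_of_ncard_le ?_ ?_ (finite_fibre h0)
    · rintro _ ⟨i, rfl⟩; exact (hy i x hx).1
    · have h1 : (range fun i => y i x).ncard = (fibre f x₀).ncard := by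
        rw [← image_univ, ncard_image_of_injective _ (hinj x hx), ncard_univ, Nat.card_coe_set_eq]
      rw [h1, hcard]
      exact (ncard_fibre_le h0).trans (natDegree_fibrePoly_le f x)
  have hx₀ : x₀ ∈ Ioo (x₀ - δ) (x₀ + δ) := ⟨by linarith, by linarith⟩
  -- Each `ε`-disc holds a single root. Continuity follows, since a root close to `y i x₁` stays in
  -- the disc about `i`; so does the conjugation rule, since the conjugate root lies in the
  -- conjugate disc.
  have hmem : ∀ x ∈ Ioo (x₀ - δ) (x₀ + δ), ∀ z ∈ fibre f x, ∀ i : fibre f x₀, ‖z - i‖ < ε →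
      z = y i x := by
    intro x hx z hz i hzi
    rw [← hrange x hx] at hz
    obtain ⟨j, rfl⟩ := hz
    rw [huniq i j _ hzi (hy j x hx).2]
  refine ⟨δ, hδ, y, fun i => ?_, fun i => ?_, fun x hx => ⟨hinj x hx, hrange x hx, ?_⟩⟩
  · intro x₁ hx₁
    refine ContinuousAt.continuousWithinAt ?_
    rw [ContinuousAt, Metric.tendsto_nhds]
    intro η hη
    have hgap : 0 < min η (ε - ‖y i x₁ - i‖) := lt_min hη (by linarith [(hy i x₁ hx₁).2])
    have h1 := (Complex.continuous_ofReal.tendsto x₁).eventually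
      (eventually_exists_root_near (hδ' x₁ hx₁).1 (hy i x₁ hx₁).1 hgap)
    filter_upwards [h1, isOpen_Ioo.mem_nhds hx₁] with x ⟨z, hz, hzy⟩ hx
    have h2 : z = y i x := by
      refine hmem x hx z hz i ?_
      have h3 := norm_add_le (z - y i x₁) (y i x₁ - i)
      rw [sub_add_sub_cancel] at h3
      linarith [min_le_right η (ε - ‖y i x₁ - i‖)]
    rw [dist_eq_norm, ← h2]
    exact hzy.trans_le (min_le_left _ _)
  · exact (hmem x₀ hx₀ i i.2 i (by simpa using hε)).symm
  · intro i j hij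
    refine (hmem x hx _ (conj_mem_fibre (hy i x hx).1) j ?_).symm
    rw [hij, ← map_sub, RCLike.norm_conj]
    exact (hy i x hx).2

/-! ### Model points -/

/-- The number of points of `K(x)` in the open upper half plane at height at most `s`. -/
def upperCount (f : Polynomial (Polynomial ℝ)) (x : ℝ) (s : ℝ) : ℕ :=
  {w | w ∈ fibre f x ∧ 0 < w.im ∧ w.im ≤ s}.ncard

theorem modelPoint_of_im_eq_zero {f : Polynomial (Polynomial ℝ)} {x : ℝ} {y : ℂ} (h : y.im = 0) :
    modelPoint f x y = ({w | w ∈ fibre f x ∧ w.im = 0 ∧ w.re ≤ y.re}.ncard : ℂ) := by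
  rw [modelPoint, if_pos h]

theorem modelPoint_of_im_pos {f : Polynomial (Polynomial ℝ)} {x : ℝ} {y : ℂ} (h : 0 < y.im) :
    modelPoint f x y = (f.natDegree + 1 : ℂ) + (upperCount f x y.im : ℂ) * Complex.I := by
  rw [modelPoint, if_neg h.ne', if_pos h]; rfl

/-- Conjugation exchanges the points counted below the axis with those above it, so only upper
counts are needed later. -/
theorem modelPoint_of_im_neg {f : Polynomial (Polynomial ℝ)} {x : ℝ} {y : ℂ} (h : y.im < 0) :
    modelPoint f x y = (f.natDegree + 1 : ℂ) - (upperCount f x (-y.im) : ℂ) * Complex.I := by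
  rw [modelPoint, if_neg h.ne, if_neg h.le.not_gt, upperCount]
  congr 3
  rw [← ncard_image_of_injective {w | w ∈ fibre f x ∧ 0 < w.im ∧ w.im ≤ -y.im}
    (starRingEnd ℂ).injective]
  congr 1
  ext w
  simp only [mem_ofPred_eq, mem_image]
  constructor
  · rintro ⟨h1, h2, h3⟩
    exact ⟨(starRingEnd ℂ) w, ⟨conj_mem_fibre h1, by simpa using h2, by simpa using h3⟩, by simp⟩
  · rintro ⟨v, ⟨h1, h2, h3⟩, rfl⟩
    exact ⟨conj_mem_fibre h1, by simpa using h2, by simp; linarith⟩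

theorem upperCount_lt {f : Polynomial (Polynomial ℝ)} {x : ℝ} (hfin : (fibre f x).Finite)
    {s : ℝ} {z : ℂ} (hz : z ∈ fibre f x) (hz0 : 0 < z.im) (hs : s < z.im) :
    upperCount f x s < upperCount f x z.im := by
  refine ncard_lt_ncard ⟨fun w hw => ⟨hw.1, hw.2.1, hw.2.2.trans hs.le⟩, fun h => ?_⟩
    (hfin.subset fun w hw => hw.1)
  exact absurd (h ⟨hz, hz0, le_rfl⟩).2.2 (not_le.2 hs)

theorem upperCount_pos {f : Polynomial (Polynomial ℝ)} {x : ℝ} (hfin : (fibre f x).Finite)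
    {z : ℂ} (hz : z ∈ fibre f x) (hz0 : 0 < z.im) : 0 < upperCount f x z.im :=
  (Nat.zero_le _).trans_lt (upperCount_lt hfin hz hz0 hz0)

/-- The imaginary part of a model point, as an integer. -/
def level (f : Polynomial (Polynomial ℝ)) (x : ℝ) (y : ℂ) : ℤ :=
  if y.im = 0 then 0 else if 0 < y.im then upperCount f x y.im else -upperCount f x (-y.im)

theorem modelPoint_im (f : Polynomial (Polynomial ℝ)) (x : ℝ) (y : ℂ) :
    (modelPoint f x y).im = level f x y := by
  rcases lt_trichotomy y.im 0 with h | h | h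
  · simp [modelPoint_of_im_neg h, level, h.ne, h.le.not_gt]
  · simp [modelPoint_of_im_eq_zero h, level, h]
  · simp [modelPoint_of_im_pos h, level, h.ne', h]

theorem modelPoint_re {f : Polynomial (Polynomial ℝ)} {x : ℝ} {y : ℂ} (hy : y.im ≠ 0) :
    (modelPoint f x y).re = f.natDegree + 1 := by
  rcases lt_or_gt_of_ne hy with h | h
  · simp [modelPoint_of_im_neg h]
  · simp [modelPoint_of_im_pos h]

theorem level_of_im_pos {f : Polynomial (Polynomial ℝ)} {x : ℝ} {y : ℂ} (h : 0 < y.im) :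
    level f x y = upperCount f x y.im := by
  rw [level, if_neg h.ne', if_pos h]

theorem level_conj (f : Polynomial (Polynomial ℝ)) (x : ℝ) (y : ℂ) :
    level f x ((starRingEnd ℂ) y) = -level f x y := by
  rcases lt_trichotomy y.im 0 with h | h | h
  · simp [level, h.ne, h.le.not_gt, h]
  · simp [level, h]
  · simp [level, h.ne', h, h.le.not_gt]

theorem level_lt {f : Polynomial (Polynomial ℝ)} {x : ℝ} (hfin : (fibre f x).Finite)
    {y z : ℂ} (hy : y ∈ fibre f x) (hz : z ∈ fibre f x) (h : y.im < z.im) :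
    level f x y < level f x z := by
  have pos : ∀ {w}, w ∈ fibre f x → 0 < w.im → 0 < level f x w := by
    intro w hw h0
    rw [level_of_im_pos h0]; exact_mod_cast upperCount_pos hfin hw h0
  have neg : ∀ {w}, w ∈ fibre f x → w.im < 0 → level f x w < 0 := by
    intro w hw h0
    have := pos (conj_mem_fibre hw) (by simpa using h0)
    rw [level_conj] at this; linarith
  have zero : ∀ {w : ℂ}, w.im = 0 → level f x w = 0 := fun h => by simp [level, h]
  rcases lt_trichotomy y.im 0 with hy0 | hy0 | hy0
  · rcases lt_trichotomy z.im 0 with hz0 | hz0 | hz0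
    · have := upperCount_lt hfin (conj_mem_fibre hy) (by simpa using hy0)
        (show ((starRingEnd ℂ) z).im < ((starRingEnd ℂ) y).im by simpa using h)
      rw [← neg_lt_neg_iff, ← level_conj, ← level_conj, level_of_im_pos (by simpa using hz0),
        level_of_im_pos (by simpa using hy0)]
      exact_mod_cast this
    · rw [zero hz0]; exact neg hy hy0
    · exact (neg hy hy0).trans (pos hz hz0)
  · rw [zero hy0]; exact pos hz (by linarith)
  · rw [level_of_im_pos hy0, level_of_im_pos (hy0.trans h)]
    exact_mod_cast upperCount_lt hfin hz (hy0.trans h) h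

theorem modelPoint_im_lt {f : Polynomial (Polynomial ℝ)} {x : ℝ} (hfin : (fibre f x).Finite)
    {y z : ℂ} (hy : y ∈ fibre f x) (hz : z ∈ fibre f x) (h : y.im < z.im) :
    (modelPoint f x y).im < (modelPoint f x z).im := by
  rw [modelPoint_im, modelPoint_im]; exact_mod_cast level_lt hfin hy hz h

theorem modelPoint_re_lt {f : Polynomial (Polynomial ℝ)} {x : ℝ} (hfin : (fibre f x).Finite)
    {y z : ℂ} (hz : z ∈ fibre f x) (hy0 : y.im = 0) (hz0 : z.im = 0) (h : y.re < z.re) :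
    (modelPoint f x y).re < (modelPoint f x z).re := by
  rw [modelPoint_of_im_eq_zero hy0, modelPoint_of_im_eq_zero hz0, Complex.natCast_re,
    Complex.natCast_re, Nat.cast_lt]
  refine ncard_lt_ncard ⟨fun w hw => ⟨hw.1, hw.2.1, hw.2.2.trans h.le⟩, fun h' => ?_⟩
    (hfin.subset fun w hw => hw.1)
  exact absurd (h' ⟨hz, hz0, le_rfl⟩).2.2 (not_le.2 h)

/-- Two such points at one height would differ in real part and form a level pair in one of the two
orders. -/
theorem im_ne_of_notMem_switchSet {f : Polynomial (Polynomial ℝ)} {x : ℝ} (hx : x ∉ switchSet f)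
    {y z : ℂ} (hy : y ∈ fibre f x) (hz : z ∈ fibre f x) (hyz : y ≠ z) (h0 : y.im ≠ 0) :
    y.im ≠ z.im := by
  intro h
  rcases lt_trichotomy y.re z.re with h1 | h1 | h1
  · exact hx ⟨(y, z), hy, hz, h0, h, h1⟩
  · exact hyz (Complex.ext h1 h)
  · exact hx ⟨(z, y), hz, hy, h ▸ h0, h.symm, h1⟩

theorem injOn_modelPoint {f : Polynomial (Polynomial ℝ)} {x : ℝ} (hfin : (fibre f x).Finite)
    (hx : x ∉ switchSet f) : InjOn (modelPoint f x) (fibre f x) := by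
  intro y hy z hz h
  have him : y.im = z.im := by
    rcases lt_trichotomy y.im z.im with h1 | h1 | h1
    · exact absurd (congrArg Complex.im h) (modelPoint_im_lt hfin hy hz h1).ne
    · exact h1
    · exact absurd (congrArg Complex.im h) (modelPoint_im_lt hfin hz hy h1).ne'
  by_contra hyz
  by_cases h0 : y.im = 0
  · rcases lt_trichotomy y.re z.re with h1 | h1 | h1
    · exact absurd (congrArg Complex.re h) (modelPoint_re_lt hfin hz h0 (him ▸ h0) h1).ne
    · exact hyz (Complex.ext h1 him)
    · exact absurd (congrArg Complex.re h) (modelPoint_re_lt hfin hy (him ▸ h0) h0 h1).ne'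
  · exact im_ne_of_notMem_switchSet hx hy hz hyz h0 him

theorem two_mul_upperCount_le {f : Polynomial (Polynomial ℝ)} {x : ℝ} (hfin : (fibre f x).Finite)
    (s : ℝ) : 2 * upperCount f x s ≤ numNonreal f x := by
  have hU : {w | w ∈ fibre f x ∧ 0 < w.im ∧ w.im ≤ s}.Finite := hfin.subset fun w hw => hw.1
  have h1 : ((starRingEnd ℂ) '' {w | w ∈ fibre f x ∧ 0 < w.im ∧ w.im ≤ s}).ncard =
      upperCount f x s := ncard_image_of_injective _ (starRingEnd ℂ).injective
  have hdisj : Disjoint {w | w ∈ fibre f x ∧ 0 < w.im ∧ w.im ≤ s}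
      ((starRingEnd ℂ) '' {w | w ∈ fibre f x ∧ 0 < w.im ∧ w.im ≤ s}) := by
    rw [disjoint_left]
    rintro _ ⟨_, h2, _⟩ ⟨v, ⟨_, h3, _⟩, rfl⟩
    simp at h2; linarith
  have h2 := ncard_union_eq hdisj hU (hU.image _)
  rw [h1] at h2
  refine (two_mul (upperCount f x s)).trans_le (h2.symm.trans_le ?_)
  refine ncard_le_ncard ?_ (hfin.subset fun w hw => hw.1)
  rintro w (⟨h2, h3, _⟩ | ⟨v, ⟨h2, h3, _⟩, rfl⟩)
  · exact ⟨h2, h3.ne'⟩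
  · exact ⟨conj_mem_fibre h2, by simpa using h3.ne'⟩

theorem modelPoint_mem_modelConfig {f : Polynomial (Polynomial ℝ)} {x : ℝ}
    (hfin : (fibre f x).Finite) (hcard : (fibre f x).ncard = f.natDegree) {y : ℂ}
    (hy : y ∈ fibre f x) : modelPoint f x y ∈ modelConfig f.natDegree (numNonreal f x) := by
  rcases lt_trichotomy y.im 0 with h | h | h
  · right
    have h1 := upperCount_pos hfin (conj_mem_fibre hy) (by simpa using h)
    rw [Complex.conj_im] at h1
    exact ⟨_, h1, two_mul_upperCount_le hfin _, Or.inr (modelPoint_of_im_neg h)⟩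
  · left
    have hs : {w | w ∈ fibre f x ∧ w.im = 0 ∧ w.re ≤ y.re}.Finite := hfin.subset fun w hw => hw.1
    refine ⟨_, (ncard_pos hs).2 ⟨y, hy, h, le_rfl⟩, ?_, modelPoint_of_im_eq_zero h⟩
    rw [numNonreal, ← hcard, ← ncard_union_eq ?_ hs (hfin.subset fun w hw => hw.1)]
    · exact ncard_le_ncard (union_subset (fun w hw => hw.1) fun w hw => hw.1) hfin
    · rw [disjoint_left]
      rintro w ⟨_, h1, _⟩ ⟨_, h2⟩
      exact h2 h1
  · right
    exact ⟨_, upperCount_pos hfin hy h, two_mul_upperCount_le hfin _,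
      Or.inl (modelPoint_of_im_pos h)⟩

theorem numNonreal_le {f : Polynomial (Polynomial ℝ)} {x : ℝ}
    (hfin : (fibre f x).Finite) (hcard : (fibre f x).ncard = f.natDegree) :
    numNonreal f x ≤ f.natDegree := by
  rw [← hcard]; exact ncard_le_ncard (fun w hw => hw.1) hfin

/-- The count is `(n - d) + 2 * (d / 2) ≤ n` with rounded division, so the parity of `d` plays no
role; an upper bound suffices for `image_modelPoint`. -/
theorem modelConfig_finite_and_ncard_le {n d : ℕ} (hd : d ≤ n) :
    (modelConfig n d).Finite ∧ (modelConfig n d).ncard ≤ n := by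
  classical
  let S : Finset ℂ := (Finset.Icc 1 (n - d)).image (fun j : ℕ => (j : ℂ)) ∪
    ((Finset.Icc 1 (d / 2)).image (fun j : ℕ => (n + 1 : ℂ) + j * Complex.I) ∪
      (Finset.Icc 1 (d / 2)).image (fun j : ℕ => (n + 1 : ℂ) - j * Complex.I))
  have hsub : modelConfig n d ⊆ S := by
    rintro z (⟨j, h1, h2, rfl⟩ | ⟨j, h1, h2, rfl | rfl⟩)
    · simp only [S, Finset.coe_union, Finset.coe_image]
      exact Or.inl ⟨j, by simp; omega, rfl⟩
    · simp only [S, Finset.coe_union, Finset.coe_image]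
      exact Or.inr (Or.inl ⟨j, by simp; omega, rfl⟩)
    · simp only [S, Finset.coe_union, Finset.coe_image]
      exact Or.inr (Or.inr ⟨j, by simp; omega, rfl⟩)
  refine ⟨S.finite_toSet.subset hsub, (ncard_le_ncard hsub S.finite_toSet).trans ?_⟩
  rw [ncard_coe_finset]
  have h1 := Finset.card_union_le ((Finset.Icc 1 (n - d)).image (fun j : ℕ => (j : ℂ)))
    ((Finset.Icc 1 (d / 2)).image (fun j : ℕ => (n + 1 : ℂ) + j * Complex.I) ∪
      (Finset.Icc 1 (d / 2)).image (fun j : ℕ => (n + 1 : ℂ) - j * Complex.I))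
  have h2 := Finset.card_union_le
    ((Finset.Icc 1 (d / 2)).image (fun j : ℕ => (n + 1 : ℂ) + j * Complex.I))
    ((Finset.Icc 1 (d / 2)).image (fun j : ℕ => (n + 1 : ℂ) - j * Complex.I))
  have h3 := Finset.card_image_le (s := Finset.Icc 1 (n - d)) (f := fun j : ℕ => (j : ℂ))
  have h4 := Finset.card_image_le (s := Finset.Icc 1 (d / 2))
    (f := fun j : ℕ => (n + 1 : ℂ) + j * Complex.I)
  have h5 := Finset.card_image_le (s := Finset.Icc 1 (d / 2))
    (f := fun j : ℕ => (n + 1 : ℂ) - j * Complex.I)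
  rw [Nat.card_Icc] at h3 h4 h5
  simp only [S]
  omega

theorem image_modelPoint {f : Polynomial (Polynomial ℝ)} {x : ℝ}
    (hfin : (fibre f x).Finite) (hcard : (fibre f x).ncard = f.natDegree) (hx : x ∉ switchSet f) :
    modelPoint f x '' fibre f x = modelConfig f.natDegree (numNonreal f x) := by
  obtain ⟨h1, h2⟩ := modelConfig_finite_and_ncard_le (numNonreal_le hfin hcard)
  refine Set.eq_of_subset_of_ncard_le ?_ ?_ h1
  · rintro _ ⟨y, hy, rfl⟩; exact modelPoint_mem_modelConfig hfin hcard hy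
  · rwa [(injOn_modelPoint hfin hx).ncard_image, hcard]

theorem modelConfig_subset_ball {n d : ℕ} (hd : d ≤ n) :
    modelConfig n d ⊆ Metric.ball (n + 1 : ℂ) (n + 1 : ℝ) := by
  have key : ∀ j : ℕ, 2 * j ≤ d → (j : ℝ) < n + 1 := fun j hj => by
    have : j < n + 1 := by omega
    exact_mod_cast this
  rintro z (⟨j, h1, h2, rfl⟩ | ⟨j, h1, h2, rfl | rfl⟩)
  · have e : (j : ℂ) - (n + 1) = ((j - (n + 1) : ℝ) : ℂ) := by push_cast; ring
    have h3 : (1 : ℝ) ≤ j := by exact_mod_cast h1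
    have h4 : (j : ℝ) ≤ n := by
      have : j ≤ n := by omega
      exact_mod_cast this
    rw [Metric.mem_ball, dist_eq_norm, e, Complex.norm_real, Real.norm_eq_abs, abs_lt]
    constructor <;> linarith
  · rw [Metric.mem_ball, dist_eq_norm]; simpa using key j h2
  · rw [Metric.mem_ball, dist_eq_norm]; simpa using key j h2

/-! ### Rotations -/

theorem rotFun_of_le {a : ℝ} {s : ℂ} {r : ℝ} {z : ℂ} (h : r + 1 / 4 ≤ ‖z - s‖) :
    rotFun a s r z = z := by
  rw [rotFun, rotProfile, Real.smoothTransition.zero_of_nonpos (by linarith)]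
  simp

theorem rotFun_of_norm_le {a : ℝ} {s : ℂ} {r : ℝ} {z : ℂ} (h : ‖z - s‖ ≤ r) :
    rotFun a s r z = s + Complex.exp ((2 * Real.pi * a : ℝ) * Complex.I) * (z - s) := by
  rw [rotFun, rotProfile, Real.smoothTransition.one_of_one_le (by linarith), mul_one]

theorem contDiff_rotFun (a : ℝ) (s : ℂ) {r : ℝ} (hr : 0 < r) : ContDiff ℝ ∞ (rotFun a s r) := by
  have h0 : ContDiff ℝ ∞ fun z : ℂ => z - s := contDiff_id.sub contDiff_const
  have h1 : ContDiff ℝ ∞ fun z : ℂ => rotProfile r ‖z - s‖ := by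
    rw [contDiff_iff_contDiffAt]
    intro z
    by_cases hz : z = s
    · subst hz
      -- The norm is not smooth at the centre, but the profile is constant near it.
      refine (contDiffAt_const (c := (1 : ℝ))).congr_of_eventuallyEq ?_
      filter_upwards [Metric.ball_mem_nhds z hr] with w hw
      rw [Metric.mem_ball, dist_eq_norm] at hw
      rw [rotProfile, Real.smoothTransition.one_of_one_le (by linarith)]
    · have h2 : ContDiffAt ℝ ∞ (fun z : ℂ => ‖z - s‖) z :=
        h0.contDiffAt.norm ℝ (sub_ne_zero.2 hz)
      exact Real.smoothTransition.contDiff.contDiffAt.comp z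
        (contDiffAt_const.mul (contDiffAt_const.sub h2))
  have h2 : ContDiff ℝ ∞ fun z : ℂ => 2 * Real.pi * a * rotProfile r ‖z - s‖ :=
    contDiff_const.mul h1
  have h3 := Complex.ofRealCLM.contDiff.comp h2
  exact contDiff_const.add (((h3.mul contDiff_const).cexp).mul h0)

theorem isSupportedFamily_rotation {U : Set ℂ} {a : ℝ → ℝ} (ha : Continuous a) (s : ℂ) {r : ℝ}
    (hr : 0 < r) (hU : Metric.ball s (r + 1 / 4) ⊆ U) :
    IsSupportedFamily U (fun t => rotation (a t) s r) where
  contDiff _ := contDiff_rotFun _ _ hr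
  contDiff_symm _ := contDiff_rotFun _ _ hr
  eq_self t z hz := by
    refine rotFun_of_le (not_lt.1 fun h => hz (hU ?_))
    rwa [Metric.mem_ball, dist_eq_norm]
  continuous := by
    have h1 : Continuous fun p : ℝ × ℂ => rotProfile r ‖p.2 - s‖ :=
      Real.smoothTransition.continuous.comp (by fun_prop)
    have h2 : Continuous fun p : ℝ × ℂ =>
        ((2 * Real.pi * a p.1 * rotProfile r ‖p.2 - s‖ : ℝ) : ℂ) :=
      Complex.continuous_ofReal.comp ((continuous_const.mul (ha.comp continuous_fst)).mul h1)
    exact continuous_const.add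
      ((Complex.continuous_exp.comp (h2.mul continuous_const)).mul (by fun_prop))

theorem rotation_inv (a : ℝ) (s : ℂ) (r : ℝ) : (rotation a s r)⁻¹ = rotation (-a) s r :=
  Equiv.ext fun _ => rfl

theorem rotation_zero (s : ℂ) (r : ℝ) : rotation 0 s r = 1 :=
  Equiv.ext fun z => by
    change rotFun 0 s r z = z
    simp [rotFun]

/-- A rotation of a disc of radius `1/2` is supported within `3/4` of its centre, so a difference of
heights decides that a point is fixed. -/
theorem three_quarters_le_norm {s z : ℂ} (h : 3 / 4 ≤ |z.im - s.im|) :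
    (1 / 2 : ℝ) + 1 / 4 ≤ ‖z - s‖ := by
  have := Complex.abs_im_le_norm (z - s)
  rw [Complex.sub_im] at this
  linarith

/-- The centre of the upper rotation in `Δ_com⟨k, l⟩`. -/
def upperCentre (n k : ℕ) : ℂ := (n + 1 : ℂ) + (k + 1 / 2 : ℂ) * Complex.I

/-- The centre of the lower rotation in `Δ_com⟨k, l⟩`. -/
def lowerCentre (n k : ℕ) : ℂ := (n + 1 : ℂ) - (k + 1 / 2 : ℂ) * Complex.I

theorem upperCentre_im (n k : ℕ) : (upperCentre n k).im = k + 1 / 2 := by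
  simp [upperCentre]

theorem lowerCentre_im (n k : ℕ) : (lowerCentre n k).im = -(k + 1 / 2) := by
  simp [lowerCentre]

theorem upperCentre_re (n k : ℕ) : (upperCentre n k).re = n + 1 := by
  simp [upperCentre]

theorem lowerCentre_re (n k : ℕ) : (lowerCentre n k).re = n + 1 := by
  simp [lowerCentre]

/-- The simultaneous rotations by `e π t` and `-e π t` about the two centres. -/
def twist (n k : ℕ) (e t : ℝ) : Equiv.Perm ℂ :=
  rotation (e * t / 2) (upperCentre n k) (1 / 2) * rotation (-(e * t / 2)) (lowerCentre n k) (1 / 2)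

theorem twist_of_im_nonneg {n k : ℕ} (hk : 1 ≤ k) (e t : ℝ) {z : ℂ} (hz : 0 ≤ z.im) :
    twist n k e t z = rotFun (e * t / 2) (upperCentre n k) (1 / 2) z := by
  have hk' : (1 : ℝ) ≤ k := by exact_mod_cast hk
  have h : rotFun (-(e * t / 2)) (lowerCentre n k) (1 / 2) z = z := by
    refine rotFun_of_le (three_quarters_le_norm ?_)
    rw [lowerCentre_im, le_abs]; left; linarith
  change rotFun _ _ _ (rotFun _ _ _ z) = _
  rw [h]

theorem twist_of_im_nonpos {n k : ℕ} (hk : 1 ≤ k) (e t : ℝ) {z : ℂ} (hz : z.im ≤ 0) :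
    twist n k e t z = rotFun (-(e * t / 2)) (lowerCentre n k) (1 / 2) z := by
  have hk' : (1 : ℝ) ≤ k := by exact_mod_cast hk
  change rotFun _ _ _ (rotFun _ _ _ z) = _
  by_cases h : 1 / 2 + 1 / 4 ≤ ‖z - lowerCentre n k‖
  · rw [rotFun_of_le h]
    refine rotFun_of_le (three_quarters_le_norm ?_)
    rw [upperCentre_im, le_abs]; right; linarith
  · refine rotFun_of_le (three_quarters_le_norm ?_)
    set w := rotFun (-(e * t / 2)) (lowerCentre n k) (1 / 2) z
    -- The image is still within `3/4` of the lower centre; since `1 ≤ k`, it stays outside the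
    -- support of the upper rotation.
    have hw : ‖w - lowerCentre n k‖ = ‖z - lowerCentre n k‖ := by
      simp only [w, rotFun, add_sub_cancel_left, norm_mul, Complex.norm_exp_ofReal_mul_I, one_mul]
    have h2 := (abs_le.1 (Complex.abs_im_le_norm (w - lowerCentre n k))).2
    rw [Complex.sub_im, lowerCentre_im] at h2
    rw [upperCentre_im, le_abs]; right; linarith

theorem twist_zero (n k : ℕ) (e : ℝ) : twist n k e 0 = 1 := by
  simp [twist, rotation_zero]

theorem isSupportedFamily_twist {n k : ℕ} (hk : k + 1 ≤ n) (e : ℝ) :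
    IsSupportedFamily (Metric.ball (n + 1 : ℂ) (n + 1 : ℝ)) (twist n k e) := by
  have hk' : (k : ℝ) + 1 ≤ n := by exact_mod_cast hk
  have key : ‖(k + 1 / 2 : ℂ) * Complex.I‖ = k + 1 / 2 := by
    rw [norm_mul, Complex.norm_I, mul_one, show (k + 1 / 2 : ℂ) = ((k + 1 / 2 : ℝ) : ℂ) by
      push_cast; ring, Complex.norm_real, Real.norm_of_nonneg (by positivity)]
  refine IsSupportedFamily.mul
    (isSupportedFamily_rotation (by fun_prop) _ (by norm_num) (Metric.ball_subset_ball' ?_))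
    (isSupportedFamily_rotation (by fun_prop) _ (by norm_num) (Metric.ball_subset_ball' ?_))
  · rw [upperCentre, dist_eq_norm, add_sub_cancel_left, key]; linarith
  · rw [lowerCentre, dist_eq_norm, sub_sub_cancel_left, norm_neg, key]; linarith

/-- Inversion reverses the order of the two half rotations; they commute because their supports lie
in opposite half planes. -/
theorem deltaCom_zpow {n k : ℕ} (l : ℕ) (hk : 1 ≤ k) {o : ℤ} (ho : o = 1 ∨ o = -1 ∨ o = 0) :
    deltaCom n k l ^ o = twist n k o 1 := by
  have h1 : deltaCom n k l = rotation (1 / 2) (upperCentre n k) (1 / 2) *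
    rotation (-(1 / 2)) (lowerCentre n k) (1 / 2) := rfl
  rcases ho with rfl | rfl | rfl
  · rw [zpow_one, h1, twist]; norm_num
  · have hcomm : Commute (rotation (-(1 / 2)) (upperCentre n k) (1 / 2))
        (rotation (1 / 2) (lowerCentre n k) (1 / 2)) := by
      refine Equiv.Perm.Disjoint.commute fun z => ?_
      have hk' : (1 : ℝ) ≤ k := by exact_mod_cast hk
      rcases le_total 0 z.im with hz | hz
      · right
        refine rotFun_of_le (three_quarters_le_norm ?_)
        rw [lowerCentre_im, le_abs]; left; linarith
      · left
        refine rotFun_of_le (three_quarters_le_norm ?_)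
        rw [upperCentre_im, le_abs]; right; linarith
    rw [zpow_neg_one, h1, mul_inv_rev, rotation_inv, rotation_inv, neg_neg, ← hcomm.eq, twist]
    norm_num
  · simp [twist, rotation_zero]

theorem twist_of_far {n k : ℕ} (hk : 1 ≤ k) (e t : ℝ) {z : ℂ}
    (h1 : 3 / 4 ≤ |z.im - (k + 1 / 2)|) (h2 : 3 / 4 ≤ |z.im + (k + 1 / 2)|) :
    twist n k e t z = z := by
  rcases le_total 0 z.im with hz | hz
  · rw [twist_of_im_nonneg hk e t hz]
    exact rotFun_of_le (three_quarters_le_norm (by rwa [upperCentre_im]))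
  · rw [twist_of_im_nonpos hk e t hz]
    exact rotFun_of_le (three_quarters_le_norm (by rwa [lowerCentre_im, sub_neg_eq_add]))

theorem twist_of_near_upper {n k : ℕ} (hk : 1 ≤ k) (e t : ℝ) {z : ℂ} (hre : z.re = n + 1)
    (him : z.im = k ∨ z.im = k + 1) :
    twist n k e t z = upperCentre n k +
      Complex.exp ((e * Real.pi * t : ℝ) * Complex.I) * (z - upperCentre n k) := by
  have hk' : (1 : ℝ) ≤ k := by exact_mod_cast hk
  rw [twist_of_im_nonneg hk e t (by rcases him with h | h <;> linarith), rotFun_of_norm_le]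
  · congr 4; ring_nf
  · have h0 : (z - upperCentre n k).re = 0 := by simp [upperCentre_re, hre]
    refine (Complex.norm_le_abs_re_add_abs_im _).trans ?_
    rw [h0, abs_zero, zero_add, Complex.sub_im, upperCentre_im, abs_le]
    rcases him with h | h <;> rw [h] <;> constructor <;> linarith

theorem twist_of_near_lower {n k : ℕ} (hk : 1 ≤ k) (e t : ℝ) {z : ℂ} (hre : z.re = n + 1)
    (him : z.im = -k ∨ z.im = -(k + 1)) :
    twist n k e t z = lowerCentre n k +
      Complex.exp ((-(e * Real.pi * t) : ℝ) * Complex.I) * (z - lowerCentre n k) := by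
  have hk' : (1 : ℝ) ≤ k := by exact_mod_cast hk
  rw [twist_of_im_nonpos hk e t (by rcases him with h | h <;> linarith), rotFun_of_norm_le]
  · congr 4; ring_nf
  · have h0 : (z - lowerCentre n k).re = 0 := by simp [lowerCentre_re, hre]
    refine (Complex.norm_le_abs_re_add_abs_im _).trans ?_
    rw [h0, abs_zero, zero_add, Complex.sub_im, lowerCentre_im, abs_le]
    rcases him with h | h <;> rw [h] <;> constructor <;> linarith

theorem abs_im_exp_mul_le (θ : ℝ) (z : ℂ) : |(Complex.exp (θ * Complex.I) * z).im| ≤ ‖z‖ := by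
  refine (Complex.abs_im_le_norm _).trans_eq ?_
  rw [norm_mul, Complex.norm_exp_ofReal_mul_I, one_mul]

theorem norm_sub_upperCentre {n k : ℕ} {z : ℂ} (hre : z.re = n + 1)
    (him : z.im = k ∨ z.im = k + 1) : ‖z - upperCentre n k‖ ≤ 1 / 2 := by
  refine (Complex.norm_le_abs_re_add_abs_im _).trans ?_
  rw [Complex.sub_re, upperCentre_re, hre, sub_self, abs_zero, zero_add, Complex.sub_im,
    upperCentre_im, abs_le]
  rcases him with h | h <;> rw [h] <;> constructor <;> linarith

theorem conj_upperCentre (n k : ℕ) : (starRingEnd ℂ) (upperCentre n k) = lowerCentre n k :=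
  Complex.ext (by simp [upperCentre_re, lowerCentre_re])
    (by simp [upperCentre_im, lowerCentre_im])

/-- The two rotations have opposite senses and conjugate centres, so statements about the upper pair
carry over to the lower one. -/
theorem twist_conj_of_near {n k : ℕ} (hk : 1 ≤ k) (e t : ℝ) {z : ℂ} (hre : z.re = n + 1)
    (him : z.im = k ∨ z.im = k + 1) :
    twist n k e t ((starRingEnd ℂ) z) = (starRingEnd ℂ) (twist n k e t z) := by
  rw [twist_of_near_upper hk e t hre him, twist_of_near_lower hk e t (by simpa using hre)
    (by rw [Complex.conj_im]; exact him.imp (congrArg _) (congrArg _)), map_add, map_mul, map_sub, conj_upperCentre, ← Complex.exp_conj, map_mul,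
    Complex.conj_I, Complex.conj_ofReal]
  congr 3
  push_cast; ring

theorem twist_im_mem {n k : ℕ} (hk : 1 ≤ k) (e t : ℝ) {z : ℂ} (hre : z.re = n + 1)
    (him : z.im = k ∨ z.im = k + 1) : (twist n k e t z).im ∈ Icc (k : ℝ) (k + 1) := by
  rw [twist_of_near_upper hk e t hre him, Complex.add_im, upperCentre_im]
  have h := abs_le.1 ((abs_im_exp_mul_le (e * Real.pi * t) (z - upperCentre n k)).trans
    (norm_sub_upperCentre hre him))
  constructor <;> linarith [h.1, h.2]

theorem twist_im_mem_neg {n k : ℕ} (hk : 1 ≤ k) (e t : ℝ) {z : ℂ} (hre : z.re = n + 1)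
    (him : z.im = -k ∨ z.im = -(k + 1)) :
    (twist n k e t z).im ∈ Icc (-(k + 1) : ℝ) (-k) := by
  have him' : ((starRingEnd ℂ) z).im = k ∨ ((starRingEnd ℂ) z).im = k + 1 := by
    rcases him with h | h <;> simp [h]
  have h := twist_im_mem hk e t (z := (starRingEnd ℂ) z) (by simpa using hre) him'
  rw [← Complex.conj_conj z, twist_conj_of_near hk e t (by simpa using hre) him', Complex.conj_im]
  exact ⟨by linarith [h.2], by linarith [h.1]⟩

theorem three_quarters_le_abs_int {L : ℤ} {k : ℕ} (h1 : L ≠ k) (h2 : L ≠ k + 1) :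
    3 / 4 ≤ |(L : ℝ) - (k + 1 / 2)| := by
  rw [le_abs]
  rcases lt_or_ge L k with h | h
  · right
    have h3 : L + 1 ≤ k := by omega
    have h4 : (L : ℝ) + 1 ≤ k := by exact_mod_cast h3
    linarith
  · left
    have h3 : (k : ℤ) + 2 ≤ L := by omega
    have h4 : (k : ℝ) + 2 ≤ L := by exact_mod_cast h3
    linarith

theorem twist_eq_self {n k : ℕ} (hk : 1 ≤ k) (e t : ℝ) {z : ℂ} {L : ℤ} (hz : z.im = L)
    (h1 : L ≠ k) (h2 : L ≠ k + 1) (h3 : L ≠ -k) (h4 : L ≠ -(k + 1)) :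
    twist n k e t z = z := by
  refine twist_of_far hk e t (by rw [hz]; exact three_quarters_le_abs_int h1 h2) ?_
  have := three_quarters_le_abs_int (L := -L) (k := k) (by omega) (by omega)
  rw [hz]
  rw [← abs_neg] at this
  convert this using 2
  push_cast; ring

/-- The twist preserves the order of the levels of two points at integral levels that are not
the two levels exchanged by one of the half rotations. -/
theorem twist_im_lt {n k : ℕ} (hk : 1 ≤ k) (e t : ℝ) {z w : ℂ} {L L' : ℤ}
    (hz : z.im = L) (hw : w.im = L') (hz' : L ≠ 0 → z.re = n + 1) (hw' : L' ≠ 0 → w.re = n + 1)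
    (h : L < L') (h1 : ¬(L = k ∧ L' = k + 1)) (h2 : ¬(L = -(k + 1) ∧ L' = -k)) :
    (twist n k e t z).im < (twist n k e t w).im := by
  -- A rotating point stays in the strip between the two exchanged levels and every other point is
  -- fixed. The bounds on the heights are therefore integers, and comparing them is integer
  -- arithmetic.
  have upper : ∀ {z : ℂ} {L : ℤ}, z.im = L → (L ≠ 0 → z.re = n + 1) →
      (twist n k e t z).im ≤ ((if L = k then (k : ℤ) + 1 else if L = -(k + 1) then -(k : ℤ) else L : ℤ) : ℝ) := by
    intro z L hz hz'
    split_ifs with a1 a2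
    · have := (twist_im_mem hk e t (hz' (by omega)) (Or.inl (by rw [hz, a1]; simp))).2
      simpa using this
    · have := (twist_im_mem_neg hk e t (hz' (by omega)) (Or.inr (by rw [hz, a2]; push_cast; ring))).2
      simpa using this
    · by_cases a3 : L = k + 1
      · have := (twist_im_mem hk e t (hz' (by omega)) (Or.inr (by rw [hz, a3]; push_cast; ring))).2
        rw [a3]; simpa using this
      by_cases a4 : L = -k
      · have := (twist_im_mem_neg hk e t (hz' (by omega)) (Or.inl (by rw [hz, a4]; push_cast; ring))).2
        rw [a4]; simpa using this
      rw [twist_eq_self hk e t hz a1 a3 a4 a2, hz]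
  have lower : ∀ {z : ℂ} {L : ℤ}, z.im = L → (L ≠ 0 → z.re = n + 1) →
      ((if L = k + 1 then (k : ℤ) else if L = -k then -((k : ℤ) + 1) else L : ℤ) : ℝ) ≤
        (twist n k e t z).im := by
    intro z L hz hz'
    split_ifs with a1 a2
    · have := (twist_im_mem hk e t (hz' (by omega)) (Or.inr (by rw [hz, a1]; push_cast; ring))).1
      simpa using this
    · have := (twist_im_mem_neg hk e t (hz' (by omega)) (Or.inl (by rw [hz, a2]; push_cast; ring))).1
      push_cast; simpa using this
    · by_cases a3 : L = k
      · have := (twist_im_mem hk e t (hz' (by omega)) (Or.inl (by rw [hz, a3]; push_cast; ring))).1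
        rw [a3]; simpa using this
      by_cases a4 : L = -(k + 1)
      · have := (twist_im_mem_neg hk e t (hz' (by omega)) (Or.inr (by rw [hz, a4]; push_cast; ring))).1
        rw [a4]; push_cast; simpa using this
      rw [twist_eq_self hk e t hz a3 a1 a2 a4, hz]
  refine (upper hz hz').trans_lt (lt_of_lt_of_le ?_ (lower hw hw'))
  rw [Int.cast_lt]
  split_ifs <;> omega

theorem div_mem_slitPlane {w v : ℂ} (h : ∀ s : ℝ, s ≤ 0 → w ≠ s * v) (hv : v ≠ 0) :
    w / v ∈ Complex.slitPlane := by
  rw [Complex.mem_slitPlane_iff_not_le_zero]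
  intro h0
  obtain ⟨h1, h2⟩ := Complex.le_def.1 h0
  refine h (w / v).re h1 ?_
  have : ((w / v).re : ℂ) = w / v := Complex.ext rfl (by simpa using h2.symm)
  rw [this, div_mul_cancel₀ _ hv]

theorem div_mem_slitPlane_of_im {w v : ℂ} (h : 0 < w.im * v.im) : w / v ∈ Complex.slitPlane := by
  refine div_mem_slitPlane (fun s hs e => ?_) (by rintro rfl; simp at h)
  rw [e] at h
  simp only [Complex.mul_im, Complex.ofReal_re, Complex.ofReal_im, zero_mul, add_zero] at h
  nlinarith [mul_self_nonneg v.im]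

theorem div_mem_slitPlane_of_re {w v : ℂ} (h : 0 < w.re * v.re) : w / v ∈ Complex.slitPlane := by
  refine div_mem_slitPlane (fun s hs e => ?_) (by rintro rfl; simp at h)
  rw [e] at h
  simp only [Complex.mul_re, Complex.ofReal_re, Complex.ofReal_im, zero_mul, sub_zero] at h
  nlinarith [mul_self_nonneg v.re]

/-- For a negative real `v`, the nonpositive multiples are the nonnegative reals. This is the
criterion for the switching pair. -/
theorem div_mem_slitPlane_of_neg {w v : ℂ} (hv : v.im = 0) (hv' : v.re < 0)
    (h : w.im ≠ 0 ∨ w.re < 0) : w / v ∈ Complex.slitPlane := by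
  refine div_mem_slitPlane (fun s hs e => ?_) (by rintro rfl; simp at hv')
  rw [e] at h
  simp only [Complex.mul_re, Complex.mul_im, Complex.ofReal_re, Complex.ofReal_im, zero_mul,
    sub_zero, hv, mul_zero, add_zero, ne_eq, not_true_eq_false, false_or] at h
  nlinarith

/-! ### The fibres near a regular point -/

/-- The points of the fibres above an interval around `x₀`, as continuous functions which respect
complex conjugation and the order of the real and of the imaginary parts above `x₀`. -/
structure LocalRoots (f : Polynomial (Polynomial ℝ)) (x₀ δ : ℝ) (y : fibre f x₀ → ℝ → ℂ) :
    Prop where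
  continuousOn : ∀ i, ContinuousOn (y i) (Ioo (x₀ - δ) (x₀ + δ))
  apply_self : ∀ i, y i x₀ = i
  injective : ∀ x ∈ Ioo (x₀ - δ) (x₀ + δ), Function.Injective fun i => y i x
  range_eq : ∀ x ∈ Ioo (x₀ - δ) (x₀ + δ), (range fun i => y i x) = fibre f x
  conj : ∀ x ∈ Ioo (x₀ - δ) (x₀ + δ), ∀ i j : fibre f x₀,
    (j : ℂ) = (starRingEnd ℂ) i → y j x = (starRingEnd ℂ) (y i x)
  im_lt : ∀ x ∈ Ioo (x₀ - δ) (x₀ + δ), ∀ i j : fibre f x₀,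
    (i : ℂ).im < (j : ℂ).im → (y i x).im < (y j x).im
  re_lt : ∀ x ∈ Ioo (x₀ - δ) (x₀ + δ), ∀ i j : fibre f x₀,
    (i : ℂ).re < (j : ℂ).re → (y i x).re < (y j x).re

/-- A regular real point has local roots. -/
theorem exists_localRoots {f : Polynomial (Polynomial ℝ)} {x₀ : ℝ}
    (hlc : (fibrePoly f x₀).coeff f.natDegree ≠ 0) (hcard : (fibre f x₀).ncard = f.natDegree) :
    ∃ δ > 0, ∃ y, LocalRoots f x₀ δ y := by
  obtain ⟨δ, hδ, y, hc, h0, hx⟩ := exists_local_roots hlc hcard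
  have : Finite (fibre f x₀) := finite_fibre (fibrePoly_ne_zero_of_coeff hlc)
  have hca : ∀ i, ContinuousAt (y i) x₀ := fun i =>
    (hc i).continuousAt (Ioo_mem_nhds (by linarith) (by linarith))
  have h1 : ∀ᶠ x in 𝓝 x₀, ∀ i j : fibre f x₀,
      ((i : ℂ).im < (j : ℂ).im → (y i x).im < (y j x).im) ∧
      ((i : ℂ).re < (j : ℂ).re → (y i x).re < (y j x).re) := by
    refine eventually_all.2 fun i => eventually_all.2 fun j => Eventually.and ?_ ?_
    · by_cases hij : (i : ℂ).im < (j : ℂ).im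
      · filter_upwards [(Complex.continuous_im.continuousAt.comp (hca i)).eventually_lt
          (Complex.continuous_im.continuousAt.comp (hca j)) (by simpa [h0] using hij)] with x hx _
        exact hx
      · exact Eventually.of_forall fun x h => absurd h hij
    · by_cases hij : (i : ℂ).re < (j : ℂ).re
      · filter_upwards [(Complex.continuous_re.continuousAt.comp (hca i)).eventually_lt
          (Complex.continuous_re.continuousAt.comp (hca j)) (by simpa [h0] using hij)] with x hx _
        exact hx
      · exact Eventually.of_forall fun x h => absurd h hij
  obtain ⟨η, hη, hη'⟩ := Metric.eventually_nhds_iff_ball.1 h1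
  rw [Real.ball_eq_Ioo] at hη'
  have hsub1 : Ioo (x₀ - min δ η) (x₀ + min δ η) ⊆ Ioo (x₀ - δ) (x₀ + δ) :=
    Ioo_subset_Ioo (by linarith [min_le_left δ η]) (by linarith [min_le_left δ η])
  have hsub2 : Ioo (x₀ - min δ η) (x₀ + min δ η) ⊆ Ioo (x₀ - η) (x₀ + η) :=
    Ioo_subset_Ioo (by linarith [min_le_right δ η]) (by linarith [min_le_right δ η])
  exact ⟨min δ η, lt_min hδ hη, y, fun i => (hc i).mono hsub1, h0,
    fun x h => (hx x (hsub1 h)).1, fun x h => (hx x (hsub1 h)).2.1,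
    fun x h => (hx x (hsub1 h)).2.2, fun x h i j => (hη' x (hsub2 h) i j).1,
    fun x h i j => (hη' x (hsub2 h) i j).2⟩

section LocalRoots

variable {f : Polynomial (Polynomial ℝ)} {x₀ δ : ℝ} {y : fibre f x₀ → ℝ → ℂ}

theorem LocalRoots.mono (h : LocalRoots f x₀ δ y) {δ' : ℝ} (hδ : δ' ≤ δ) :
    LocalRoots f x₀ δ' y := by
  have hsub : Ioo (x₀ - δ') (x₀ + δ') ⊆ Ioo (x₀ - δ) (x₀ + δ) :=
    Ioo_subset_Ioo (by linarith) (by linarith)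
  exact ⟨fun i => (h.continuousOn i).mono hsub, h.apply_self, fun x hx => h.injective x (hsub hx),
    fun x hx => h.range_eq x (hsub hx), fun x hx => h.conj x (hsub hx),
    fun x hx => h.im_lt x (hsub hx), fun x hx => h.re_lt x (hsub hx)⟩

theorem LocalRoots.mem (h : LocalRoots f x₀ δ y) {x : ℝ} (hx : x ∈ Ioo (x₀ - δ) (x₀ + δ))
    (i : fibre f x₀) : y i x ∈ fibre f x := by
  rw [← h.range_eq x hx]; exact ⟨i, rfl⟩

theorem LocalRoots.exists_eq (h : LocalRoots f x₀ δ y) {x : ℝ} (hx : x ∈ Ioo (x₀ - δ) (x₀ + δ))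
    {w : ℂ} (hw : w ∈ fibre f x) : ∃ i, y i x = w := by
  rw [← h.range_eq x hx] at hw; exact hw

theorem LocalRoots.finite (h : LocalRoots f x₀ δ y) (hfin : (fibre f x₀).Finite) {x : ℝ}
    (hx : x ∈ Ioo (x₀ - δ) (x₀ + δ)) : (fibre f x).Finite := by
  have : Finite (fibre f x₀) := hfin
  rw [← h.range_eq x hx]; exact finite_range _

/-- Counting points of a fibre is counting the corresponding points above `x₀`. -/
theorem LocalRoots.ncard_eq (h : LocalRoots f x₀ δ y) {x : ℝ} (hx : x ∈ Ioo (x₀ - δ) (x₀ + δ))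
    {P : ℂ → Prop} {Q : fibre f x₀ → Prop} (hPQ : ∀ i, P (y i x) ↔ Q i) :
    {w | w ∈ fibre f x ∧ P w}.ncard = {i | Q i}.ncard := by
  rw [← ncard_image_of_injective {i | Q i} (h.injective x hx)]
  congr 1
  ext w
  constructor
  · rintro ⟨hw, hP⟩
    obtain ⟨i, rfl⟩ := h.exists_eq hx hw
    exact ⟨i, (hPQ i).1 hP, rfl⟩
  · rintro ⟨i, hi, rfl⟩
    exact ⟨h.mem hx i, (hPQ i).2 hi⟩

/-- A real index is its own conjugate, so its root equals its own conjugate over the whole interval.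
-/
theorem LocalRoots.im_eq_zero (h : LocalRoots f x₀ δ y) {x : ℝ}
    (hx : x ∈ Ioo (x₀ - δ) (x₀ + δ)) {i : fibre f x₀} (hi : (i : ℂ).im = 0) : (y i x).im = 0 :=
  Complex.conj_eq_iff_im.1 (h.conj x hx i i (Complex.conj_eq_iff_im.2 hi).symm).symm

/-- The index of the complex conjugate of a point of the fibre. -/
def conjIndex (i : fibre f x₀) : fibre f x₀ := ⟨(starRingEnd ℂ) (i : ℂ), conj_mem_fibre i.2⟩

theorem LocalRoots.conjIndex (h : LocalRoots f x₀ δ y) {x : ℝ} (hx : x ∈ Ioo (x₀ - δ) (x₀ + δ))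
    (i : fibre f x₀) : y (conjIndex i) x = (starRingEnd ℂ) (y i x) :=
  h.conj x hx i _ rfl

/-- The index lies above its conjugate over `x₀`; this order persists, and a point above its own
conjugate is in the upper half plane. -/
theorem LocalRoots.im_pos (h : LocalRoots f x₀ δ y) {x : ℝ} (hx : x ∈ Ioo (x₀ - δ) (x₀ + δ))
    {i : fibre f x₀} (hi : 0 < (i : ℂ).im) : 0 < (y i x).im := by
  have h1 := h.im_lt x hx (RealCurve.conjIndex i) i (by simp [RealCurve.conjIndex]; linarith)
  rw [h.conjIndex hx, Complex.conj_im] at h1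
  linarith

theorem LocalRoots.im_neg (h : LocalRoots f x₀ δ y) {x : ℝ} (hx : x ∈ Ioo (x₀ - δ) (x₀ + δ))
    {i : fibre f x₀} (hi : (i : ℂ).im < 0) : (y i x).im < 0 := by
  have h1 := h.im_pos hx (i := RealCurve.conjIndex i) (by simpa [RealCurve.conjIndex] using hi)
  rw [h.conjIndex hx, Complex.conj_im] at h1
  linarith

theorem LocalRoots.im_pos_iff (h : LocalRoots f x₀ δ y) {x : ℝ}
    (hx : x ∈ Ioo (x₀ - δ) (x₀ + δ)) (i : fibre f x₀) : 0 < (y i x).im ↔ 0 < (i : ℂ).im := by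
  refine ⟨fun hi => not_le.1 fun h0 => ?_, h.im_pos hx⟩
  rcases h0.lt_or_eq with h1 | h1
  · linarith [h.im_neg hx h1]
  · linarith [h.im_eq_zero hx h1]

theorem LocalRoots.im_eq_zero_iff (h : LocalRoots f x₀ δ y) {x : ℝ}
    (hx : x ∈ Ioo (x₀ - δ) (x₀ + δ)) (i : fibre f x₀) : (y i x).im = 0 ↔ (i : ℂ).im = 0 := by
  refine ⟨fun hi => ?_, h.im_eq_zero hx⟩
  rcases lt_trichotomy (i : ℂ).im 0 with h1 | h1 | h1
  · exact absurd hi (h.im_neg hx h1).ne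
  · exact h1
  · exact absurd hi (h.im_pos hx h1).ne'

theorem LocalRoots.mem_center (_h : LocalRoots f x₀ δ y) {x : ℝ}
    (hx : x ∈ Ioo (x₀ - δ) (x₀ + δ)) : x₀ ∈ Ioo (x₀ - δ) (x₀ + δ) :=
  ⟨by linarith [hx.1, hx.2], by linarith [hx.1, hx.2]⟩

theorem LocalRoots.numNonreal_eq (h : LocalRoots f x₀ δ y) {x : ℝ}
    (hx : x ∈ Ioo (x₀ - δ) (x₀ + δ)) : numNonreal f x = numNonreal f x₀ := by
  rw [numNonreal, numNonreal, h.ncard_eq hx fun i => (h.im_eq_zero_iff hx i).not,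
    h.ncard_eq (h.mem_center hx) fun i => (h.im_eq_zero_iff (h.mem_center hx) i).not]

theorem LocalRoots.ncard_fibre (h : LocalRoots f x₀ δ y) {x : ℝ}
    (hx : x ∈ Ioo (x₀ - δ) (x₀ + δ)) : (fibre f x).ncard = (fibre f x₀).ncard := by
  rw [← h.range_eq x hx, ← image_univ, ncard_image_of_injective _ (h.injective x hx), ncard_univ,
    Nat.card_coe_set_eq]

theorem LocalRoots.re_le_iff (h : LocalRoots f x₀ δ y) {x : ℝ}
    (hx : x ∈ Ioo (x₀ - δ) (x₀ + δ)) {i j : fibre f x₀} (hi : (i : ℂ).im = 0)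
    (hj : (j : ℂ).im = 0) : (y j x).re ≤ (y i x).re ↔ (j : ℂ).re ≤ (i : ℂ).re := by
  rcases lt_trichotomy (i : ℂ).re (j : ℂ).re with h1 | h1 | h1
  · exact iff_of_false (not_le.2 (h.re_lt x hx i j h1)) (not_le.2 h1)
  · rw [show i = j from Subtype.ext (Complex.ext h1 (hi.trans hj.symm))]
    simp
  · exact iff_of_true (h.re_lt x hx j i h1).le h1.le

/-- If no other point of the fibre above `x₀` has the same height, the count of points up to the
height of a point of the upper half plane is locally constant. -/
theorem LocalRoots.upperCount_eq (h : LocalRoots f x₀ δ y) {x : ℝ}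
    (hx : x ∈ Ioo (x₀ - δ) (x₀ + δ)) {i : fibre f x₀}
    (hu : ∀ j : fibre f x₀, (j : ℂ).im = (i : ℂ).im → j = i) :
    upperCount f x (y i x).im = {j : fibre f x₀ | 0 < (j : ℂ).im ∧ (j : ℂ).im ≤ (i : ℂ).im}.ncard := by
  refine h.ncard_eq hx fun j => and_congr (h.im_pos_iff hx j) ?_
  rcases lt_trichotomy (i : ℂ).im (j : ℂ).im with h1 | h1 | h1
  · exact iff_of_false (not_le.2 (h.im_lt x hx i j h1)) (not_le.2 h1)
  · rw [hu j h1.symm]; simp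
  · exact iff_of_true (h.im_lt x hx j i h1).le h1.le

/-- The model point is locally constant along a point which shares its height with no other
point, or which is real. -/
theorem LocalRoots.modelPoint_eq (h : LocalRoots f x₀ δ y) {x x' : ℝ}
    (hx : x ∈ Ioo (x₀ - δ) (x₀ + δ)) (hx' : x' ∈ Ioo (x₀ - δ) (x₀ + δ)) {i : fibre f x₀}
    (hu : (i : ℂ).im ≠ 0 → ∀ j : fibre f x₀, (j : ℂ).im = (i : ℂ).im → j = i) :
    modelPoint f x (y i x) = modelPoint f x' (y i x') := by
  rcases lt_trichotomy (i : ℂ).im 0 with h1 | h1 | h1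
  · have hc : ∀ j : fibre f x₀, (j : ℂ).im = (RealCurve.conjIndex i : ℂ).im →
        j = RealCurve.conjIndex i := by
      intro j hj
      have h2 := hu h1.ne (RealCurve.conjIndex j) (by
        simp only [RealCurve.conjIndex, Complex.conj_im] at hj ⊢; rw [hj, neg_neg])
      rw [← h2]
      exact Subtype.ext (by simp [RealCurve.conjIndex])
    have e1 := h.upperCount_eq hx hc
    have e2 := h.upperCount_eq hx' hc
    rw [h.conjIndex hx, Complex.conj_im] at e1
    rw [h.conjIndex hx', Complex.conj_im] at e2
    rw [modelPoint_of_im_neg (h.im_neg hx h1), modelPoint_of_im_neg (h.im_neg hx' h1), e1, e2]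
  · rw [modelPoint_of_im_eq_zero (h.im_eq_zero hx h1),
      modelPoint_of_im_eq_zero (h.im_eq_zero hx' h1),
      h.ncard_eq hx (Q := fun j => (j : ℂ).im = 0 ∧ (j : ℂ).re ≤ (i : ℂ).re),
      h.ncard_eq hx' (Q := fun j => (j : ℂ).im = 0 ∧ (j : ℂ).re ≤ (i : ℂ).re)]
    · intro j
      rw [h.im_eq_zero_iff hx']
      exact and_congr_right fun hj => h.re_le_iff hx' h1 hj
    · intro j
      rw [h.im_eq_zero_iff hx]
      exact and_congr_right fun hj => h.re_le_iff hx h1 hj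
  · rw [modelPoint_of_im_pos (h.im_pos hx h1), modelPoint_of_im_pos (h.im_pos hx' h1),
      h.upperCount_eq hx (hu h1.ne'), h.upperCount_eq hx' (hu h1.ne')]

end LocalRoots

theorem modelPoint_conj (f : Polynomial (Polynomial ℝ)) (x : ℝ) (w : ℂ) :
    modelPoint f x ((starRingEnd ℂ) w) = (starRingEnd ℂ) (modelPoint f x w) := by
  refine Complex.ext ?_ ?_
  · by_cases hw : w.im = 0
    · rw [Complex.conj_re, Complex.conj_eq_iff_im.2 hw]
    · rw [Complex.conj_re, modelPoint_re hw, modelPoint_re (by simpa using hw)]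
  · rw [Complex.conj_im, modelPoint_im, modelPoint_im, level_conj]; simp

/-! ### The fibres near a switching point -/

/-- The only coincidences of heights of non-real points of `K(x₀)` are those of `a`, `b` and of
their conjugates. -/
structure IsSwitchPair {f : Polynomial (Polynomial ℝ)} {x₀ : ℝ} (a b : fibre f x₀) : Prop where
  im_pos : 0 < (a : ℂ).im
  im_eq : (a : ℂ).im = (b : ℂ).im
  re_lt : (a : ℂ).re < (b : ℂ).re
  classify : ∀ i j : fibre f x₀, (i : ℂ).im = (j : ℂ).im → (i : ℂ).im ≠ 0 →
    (i : ℂ).re < (j : ℂ).re → (i = a ∧ j = b) ∨ (i = conjIndex a ∧ j = conjIndex b)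

/-- A pair and its conjugate are two different level pairs, and by hypothesis there are only two. -/
theorem exists_isSwitchPair {f : Polynomial (Polynomial ℝ)} {x₀ : ℝ}
    (hcard : (levelPairs f (x₀ : ℂ)).ncard = 2) {z w : ℂ} (hzw : (z, w) ∈ levelPairs f (x₀ : ℂ))
    (hz : 0 < z.im) :
    ∃ a b : fibre f x₀, (a : ℂ) = z ∧ (b : ℂ) = w ∧ IsSwitchPair a b := by
  obtain ⟨h1, h2, h3, h4, h5⟩ := hzw
  simp only at h1 h2 h3 h4 h5
  refine ⟨⟨z, h1⟩, ⟨w, h2⟩, rfl, rfl, hz, h4, h5, ?_⟩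
  have hsub : ({(z, w), ((starRingEnd ℂ) z, (starRingEnd ℂ) w)} : Set (ℂ × ℂ)) ⊆
      levelPairs f (x₀ : ℂ) := by
    rintro p (rfl | rfl)
    · exact ⟨h1, h2, h3, h4, h5⟩
    · exact ⟨conj_mem_fibre h1, conj_mem_fibre h2, by simpa using h3, by simpa using h4,
        by simpa using h5⟩
  have hne : (z, w) ≠ ((starRingEnd ℂ) z, (starRingEnd ℂ) w) := by
    intro e
    exact hz.ne' (Complex.conj_eq_iff_im.1 (congrArg Prod.fst e).symm)
  have heq := Set.eq_of_subset_of_ncard_le hsub (by rw [hcard, ncard_pair hne])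
    (finite_of_ncard_pos (by omega))
  intro i j hij hi0 hre
  have : ((i : ℂ), (j : ℂ)) ∈ levelPairs f (x₀ : ℂ) := ⟨i.2, j.2, hi0, hij, hre⟩
  rw [← heq] at this
  rcases this with e | e
  · left
    exact ⟨Subtype.ext (congrArg Prod.fst e), Subtype.ext (congrArg Prod.snd e)⟩
  · right
    exact ⟨Subtype.ext (congrArg Prod.fst e), Subtype.ext (congrArg Prod.snd e)⟩

section

variable {f : Polynomial (Polynomial ℝ)} {x₀ δ : ℝ} {y : fibre f x₀ → ℝ → ℂ} {a b : fibre f x₀}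

theorem IsSwitchPair.eq_or_eq (hab : IsSwitchPair a b) {i : fibre f x₀}
    (hi : (i : ℂ).im = (a : ℂ).im) : i = a ∨ i = b := by
  rcases lt_trichotomy (i : ℂ).re (a : ℂ).re with h | h | h
  · rcases hab.classify i a hi (hi ▸ hab.im_pos.ne') h with ⟨h1, -⟩ | ⟨-, h2⟩
    · exact Or.inl h1
    · have := congrArg (fun z : fibre f x₀ => (z : ℂ).im) h2
      simp only [conjIndex, Complex.conj_im] at this
      linarith [hab.im_pos, hab.im_eq]
  · exact Or.inl (Subtype.ext (Complex.ext h hi))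
  · rcases hab.classify a i hi.symm hab.im_pos.ne' h with ⟨-, h2⟩ | ⟨h1, -⟩
    · exact Or.inr h2
    · have := congrArg (fun z : fibre f x₀ => (z : ℂ).im) h1
      simp only [conjIndex, Complex.conj_im] at this
      linarith [hab.im_pos]

theorem conjIndex_conjIndex (i : fibre f x₀) : conjIndex (conjIndex i) = i :=
  Subtype.ext (by simp [conjIndex])

theorem IsSwitchPair.eq_or_eq_conj (hab : IsSwitchPair a b) {i : fibre f x₀}
    (hi : (i : ℂ).im = -(a : ℂ).im) : i = conjIndex a ∨ i = conjIndex b := by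
  rcases hab.eq_or_eq (i := conjIndex i) (by simp [conjIndex, hi]) with h | h
  · left; rw [← h, conjIndex_conjIndex]
  · right; rw [← h, conjIndex_conjIndex]

/-- A point off the heights `± Im a` shares its height with no other non-real point. -/
theorem IsSwitchPair.unique (hab : IsSwitchPair a b) {i : fibre f x₀}
    (h1 : (i : ℂ).im ≠ (a : ℂ).im) (h2 : (i : ℂ).im ≠ -(a : ℂ).im) (hi : (i : ℂ).im ≠ 0)
    (j : fibre f x₀) (hj : (j : ℂ).im = (i : ℂ).im) : j = i := by
  have key : ∀ p q : fibre f x₀, (p : ℂ).im = (i : ℂ).im → (q : ℂ).im = (i : ℂ).im →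
      ¬ (p : ℂ).re < (q : ℂ).re := by
    intro p q hp hq hlt
    rcases hab.classify p q (hp.trans hq.symm) (hp ▸ hi) hlt with ⟨rfl, -⟩ | ⟨rfl, -⟩
    · exact h1 hp.symm
    · exact h2 (by rw [← hp]; simp [conjIndex])
  exact Subtype.ext (Complex.ext
    (le_antisymm (not_lt.1 (key i j rfl hj)) (not_lt.1 (key j i hj rfl))) hj)

/-- Above `x`, the points continuing `p` and `q` are the `k`-th and the `(k+1)`-st of the upper
half plane. -/
structure LevelsAt (y : fibre f x₀ → ℝ → ℂ) (k : ℕ) (p q : fibre f x₀) (x : ℝ) : Prop where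
  im_lt : (y p x).im < (y q x).im
  left : upperCount f x (y p x).im = k
  right : upperCount f x (y q x).im = k + 1

theorem eq_of_upperCount_eq {x : ℝ} (hfin : (fibre f x).Finite) (hx : x ∉ switchSet f) {z w : ℂ}
    (hz : z ∈ fibre f x) (hw : w ∈ fibre f x) (hz0 : 0 < z.im) (hw0 : 0 < w.im)
    (h : upperCount f x z.im = upperCount f x w.im) : z = w := by
  by_contra hne
  rcases lt_or_gt_of_ne (im_ne_of_notMem_switchSet hx hz hw hne hz0.ne') with h1 | h1
  · exact (upperCount_lt hfin hw hw0 h1).ne h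
  · exact (upperCount_lt hfin hz hz0 h1).ne' h

/-- Off the switching set the height is injective on the upper half plane part of the fibre, so
ranking heights is ranking points. -/
theorem ncard_posIm_le {x : ℝ} (hx : x ∉ switchSet f) (r : ℝ) :
    {s | s ∈ posIm f x ∧ s ≤ r}.ncard = upperCount f x r := by
  rw [upperCount]
  have : {s | s ∈ posIm f x ∧ s ≤ r} =
      Complex.im '' {w | w ∈ fibre f x ∧ 0 < w.im ∧ w.im ≤ r} := by
    ext s
    constructor
    · rintro ⟨⟨h1, w, hw, rfl⟩, h2⟩; exact ⟨w, ⟨hw, h1, h2⟩, rfl⟩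
    · rintro ⟨w, ⟨hw, h1, h2⟩, rfl⟩; exact ⟨⟨h1, w, hw, rfl⟩, h2⟩
  rw [this]
  refine InjOn.ncard_image fun z hz w hw hzw => ?_
  by_contra hne
  exact im_ne_of_notMem_switchSet hx hz.1 hw.1 hne hz.2.1.ne' hzw

/-- All other points start at heights different from that of `p`, `q` and keep their side, so the
ranks of `p` and `q` are consecutive. Both heights lie in a window which contains only `r` and `s`.
-/
theorem LocalRoots.levelsAt (h : LocalRoots f x₀ δ y) (hfin : (fibre f x₀).Finite)
    {x : ℝ} (hx : x ∈ Ioo (x₀ - δ) (x₀ + δ)) (hxB : x ∉ switchSet f) {p q : fibre f x₀}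
    (hp : 0 < (p : ℂ).im) (hpq : (p : ℂ).im = (q : ℂ).im)
    (hun : ∀ i : fibre f x₀, (i : ℂ).im = (p : ℂ).im → i = p ∨ i = q)
    (hlt : (y p x).im < (y q x).im) {k l : ℕ} (hkl : k ≤ l) {r s t ε : ℝ}
    (hr : IsNth (posIm f x) k r) (hs : IsNth (posIm f x) l s)
    (hrs : posIm f x ∩ Ioo (t - ε) (t + ε) = {r, s})
    (hpI : (y p x).im ∈ Ioo (t - ε) (t + ε)) (hqI : (y q x).im ∈ Ioo (t - ε) (t + ε)) :
    LevelsAt y k p q x ∧ l = k + 1 := by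
  have hfx := h.finite hfin hx
  have hp0 := h.im_pos hx hp
  have hq0 := h.im_pos hx (hpq ▸ hp)
  have hpm : (y p x).im ∈ ({r, s} : Set ℝ) := by
    rw [← hrs]; exact ⟨⟨hp0, _, h.mem hx p, rfl⟩, hpI⟩
  have hqm : (y q x).im ∈ ({r, s} : Set ℝ) := by
    rw [← hrs]; exact ⟨⟨hq0, _, h.mem hx q, rfl⟩, hqI⟩
  have hk : upperCount f x r = k := by rw [← ncard_posIm_le hxB]; exact hr.2.2
  have hl : upperCount f x s = l := by rw [← ncard_posIm_le hxB]; exact hs.2.2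
  have hlt' := upperCount_lt hfx (h.mem hx q) hq0 hlt
  -- no point lies between the two levels
  have hsucc : upperCount f x (y q x).im = upperCount f x (y p x).im + 1 := by
    rw [upperCount, upperCount, ← ncard_insert_of_notMem (a := y q x) ?_
      (hfx.subset fun w hw => hw.1)]
    · congr 1
      ext w
      constructor
      · rintro ⟨hw, hw0, hwq⟩
        obtain ⟨i, rfl⟩ := h.exists_eq hx hw
        by_cases hiq : i = q
        · exact Or.inl (by rw [hiq])
        right
        refine ⟨hw, hw0, ?_⟩
        rcases lt_trichotomy (i : ℂ).im (p : ℂ).im with h1 | h1 | h1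
        · exact (h.im_lt x hx i p h1).le
        · rcases hun i h1 with rfl | rfl
          · exact le_rfl
          · exact absurd rfl hiq
        · exact absurd hwq (not_le.2 (h.im_lt x hx q i (hpq ▸ h1)))
      · rintro (rfl | ⟨hw, hw0, hwp⟩)
        · exact ⟨h.mem hx q, hq0, le_rfl⟩
        · exact ⟨hw, hw0, hwp.trans hlt.le⟩
    · rintro ⟨-, -, h1⟩
      exact absurd h1 (not_le.2 hlt)
  rcases hpm with hpr | hps
  · rcases hqm with hqr | hqs
    · exact absurd (hpr.trans hqr.symm) hlt.ne
    · rw [mem_singleton_iff] at hqs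
      rw [← hpr] at hk
      rw [← hqs] at hl
      exact ⟨⟨hlt, hk, by omega⟩, by omega⟩
  · rw [mem_singleton_iff] at hps
    rcases hqm with hqr | hqs
    · rw [← hps] at hl
      rw [← hqr] at hk
      omega
    · rw [mem_singleton_iff] at hqs
      exact absurd (hps.trans hqs.symm) hlt.ne

theorem eventually_levelsAt (h : LocalRoots f x₀ δ y) (hδ : 0 < δ) (hfin : (fibre f x₀).Finite)
    (hab : IsSwitchPair a b) (hB : (switchSet f).Finite) {k l : ℕ} (hkl : k ≤ l)
    (hlim : ∀ᶠ ε : ℝ in 𝓝[>] 0, ∀ᶠ x : ℝ in 𝓝[≠] x₀, ∃ r s : ℝ,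
      IsNth (posIm f x) k r ∧ IsNth (posIm f x) l s ∧
      posIm f x ∩ Ioo ((a : ℂ).im - ε) ((a : ℂ).im + ε) = {r, s}) :
    ∀ᶠ x : ℝ in 𝓝[≠] x₀, x ∉ switchSet f ∧ (LevelsAt y k a b x ∨ LevelsAt y k b a x) ∧
      l = k + 1 := by
  obtain ⟨ε, hε, hε0⟩ := (hlim.and (self_mem_nhdsWithin : ∀ᶠ ε : ℝ in 𝓝[>] 0, 0 < ε)).exists
  have hI : Ioo (x₀ - δ) (x₀ + δ) ∈ 𝓝 x₀ := Ioo_mem_nhds (by linarith) (by linarith)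
  have hnear : ∀ i : fibre f x₀, (i : ℂ).im = (a : ℂ).im →
      ∀ᶠ x in 𝓝[≠] x₀, (y i x).im ∈ Ioo ((a : ℂ).im - ε) ((a : ℂ).im + ε) := by
    intro i hi
    have hc := Complex.continuous_im.continuousAt.comp ((h.continuousOn i).continuousAt hI)
    refine mem_nhdsWithin_of_mem_nhds (hc.preimage_mem_nhds (Ioo_mem_nhds ?_ ?_)) <;>
    · simp only [Function.comp_apply, h.apply_self, hi]; linarith
  have hBev : ∀ᶠ x in 𝓝[≠] x₀, x ∉ switchSet f := by
    -- Finiteness of the switching set isolates `x₀` from its other points.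
    have h1 : (switchSet f \ {x₀}).Finite := hB.subset sdiff_subset
    have h2 : (switchSet f \ {x₀})ᶜ ∈ 𝓝 x₀ := h1.isClosed.isOpen_compl.mem_nhds (by simp)
    filter_upwards [mem_nhdsWithin_of_mem_nhds h2, self_mem_nhdsWithin] with x hx hne hxB
    exact hx ⟨hxB, hne⟩
  filter_upwards [hε, hnear a rfl, hnear b hab.im_eq.symm, hBev, mem_nhdsWithin_of_mem_nhds hI]
    with x ⟨r, s, hr, hs, hrs⟩ ha hb hxB hx
  have hne : y a x ≠ y b x := fun e => by
    have := congrArg (fun z : fibre f x₀ => (z : ℂ).re) (h.injective x hx e)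
    exact hab.re_lt.ne this
  refine ⟨hxB, ?_⟩
  rcases lt_or_gt_of_ne (im_ne_of_notMem_switchSet hxB (h.mem hx a) (h.mem hx b) hne
    (h.im_pos hx hab.im_pos).ne') with hlt | hlt
  · obtain ⟨h1, h2⟩ := h.levelsAt hfin hx hxB hab.im_pos hab.im_eq (fun i => hab.eq_or_eq) hlt hkl
      hr hs hrs ha hb
    exact ⟨Or.inl h1, h2⟩
  · obtain ⟨h1, h2⟩ := h.levelsAt hfin hx hxB (hab.im_eq ▸ hab.im_pos) hab.im_eq.symm
      (fun i hi => (hab.eq_or_eq (hi.trans hab.im_eq.symm)).symm) hlt hkl hr hs hrs hb ha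
    exact ⟨Or.inr h1, h2⟩

/-- On an interval on which the heights differ, their order does not change. -/
theorem LocalRoots.levelsAt_const (h : LocalRoots f x₀ δ y) {k : ℕ} {u v : ℝ}
    (hsub : Ioo u v ⊆ Ioo (x₀ - δ) (x₀ + δ))
    (hl : ∀ x ∈ Ioo u v, LevelsAt y k a b x ∨ LevelsAt y k b a x) :
    (∀ x ∈ Ioo u v, LevelsAt y k a b x) ∨ (∀ x ∈ Ioo u v, LevelsAt y k b a x) := by
  by_contra! hcon
  obtain ⟨⟨x₁, hx₁, h₁⟩, ⟨x₂, hx₂, h₂⟩⟩ := hcon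
  have h₁' := (hl x₁ hx₁).resolve_left h₁
  have h₂' := (hl x₂ hx₂).resolve_right h₂
  have hc : ContinuousOn (fun x => (y b x).im - (y a x).im) (Ioo u v) :=
    (Complex.continuous_im.comp_continuousOn ((h.continuousOn b).mono hsub)).sub
      (Complex.continuous_im.comp_continuousOn ((h.continuousOn a).mono hsub))
  -- A change of order would force equal heights at an intermediate point.
  obtain ⟨x, hx, hx0⟩ := isPreconnected_Ioo.intermediate_value hx₁ hx₂ hc
    (show (0 : ℝ) ∈ Icc _ _ from ⟨by linarith [h₁'.im_lt], by linarith [h₂'.im_lt]⟩)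
  simp only at hx0
  rcases hl x hx with h3 | h3
  · linarith [h3.im_lt]
  · linarith [h3.im_lt]

theorem LocalRoots.upperReLT_iff (h : LocalRoots f x₀ δ y) (hfin : (fibre f x₀).Finite)
    {x : ℝ} (hx : x ∈ Ioo (x₀ - δ) (x₀ + δ)) (hxB : x ∉ switchSet f) {p q : fibre f x₀}
    (hp : 0 < (p : ℂ).im) (hq : 0 < (q : ℂ).im) {k l : ℕ}
    (hpk : upperCount f x (y p x).im = k) (hql : upperCount f x (y q x).im = l) :
    UpperReLT f x k l ↔ (y p x).re < (y q x).re := by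
  have hfx := h.finite hfin hx
  constructor
  · rintro ⟨z, w, ⟨hz, hz0, hzk⟩, ⟨hw, hw0, hwl⟩, hlt⟩
    rwa [← eq_of_upperCount_eq hfx hxB hz (h.mem hx p) hz0 (h.im_pos hx hp) (hzk.trans hpk.symm),
      ← eq_of_upperCount_eq hfx hxB hw (h.mem hx q) hw0 (h.im_pos hx hq) (hwl.trans hql.symm)]
  · intro hlt
    exact ⟨_, _, ⟨h.mem hx p, h.im_pos hx hp, hpk⟩, ⟨h.mem hx q, h.im_pos hx hq, hql⟩, hlt⟩

/-- Throughout the interval `a` is to the left of `b`, so the orientation depends only on which of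
them is the lower one before and after `x₀`; `L` and `R` say that this is `a`. -/
theorem LocalRoots.orientation_eq (h : LocalRoots f x₀ δ y) (hδ : 0 < δ)
    (hfin : (fibre f x₀).Finite) (hab : IsSwitchPair a b) {k : ℕ}
    (hB : ∀ x ∈ Ioo (x₀ - δ) (x₀ + δ), x ≠ x₀ → x ∉ switchSet f) {L R : Prop} [Decidable L]
    [Decidable R]
    (hL : ∀ x ∈ Ioo (x₀ - δ) x₀, if L then LevelsAt y k a b x else LevelsAt y k b a x)
    (hR : ∀ x ∈ Ioo x₀ (x₀ + δ), if R then LevelsAt y k a b x else LevelsAt y k b a x) :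
    orientation f x₀ k (k + 1) =
      if L then (if R then 0 else -1) else (if R then 1 else 0) := by
  have hb : 0 < (b : ℂ).im := hab.im_eq ▸ hab.im_pos
  have key : ∀ x ∈ Ioo (x₀ - δ) (x₀ + δ), x ≠ x₀ →
      (LevelsAt y k a b x → UpperReLT f x k (k + 1) ∧ ¬ UpperReLT f x (k + 1) k) ∧
      (LevelsAt y k b a x → ¬ UpperReLT f x k (k + 1) ∧ UpperReLT f x (k + 1) k) := by
    intro x hx hne
    have hre := h.re_lt x hx a b hab.re_lt
    refine ⟨fun hl => ?_, fun hl => ?_⟩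
    · rw [h.upperReLT_iff hfin hx (hB x hx hne) hab.im_pos hb hl.left hl.right,
        h.upperReLT_iff hfin hx (hB x hx hne) hb hab.im_pos hl.right hl.left]
      exact ⟨hre, hre.not_gt⟩
    · rw [h.upperReLT_iff hfin hx (hB x hx hne) hb hab.im_pos hl.left hl.right,
        h.upperReLT_iff hfin hx (hB x hx hne) hab.im_pos hb hl.right hl.left]
      exact ⟨hre.not_gt, hre⟩
  have hleft : ∀ᶠ x in 𝓝[<] x₀, x ∈ Ioo (x₀ - δ) x₀ := Ioo_mem_nhdsLT (by linarith)
  have hright : ∀ᶠ x in 𝓝[>] x₀, x ∈ Ioo x₀ (x₀ + δ) := Ioo_mem_nhdsGT (by linarith)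
  have keyL : ∀ᶠ x in 𝓝[<] x₀, (UpperReLT f x k (k + 1) ↔ L) ∧ (UpperReLT f x (k + 1) k ↔ ¬L) := by
    filter_upwards [hleft] with x hx
    have h1 := key x ⟨hx.1, by linarith [hx.2]⟩ hx.2.ne
    have h2 := hL x hx
    split_ifs at h2 with hLL
    · simp [hLL, h1.1 h2]
    · simp [hLL, h1.2 h2]
  have keyR : ∀ᶠ x in 𝓝[>] x₀, (UpperReLT f x k (k + 1) ↔ R) ∧ (UpperReLT f x (k + 1) k ↔ ¬R) := by
    filter_upwards [hright] with x hx
    have h1 := key x ⟨by linarith [hx.1], hx.2⟩ hx.1.ne'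
    have h2 := hR x hx
    split_ifs at h2 with hRR
    · simp [hRR, h1.1 h2]
    · simp [hRR, h1.2 h2]
  have e1 : (∀ᶠ x in 𝓝[<] x₀, UpperReLT f x (k + 1) k) ↔ ¬L := by
    rw [eventually_congr (keyL.mono fun x hx => hx.2), eventually_const]
  have e2 : (∀ᶠ x in 𝓝[>] x₀, UpperReLT f x k (k + 1)) ↔ R := by
    rw [eventually_congr (keyR.mono fun x hx => hx.1), eventually_const]
  have e3 : (∀ᶠ x in 𝓝[<] x₀, UpperReLT f x k (k + 1)) ↔ L := by
    rw [eventually_congr (keyL.mono fun x hx => hx.1), eventually_const]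
  have e4 : (∀ᶠ x in 𝓝[>] x₀, UpperReLT f x (k + 1) k) ↔ ¬R := by
    rw [eventually_congr (keyR.mono fun x hx => hx.2), eventually_const]
  rw [orientation]
  simp only [e1, e2, e3, e4]
  by_cases hLL : L <;> by_cases hRR : R <;> simp [hLL, hRR]

end

/-! ### The motion of the fibre through a switching point -/

theorem SameMappingClass.congr_right {c : ℂ} {r : ℝ} {P : Set ℂ} {g h h' : ℂ → ℂ}
    (H : SameMappingClass c r P g h) (hh : EqOn h h' (Metric.closedBall c r)) :
    SameMappingClass c r P g h' := by
  obtain ⟨G, h1, h2, h3, h4⟩ := H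
  exact ⟨G, h1, h2, h3, h4.trans hh⟩

/-- A continuous choice of points among finitely many disjoint paths follows one of them. -/
theorem eq_of_continuousOn_of_mem {ι : Type*} [Finite ι] {l : ℝ → ι → ℂ}
    (hl : ∀ i, ContinuousOn (fun t => l t i) (Icc 0 1))
    (hinj : ∀ t ∈ Icc (0 : ℝ) 1, Function.Injective (l t)) {g : ℝ → ℂ}
    (hg : ContinuousOn g (Icc 0 1)) (hmem : ∀ t ∈ Icc (0 : ℝ) 1, ∃ j, l t j = g t) {i : ι}
    (h0 : g 0 = l 0 i) {t : ℝ} (ht : t ∈ Icc (0 : ℝ) 1) : g t = l t i := by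
  have hclosed : ∀ j, IsClosed {t | t ∈ Icc (0 : ℝ) 1 ∧ g t - l t j = 0} := fun j =>
    (hg.sub (hl j)).preimage_isClosed_of_isClosed isClosed_Icc isClosed_singleton
  have h1 : IsClosed (⋃ j : {j // j ≠ i}, {t | t ∈ Icc (0 : ℝ) 1 ∧ g t - l t j = 0}) :=
    isClosed_iUnion_of_finite fun j => hclosed j
  by_contra hne
  obtain ⟨s, hs, ⟨_, hs1⟩, hs2⟩ := isPreconnected_closed_iff.1 isPreconnected_Icc _ _
    (hclosed i) h1
    (fun s hs => by
      obtain ⟨j, hj⟩ := hmem s hs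
      by_cases hji : j = i
      · left; exact ⟨hs, by rw [← hji, hj, sub_self]⟩
      · right; exact mem_iUnion.2 ⟨⟨j, hji⟩, hs, by rw [hj, sub_self]⟩)
    ⟨0, by simp, by simp, by rw [h0, sub_self]⟩
    ⟨t, ht, by
      obtain ⟨j, hj⟩ := hmem t ht
      refine mem_iUnion.2 ⟨⟨j, ?_⟩, ht, by rw [hj, sub_self]⟩
      rintro rfl
      exact hne hj.symm⟩
  obtain ⟨⟨j, hji⟩, _, hs2⟩ := mem_iUnion.1 hs2
  exact hji (hinj s hs ((sub_eq_zero.1 hs2).symm.trans (sub_eq_zero.1 hs1)))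

theorem convex_combination_lt {A B C D t : ℝ} (ht : t ∈ Icc (0 : ℝ) 1) (h1 : A < B) (h2 : C < D) :
    (1 - t) * A + t * C < (1 - t) * B + t * D := by
  rcases eq_or_lt_of_le ht.1 with h0 | h0
  · subst h0; linarith
  · nlinarith [ht.2]

section

variable {f : Polynomial (Polynomial ℝ)} {x₀ δ : ℝ} {y : fibre f x₀ → ℝ → ℂ} {a b : fibre f x₀}

/-- Different heights are settled by imaginary parts and two real points by real parts. By
`classify` the only other pairs are the switching pair, where `h3` applies, and its conjugate, where
`h3` is transported by conjugation. -/
theorem IsSwitchPair.div_mem_slitPlane (hab : IsSwitchPair a b) {p : fibre f x₀ → ℂ}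
    (h1 : ∀ i j : fibre f x₀, (i : ℂ).im < (j : ℂ).im → (p i).im < (p j).im)
    (h2 : ∀ i j : fibre f x₀, (i : ℂ).im = 0 → (j : ℂ).im = 0 → (i : ℂ).re < (j : ℂ).re →
      (p i).re < (p j).re)
    (h3 : (p a - p b).im ≠ 0 ∨ (p a - p b).re < 0)
    (hca : p (conjIndex a) = (starRingEnd ℂ) (p a))
    (hcb : p (conjIndex b) = (starRingEnd ℂ) (p b)) {i j : fibre f x₀} (hij : i ≠ j) :
    (p i - p j) / ((i : ℂ) - j) ∈ Complex.slitPlane := by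
  have key : ∀ i j : fibre f x₀, ((i : ℂ).im < (j : ℂ).im ∨
      ((i : ℂ).im = (j : ℂ).im ∧ (i : ℂ).re < (j : ℂ).re)) →
      (p i - p j) / ((i : ℂ) - j) ∈ Complex.slitPlane := by
    rintro i j (him | ⟨him, hre⟩)
    · refine div_mem_slitPlane_of_im (mul_pos_of_neg_of_neg ?_ ?_)
      · rw [Complex.sub_im]; linarith [h1 i j him]
      · rw [Complex.sub_im]; linarith
    · by_cases h0 : (i : ℂ).im = 0
      · refine div_mem_slitPlane_of_re (mul_pos_of_neg_of_neg ?_ ?_)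
        · rw [Complex.sub_re]; linarith [h2 i j h0 (him ▸ h0) hre]
        · rw [Complex.sub_re]; linarith
      · refine div_mem_slitPlane_of_neg (by rw [Complex.sub_im, him, sub_self])
          (by rw [Complex.sub_re]; linarith) ?_
        rcases hab.classify i j him h0 hre with ⟨rfl, rfl⟩ | ⟨rfl, rfl⟩
        · exact h3
        · rw [hca, hcb, ← map_sub, Complex.conj_im, Complex.conj_re, neg_ne_zero]
          exact h3
  have sw : (p i - p j) / ((i : ℂ) - j) = (p j - p i) / ((j : ℂ) - i) := by
    rw [← neg_sub (p j), ← neg_sub (j : ℂ), neg_div_neg_eq]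
  rcases lt_trichotomy (i : ℂ).im (j : ℂ).im with h | h | h
  · exact key i j (Or.inl h)
  · rcases lt_trichotomy (i : ℂ).re (j : ℂ).re with h' | h' | h'
    · exact key i j (Or.inr ⟨h, h'⟩)
    · exact absurd (Subtype.ext (Complex.ext h' h)) hij
    · rw [sw]; exact key j i (Or.inr ⟨h.symm, h'⟩)
  · rw [sw]; exact key j i (Or.inl h)

theorem LocalRoots.div_mem_slitPlane (h : LocalRoots f x₀ δ y) (hab : IsSwitchPair a b) {x : ℝ}
    (hx : x ∈ Ioo (x₀ - δ) (x₀ + δ)) {i j : fibre f x₀} (hij : i ≠ j) :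
    (y i x - y j x) / ((i : ℂ) - j) ∈ Complex.slitPlane := by
  refine hab.div_mem_slitPlane (p := fun i => y i x) (h.im_lt x hx)
    (fun i j _ _ hre => h.re_lt x hx i j hre) (Or.inr ?_) (h.conjIndex hx a) (h.conjIndex hx b) hij
  rw [Complex.sub_re]; linarith [h.re_lt x hx a b hab.re_lt]

/-- A fibre off the switching point and its model have the same order of heights, and of real points
on the axis, so every interpolation has it. The exchanged points thus keep different heights along
the whole segment. -/
theorem LocalRoots.segment_div_mem_slitPlane (h : LocalRoots f x₀ δ y)
    (hfin : (fibre f x₀).Finite) (hab : IsSwitchPair a b) {x : ℝ}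
    (hx : x ∈ Ioo (x₀ - δ) (x₀ + δ)) (hne : (y a x).im ≠ (y b x).im) {t : ℝ}
    (ht : t ∈ Icc (0 : ℝ) 1) {i j : fibre f x₀} (hij : i ≠ j) :
    ((1 - t) * (y i x - y j x) + t * (modelPoint f x (y i x) - modelPoint f x (y j x))) /
      ((i : ℂ) - j) ∈ Complex.slitPlane := by
  have hfx := h.finite hfin hx
  set p : fibre f x₀ → ℂ := fun i => ((1 - t : ℝ) : ℂ) * y i x + (t : ℂ) * modelPoint f x (y i x)
    with hp
  have him : ∀ i, (p i).im = (1 - t) * (y i x).im + t * (modelPoint f x (y i x)).im := by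
    intro i; simp only [hp, Complex.add_im, Complex.im_ofReal_mul]
  have hre : ∀ i, (p i).re = (1 - t) * (y i x).re + t * (modelPoint f x (y i x)).re := by
    intro i; simp only [hp, Complex.add_re, Complex.re_ofReal_mul]
  have hconj : ∀ i, p (RealCurve.conjIndex i) = (starRingEnd ℂ) (p i) := by
    intro i
    simp only [hp, map_add, map_mul, Complex.conj_ofReal, h.conjIndex hx, modelPoint_conj]
  have hlt : ∀ i j, (y i x).im < (y j x).im → (p i).im < (p j).im := fun i j hlt => by
    rw [him, him]
    exact convex_combination_lt ht hlt (modelPoint_im_lt hfx (h.mem hx i) (h.mem hx j) hlt)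
  have e : (1 - t) * (y i x - y j x) + t * (modelPoint f x (y i x) - modelPoint f x (y j x)) =
      p i - p j := by
    simp only [hp]; push_cast; ring
  rw [e]
  refine hab.div_mem_slitPlane (fun i j hlt' => hlt i j (h.im_lt x hx i j hlt'))
    (fun i j hi hj hlt' => ?_) (Or.inl ?_) (hconj a) (hconj b) hij
  · rw [hre, hre]
    exact convex_combination_lt ht (h.re_lt x hx i j hlt')
      (modelPoint_re_lt hfx (h.mem hx j) (h.im_eq_zero hx hi) (h.im_eq_zero hx hj)
        (h.re_lt x hx i j hlt'))
  · rw [Complex.sub_im]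
    rcases lt_or_gt_of_ne hne with h' | h'
    · exact (sub_neg.2 (hlt a b h')).ne
    · exact (sub_pos.2 (hlt b a h')).ne'

theorem LocalRoots.level_conjIndex (h : LocalRoots f x₀ δ y) {x : ℝ}
    (hx : x ∈ Ioo (x₀ - δ) (x₀ + δ)) (i : fibre f x₀) :
    level f x (y (RealCurve.conjIndex i) x) = -level f x (y i x) := by
  rw [h.conjIndex hx, level_conj]

/-- The levels of the two exchanged points are `k` and `k + 1`. -/
theorem LocalRoots.level_mem (h : LocalRoots f x₀ δ y) (hab : IsSwitchPair a b) {x : ℝ}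
    (hx : x ∈ Ioo (x₀ - δ) (x₀ + δ)) {k : ℕ} :
    (LevelsAt y k a b x → level f x (y a x) = k ∧ level f x (y b x) = k + 1) ∧
    (LevelsAt y k b a x → level f x (y a x) = k + 1 ∧ level f x (y b x) = k) := by
  have ha := h.im_pos hx hab.im_pos
  have hb := h.im_pos hx (hab.im_eq ▸ hab.im_pos)
  rw [level_of_im_pos ha, level_of_im_pos hb]
  refine ⟨fun hl => ?_, fun hl => ?_⟩ <;> rw [hl.left, hl.right] <;> simp

theorem LocalRoots.level_ne (h : LocalRoots f x₀ δ y) (hfin : (fibre f x₀).Finite)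
    (hab : IsSwitchPair a b) {x : ℝ} (hx : x ∈ Ioo (x₀ - δ) (x₀ + δ)) {k : ℕ}
    (hl : LevelsAt y k a b x ∨ LevelsAt y k b a x) {i : fibre f x₀}
    (hi : (i : ℂ).im ≠ (a : ℂ).im) :
    level f x (y i x) ≠ k ∧ level f x (y i x) ≠ k + 1 := by
  have hfx := h.finite hfin hx
  have key : ∀ c : fibre f x₀, (i : ℂ).im ≠ (c : ℂ).im →
      level f x (y i x) ≠ level f x (y c x) := by
    intro c hc
    rcases lt_or_gt_of_ne hc with h1 | h1
    · exact (level_lt hfx (h.mem hx i) (h.mem hx c) (h.im_lt x hx i c h1)).ne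
    · exact (level_lt hfx (h.mem hx c) (h.mem hx i) (h.im_lt x hx c i h1)).ne'
  have ha := key a hi
  have hb := key b (hab.im_eq ▸ hi)
  rcases hl with hl | hl
  · obtain ⟨h1, h2⟩ := (h.level_mem hab hx).1 hl
    exact ⟨h1 ▸ ha, h2 ▸ hb⟩
  · obtain ⟨h1, h2⟩ := (h.level_mem hab hx).2 hl
    exact ⟨h2 ▸ hb, h1 ▸ ha⟩

theorem LocalRoots.level_ne_neg (h : LocalRoots f x₀ δ y) (hfin : (fibre f x₀).Finite)
    (hab : IsSwitchPair a b) {x : ℝ} (hx : x ∈ Ioo (x₀ - δ) (x₀ + δ)) {k : ℕ}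
    (hl : LevelsAt y k a b x ∨ LevelsAt y k b a x) {i : fibre f x₀}
    (hi : (i : ℂ).im ≠ -(a : ℂ).im) :
    level f x (y i x) ≠ -k ∧ level f x (y i x) ≠ -(k + 1) := by
  have h1 := h.level_ne hfin hab hx hl (i := RealCurve.conjIndex i)
    (by simp only [RealCurve.conjIndex, Complex.conj_im]; intro e; exact hi (by linarith))
  rw [h.level_conjIndex hx] at h1
  omega

theorem modelPoint_re_of_level {x : ℝ} {w : ℂ} (hw : level f x w ≠ 0) :
    (modelPoint f x w).re = f.natDegree + 1 :=
  modelPoint_re fun h0 => hw (by simp [level, h0])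

/-- The imaginary part vanishes only where `cos (e π t) = 0`, and there the real part is `-s sin (e
π t)`, which is negative because `e` and `s` have the same sign. This is where the sign of the
orientation enters. -/
theorem twisted_difference {s e t : ℝ} (ht : t ∈ Icc (0 : ℝ) 1) (hs : s ≠ 0)
    (he : e = 0 ∨ (e = 1 ∧ s = 1) ∨ (e = -1 ∧ s = -1)) {w : ℂ}
    (hw : w = Complex.exp ((e * Real.pi * t : ℝ) * Complex.I) * (s * Complex.I)) :
    w.im ≠ 0 ∨ w.re < 0 := by
  have hre : w.re = -(s * Real.sin (e * Real.pi * t)) := by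
    rw [hw, Complex.mul_re, Complex.exp_ofReal_mul_I_re, Complex.exp_ofReal_mul_I_im]
    simp; ring
  have him : w.im = s * Real.cos (e * Real.pi * t) := by
    rw [hw, Complex.mul_im, Complex.exp_ofReal_mul_I_re, Complex.exp_ofReal_mul_I_im]
    simp; ring
  by_cases hc : Real.cos (e * Real.pi * t) = 0
  · right
    have h2 : 0 ≤ Real.sin (Real.pi * t) :=
      Real.sin_nonneg_of_nonneg_of_le_pi (mul_nonneg Real.pi_pos.le ht.1)
        (by nlinarith [Real.pi_pos, ht.2])
    have h1 := Real.sin_sq_add_cos_sq (e * Real.pi * t)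
    rw [hc] at h1
    rcases he with rfl | ⟨rfl, rfl⟩ | ⟨rfl, rfl⟩
    · simp at hc
    · simp only [one_mul] at h1 hre
      rw [hre]
      nlinarith
    · rw [show -1 * Real.pi * t = -(Real.pi * t) by ring, Real.sin_neg] at h1 hre
      rw [hre]
      nlinarith
  · left
    rw [him]; exact mul_ne_zero hs hc

theorem LocalRoots.twist_div_mem_slitPlane (h : LocalRoots f x₀ δ y)
    (hfin : (fibre f x₀).Finite) (hab : IsSwitchPair a b) {x : ℝ}
    (hx : x ∈ Ioo (x₀ - δ) (x₀ + δ)) {k : ℕ} (hk : 1 ≤ k) {e : ℝ}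
    (hl : LevelsAt y k a b x ∨ LevelsAt y k b a x)
    (he : e = 0 ∨ (e = 1 ∧ LevelsAt y k b a x) ∨ (e = -1 ∧ LevelsAt y k a b x)) {t : ℝ}
    (ht : t ∈ Icc (0 : ℝ) 1) {i j : fibre f x₀} (hij : i ≠ j) :
    (twist f.natDegree k e t (modelPoint f x (y i x)) -
      twist f.natDegree k e t (modelPoint f x (y j x))) / ((i : ℂ) - j) ∈ Complex.slitPlane := by
  have hfx := h.finite hfin hx
  have hab_level : (level f x (y a x) = k ∧ level f x (y b x) = k + 1) ∨
      (level f x (y a x) = k + 1 ∧ level f x (y b x) = k) :=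
    hl.imp (h.level_mem hab hx).1 (h.level_mem hab hx).2
  have ha : level f x (y a x) = k ∨ level f x (y a x) = k + 1 :=
    hab_level.imp (fun h => h.1) fun h => h.1
  have hb : level f x (y b x) = k ∨ level f x (y b x) = k + 1 :=
    hab_level.symm.imp (fun h => h.2) fun h => h.2
  have hre : ∀ i, level f x (y i x) = k ∨ level f x (y i x) = k + 1 →
      (modelPoint f x (y i x)).re = f.natDegree + 1 := fun i hi => modelPoint_re_of_level (by omega)
  have him : ∀ i, level f x (y i x) = k ∨ level f x (y i x) = k + 1 →
      (modelPoint f x (y i x)).im = k ∨ (modelPoint f x (y i x)).im = k + 1 := by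
    intro i hi
    rw [modelPoint_im]
    exact hi.imp (fun h => by rw [h]; simp) fun h => by rw [h]; simp
  have hconj : ∀ i, level f x (y i x) = k ∨ level f x (y i x) = k + 1 →
      twist f.natDegree k e t (modelPoint f x (y (RealCurve.conjIndex i) x)) =
      (starRingEnd ℂ) (twist f.natDegree k e t (modelPoint f x (y i x))) := by
    intro i hi
    rw [h.conjIndex hx, modelPoint_conj, twist_conj_of_near hk e t (hre i hi) (him i hi)]
  refine hab.div_mem_slitPlane (p := fun i => twist f.natDegree k e t (modelPoint f x (y i x)))
    (fun i j hlt => ?_) (fun i j hi hj hlt => ?_) ?_ (hconj a ha) (hconj b hb) hij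
  · refine twist_im_lt hk e t (modelPoint_im f x _) (modelPoint_im f x _)
      modelPoint_re_of_level modelPoint_re_of_level
      (level_lt hfx (h.mem hx i) (h.mem hx j) (h.im_lt x hx i j hlt)) ?_ ?_
    · rintro ⟨h1, h2⟩
      have e1 : (i : ℂ).im = (a : ℂ).im := by
        by_contra hne; exact (h.level_ne hfin hab hx hl hne).1 h1
      have e2 : (j : ℂ).im = (a : ℂ).im := by
        by_contra hne; exact (h.level_ne hfin hab hx hl hne).2 h2
      linarith
    · rintro ⟨h1, h2⟩
      have e1 : (i : ℂ).im = -(a : ℂ).im := by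
        by_contra hne; exact (h.level_ne_neg hfin hab hx hl hne).2 h1
      have e2 : (j : ℂ).im = -(a : ℂ).im := by
        by_contra hne; exact (h.level_ne_neg hfin hab hx hl hne).1 h2
      linarith
  · have hz : ∀ i : fibre f x₀, (i : ℂ).im = 0 →
        twist f.natDegree k e t (modelPoint f x (y i x)) = modelPoint f x (y i x) := by
      intro i hi
      have h0 : level f x (y i x) = 0 := by simp [level, h.im_eq_zero hx hi]
      exact twist_eq_self hk e t (modelPoint_im f x _) (by omega) (by omega) (by omega) (by omega)
    simp only [hz i hi, hz j hj]
    exact modelPoint_re_lt hfx (h.mem hx j) (h.im_eq_zero hx hi) (h.im_eq_zero hx hj)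
      (h.re_lt x hx i j hlt)
  -- The exchanged model points are one unit apart on a vertical line; `s` is the sign of their
  -- difference of heights.
  · set s : ℝ := (level f x (y a x) : ℝ) - level f x (y b x) with hs
    have hsv : s = 1 ∨ s = -1 := by
      rw [hs]
      rcases hab_level with ⟨h1, h2⟩ | ⟨h1, h2⟩ <;> rw [h1, h2] <;> simp
    have hdiff : modelPoint f x (y a x) - modelPoint f x (y b x) = s * Complex.I := by
      refine Complex.ext ?_ ?_
      · rw [Complex.sub_re, hre a ha, hre b hb]; simp
      · rw [Complex.sub_im, modelPoint_im, modelPoint_im]; simp [hs]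
    refine twisted_difference (s := s) (e := e) ht (by rcases hsv with h | h <;> rw [h] <;> simp) ?_ ?_
    · refine he.imp_right (Or.imp ?_ ?_)
      · rintro ⟨rfl, hl'⟩
        obtain ⟨h1, h2⟩ := (h.level_mem hab hx).2 hl'
        exact ⟨rfl, by rw [hs, h1, h2]; simp⟩
      · rintro ⟨rfl, hl'⟩
        obtain ⟨h1, h2⟩ := (h.level_mem hab hx).1 hl'
        exact ⟨rfl, by rw [hs, h1, h2]; simp⟩
    · rw [twist_of_near_upper hk e t (hre a ha) (him a ha),
        twist_of_near_upper hk e t (hre b hb) (him b hb), ← hdiff]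
      ring

/-- The twist carries the model of the fibre on one side to the model on the other side. -/
theorem LocalRoots.twist_modelPoint (h : LocalRoots f x₀ δ y)
    (hfin : (fibre f x₀).Finite) (hab : IsSwitchPair a b) {x x' : ℝ}
    (hx : x ∈ Ioo (x₀ - δ) (x₀ + δ)) (hx' : x' ∈ Ioo (x₀ - δ) (x₀ + δ)) {k : ℕ} (hk : 1 ≤ k)
    {e : ℝ}
    (he : (e = 0 ∧ ((LevelsAt y k a b x ∧ LevelsAt y k a b x') ∨
        (LevelsAt y k b a x ∧ LevelsAt y k b a x'))) ∨
      ((e = 1 ∨ e = -1) ∧ ((LevelsAt y k a b x ∧ LevelsAt y k b a x') ∨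
        (LevelsAt y k b a x ∧ LevelsAt y k a b x')))) (i : fibre f x₀) :
    twist f.natDegree k e 1 (modelPoint f x (y i x)) = modelPoint f x' (y i x') := by
  have hl : LevelsAt y k a b x ∨ LevelsAt y k b a x := by tauto
  have near : ∀ i : fibre f x₀, (level f x (y i x) = k ∨ level f x (y i x) = k + 1) →
      ((e = 0 ∧ level f x' (y i x') = level f x (y i x)) ∨
        ((e = 1 ∨ e = -1) ∧ level f x (y i x) + level f x' (y i x') = 2 * k + 1)) →
      (modelPoint f x (y i x)).re = f.natDegree + 1 ∧
      ((modelPoint f x (y i x)).im = k ∨ (modelPoint f x (y i x)).im = k + 1) ∧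
      twist f.natDegree k e 1 (modelPoint f x (y i x)) = modelPoint f x' (y i x') := by
    intro i h1 h2
    have hre := modelPoint_re_of_level (f := f) (x := x) (w := y i x) (by omega)
    have hre' := modelPoint_re_of_level (f := f) (x := x') (w := y i x') (by omega)
    have him : (modelPoint f x (y i x)).im = k ∨ (modelPoint f x (y i x)).im = k + 1 := by
      rw [modelPoint_im]
      exact h1.imp (fun h => by rw [h]; simp) fun h => by rw [h]; simp
    refine ⟨hre, him, ?_⟩
    rw [twist_of_near_upper hk e 1 hre him]
    rcases h2 with ⟨rfl, h2⟩ | ⟨he, h2⟩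
    · refine Complex.ext ?_ ?_
      · simp [hre, hre']
      · simp [modelPoint_im, h2]
    -- A half turn in either sense reflects in the centre at height `k + 1/2`, so it matches levels
    -- whose sum is `2k + 1`.
    · have hexp : Complex.exp ((e * Real.pi * 1 : ℝ) * Complex.I) = -1 := by
        rcases he with rfl | rfl
        · simp
        · simp [Complex.exp_neg]
      rw [hexp]
      refine Complex.ext ?_ ?_
      · simp [hre, hre', upperCentre_re]
      · have h3 : (level f x (y i x) : ℝ) + level f x' (y i x') = 2 * k + 1 := by exact_mod_cast h2
        simp only [Complex.add_im, neg_mul, one_mul, Complex.neg_im, Complex.sub_im, modelPoint_im,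
          upperCentre_im]
        linarith
  have M := h.level_mem hab hx (k := k)
  have M' := h.level_mem hab hx' (k := k)
  have Ha : (level f x (y a x) = k ∨ level f x (y a x) = k + 1) ∧
      ((e = 0 ∧ level f x' (y a x') = level f x (y a x)) ∨
        ((e = 1 ∨ e = -1) ∧ level f x (y a x) + level f x' (y a x') = 2 * k + 1)) := by
    rcases he with ⟨h0, ⟨h1, h2⟩ | ⟨h1, h2⟩⟩ | ⟨h0, ⟨h1, h2⟩ | ⟨h1, h2⟩⟩
    · exact ⟨Or.inl (M.1 h1).1, Or.inl ⟨h0, by rw [(M.1 h1).1, (M'.1 h2).1]⟩⟩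
    · exact ⟨Or.inr (M.2 h1).1, Or.inl ⟨h0, by rw [(M.2 h1).1, (M'.2 h2).1]⟩⟩
    · exact ⟨Or.inl (M.1 h1).1, Or.inr ⟨h0, by rw [(M.1 h1).1, (M'.2 h2).1]; ring⟩⟩
    · exact ⟨Or.inr (M.2 h1).1, Or.inr ⟨h0, by rw [(M.2 h1).1, (M'.1 h2).1]; ring⟩⟩
  have Hb : (level f x (y b x) = k ∨ level f x (y b x) = k + 1) ∧
      ((e = 0 ∧ level f x' (y b x') = level f x (y b x)) ∨
        ((e = 1 ∨ e = -1) ∧ level f x (y b x) + level f x' (y b x') = 2 * k + 1)) := by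
    rcases he with ⟨h0, ⟨h1, h2⟩ | ⟨h1, h2⟩⟩ | ⟨h0, ⟨h1, h2⟩ | ⟨h1, h2⟩⟩
    · exact ⟨Or.inr (M.1 h1).2, Or.inl ⟨h0, by rw [(M.1 h1).2, (M'.1 h2).2]⟩⟩
    · exact ⟨Or.inl (M.2 h1).2, Or.inl ⟨h0, by rw [(M.2 h1).2, (M'.2 h2).2]⟩⟩
    · exact ⟨Or.inr (M.1 h1).2, Or.inr ⟨h0, by rw [(M.1 h1).2, (M'.2 h2).2]; ring⟩⟩
    · exact ⟨Or.inl (M.2 h1).2, Or.inr ⟨h0, by rw [(M.2 h1).2, (M'.1 h2).2]; ring⟩⟩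
  have Na := near a Ha.1 Ha.2
  have Nb := near b Hb.1 Hb.2
  by_cases h1 : (i : ℂ).im = (a : ℂ).im
  · rcases hab.eq_or_eq h1 with rfl | rfl
    · exact Na.2.2
    · exact Nb.2.2
  by_cases h2 : (i : ℂ).im = -(a : ℂ).im
  · rcases hab.eq_or_eq_conj h2 with rfl | rfl
    · rw [h.conjIndex hx, h.conjIndex hx', modelPoint_conj, modelPoint_conj,
        twist_conj_of_near hk e 1 Na.1 Na.2.1, Na.2.2]
    · rw [h.conjIndex hx, h.conjIndex hx', modelPoint_conj, modelPoint_conj,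
        twist_conj_of_near hk e 1 Nb.1 Nb.2.1, Nb.2.2]
  obtain ⟨n1, n2⟩ := h.level_ne hfin hab hx hl h1
  obtain ⟨n3, n4⟩ := h.level_ne_neg hfin hab hx hl h2
  rw [twist_eq_self hk e 1 (modelPoint_im f x _) n1 n2 n3 n4]
  exact h.modelPoint_eq hx hx' fun h0 => hab.unique h1 h2 h0

end

/-! ### Assembling the data at the switching point -/

/-- An interval around a switching point on which the fibres are described by local roots, lie in
the disc `D`, and have the levels `k`, `k + 1` exchanged at most at the centre. -/
theorem exists_switch_interval {f : Polynomial (Polynomial ℝ)} (hf : IsAdmissible f)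
    {cE : ℂ} {rE : ℝ} {cD : ℂ} {rD : ℝ}
    (hD : ∀ x ∈ Metric.closedBall cE rE, fibre f x ⊆ Metric.closedBall cD rD)
    {x₀ : ℝ} (hx₀ : x₀ ∈ switchSet f) (hx₀E : (x₀ : ℂ) ∈ Metric.ball cE rE)
    {k l : ℕ} (hkl : IsComplexLefschetzPair f x₀ k l) :
    ∃ δ > 0, ∃ y, LocalRoots f x₀ δ y ∧ ∃ a b : fibre f x₀, IsSwitchPair a b ∧
      (fibre f x₀).Finite ∧ (fibre f x₀).ncard = f.natDegree ∧ l = k + 1 ∧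
      (∀ x ∈ Ioo (x₀ - δ) (x₀ + δ), fibre f x ⊆ Metric.closedBall cD rD) ∧
      ∀ x ∈ Ioo (x₀ - δ) (x₀ + δ), x ≠ x₀ → x ∉ switchSet f ∧
        (LevelsAt y k a b x ∨ LevelsAt y k b a x) := by
  obtain ⟨hle, z, w, hzw, hz0, hlim⟩ := hkl
  obtain ⟨hlc, hcard⟩ := regular_of_notMem_branchSet
    (Metric.isBounded_closedBall.subset (hD x₀ (Metric.ball_subset_closedBall hx₀E)))
    (hf.disjoint x₀ hx₀)
  have hfin := finite_fibre (fibrePoly_ne_zero_of_coeff hlc)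
  obtain ⟨a, b, rfl, rfl, hab⟩ := exists_isSwitchPair (hf.two_pairs x₀ hx₀) hzw hz0
  obtain ⟨δ, hδ, y, hy⟩ := exists_localRoots hlc hcard
  have h1 := eventually_levelsAt hy hδ hfin hab hf.switchSet_finite hle hlim
  have h2 : ∀ᶠ x : ℝ in 𝓝 x₀, (x : ℂ) ∈ Metric.ball cE rE :=
    Complex.continuous_ofReal.continuousAt.eventually (Metric.isOpen_ball.mem_nhds hx₀E)
  obtain ⟨η, hη, hη'⟩ := Metric.eventually_nhds_iff_ball.1
    ((eventually_nhdsWithin_iff.1 h1).and h2)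
  rw [Real.ball_eq_Ioo] at hη'
  have hsub : ∀ {x}, x ∈ Ioo (x₀ - min δ η) (x₀ + min δ η) → x ∈ Ioo (x₀ - η) (x₀ + η) :=
    fun hx => ⟨by linarith [hx.1, min_le_right δ η], by linarith [hx.2, min_le_right δ η]⟩
  refine ⟨min δ η, lt_min hδ hη, y, hy.mono (min_le_left _ _), a, b, hab, hfin, hcard, ?_,
    fun x hx => hD x (Metric.ball_subset_closedBall (hη' x (hsub hx)).2),
    fun x hx hne => ⟨((hη' x (hsub hx)).1 hne).1, ((hη' x (hsub hx)).1 hne).2.1⟩⟩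
  exact ((hη' (x₀ + η / 2) ⟨by linarith, by linarith⟩).1
    (by simp [hη.ne'])).2.2

theorem IsFibreModel.exists_isDiscPath {f : Polynomial (Polynomial ℝ)} {c : ℂ} {r : ℝ}
    {b : ℝ → ℂ → ℂ} {x : ℝ} {β : PartialEquiv ℂ ℂ} (hβ : IsFibreModel f c r b x β) :
    ∃ F, IsDiscPath c r (f.natDegree + 1 : ℂ) (f.natDegree + 1 : ℝ) b F ∧
      (∀ t ∈ Icc (0 : ℝ) 1, ∀ y ∈ fibre f x, F t y = (1 - t) * y + t * modelPoint f x y) ∧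
      EqOn (F 1) β (Metric.closedBall c r) := by
  obtain ⟨-, -, F, hF, hFc, hF0, hF1⟩ := hβ
  exact ⟨F, ⟨fun t ht => (hF t ht).1, fun t ht z hz => ((hF t ht).2.1 z hz).1, hFc, hF0⟩,
    fun t ht => (hF t ht).2.2, hF1⟩

theorem IsDiffeo.symm_eqOn {e e' : PartialEquiv ℂ ℂ} {U V : Set ℂ} (h : IsDiffeo e U V)
    (h' : IsDiffeo e' U V) (heq : EqOn e e' U) : EqOn e.symm e'.symm V := fun z hz => by
  have h1 := h.symm.mapsTo hz
  have h2 := h'.left_inv h1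
  rw [← heq h1, h.right_inv hz] at h2
  exact h2.symm

end RealCurve

end

/-! ### Proof of the proposition -/

theorem mainTheorem3 (f : Polynomial (Polynomial ℝ)) (hf : RealCurve.IsAdmissible f)
    (cE : ℂ) (rE : ℝ) (hE : RealCurve.branchSet f ⊆ Metric.ball cE rE)
    (cD : ℂ) (rD : ℝ)
    (hD : ∀ x ∈ Metric.closedBall cE rE, RealCurve.fibre f x ⊆ Metric.closedBall cD rD)
    (x₀ : ℝ) (hx₀ : x₀ ∈ RealCurve.switchSet f) (hx₀E : (x₀ : ℂ) ∈ Metric.ball cE rE)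
    (k l : ℕ) (hkl : RealCurve.IsComplexLefschetzPair f x₀ k l) :
    ∃ α₀ : ℝ, 0 < α₀ ∧ ∀ α : ℝ, 0 < α → α < α₀ →
      ∀ (b : ℝ → ℂ → ℂ) (β₁ β₂ ψ : PartialEquiv ℂ ℂ),
        RealCurve.IsFibreModel f cD rD b (x₀ - α) β₁ →
        RealCurve.IsFibreModel f cD rD b (x₀ + α) β₂ →
        RealCurve.IsLefschetzDiffeo f cD rD (fun t : ℝ => ((x₀ - α + 2 * α * t : ℝ) : ℂ)) ψ →
        RealCurve.SameMappingClass (f.natDegree + 1 : ℂ) (f.natDegree + 1 : ℝ)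
          (RealCurve.modelConfig f.natDegree (RealCurve.numNonreal f x₀))
          (RealCurve.deltaCom f.natDegree k l ^ RealCurve.orientation f x₀ k l : Equiv.Perm ℂ)
          ((β₁.symm.trans ψ).trans β₂) := by
  classical
  open RealCurve in
  obtain ⟨δ, hδ, y, hy, p, q, hpq, hfin, hcard, rfl, hyD, hB⟩ :=
    exists_switch_interval hf hD hx₀ hx₀E hkl
  have hsubL : Ioo (x₀ - δ) x₀ ⊆ Ioo (x₀ - δ) (x₀ + δ) :=
    Ioo_subset_Ioo le_rfl (by linarith)
  have hsubR : Ioo x₀ (x₀ + δ) ⊆ Ioo (x₀ - δ) (x₀ + δ) :=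
    Ioo_subset_Ioo (by linarith) le_rfl
  obtain ⟨L, hL⟩ : ∃ L : Prop, ∀ x ∈ Ioo (x₀ - δ) x₀,
      if L then LevelsAt y k p q x else LevelsAt y k q p x := by
    rcases hy.levelsAt_const (k := k) hsubL (fun x hx => (hB x (hsubL hx) hx.2.ne).2) with h | h
    · exact ⟨True, by simpa using h⟩
    · exact ⟨False, by simpa using h⟩
  obtain ⟨R, hR⟩ : ∃ R : Prop, ∀ x ∈ Ioo x₀ (x₀ + δ),
      if R then LevelsAt y k p q x else LevelsAt y k q p x := by
    rcases hy.levelsAt_const (k := k) hsubR (fun x hx => (hB x (hsubR hx) hx.1.ne').2) with h | h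
    · exact ⟨True, by simpa using h⟩
    · exact ⟨False, by simpa using h⟩
  have ho := hy.orientation_eq hδ hfin hpq (fun x hx hne => (hB x hx hne).1) hL hR
  refine ⟨δ, hδ, fun α hα hαδ b β₁ β₂ ψ hβ₁ hβ₂ hψ => ?_⟩
  have hx₁ : x₀ - α ∈ Ioo (x₀ - δ) (x₀ + δ) := ⟨by linarith, by linarith⟩
  have hx₂ : x₀ + α ∈ Ioo (x₀ - δ) (x₀ + δ) := ⟨by linarith, by linarith⟩
  have hX : ∀ t ∈ Icc (0 : ℝ) 1, x₀ - α + 2 * α * t ∈ Ioo (x₀ - δ) (x₀ + δ) := fun t ht =>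
    ⟨by nlinarith [ht.1], by nlinarith [ht.2]⟩
  have hL₁ := hL (x₀ - α) ⟨by linarith, by linarith⟩
  have hR₂ := hR (x₀ + α) ⟨by linarith, by linarith⟩
  obtain ⟨hB₁, hl₁⟩ := hB _ hx₁ (by linarith)
  obtain ⟨hB₂, hl₂⟩ := hB _ hx₂ (by linarith)
  set o := orientation f x₀ k (k + 1) with ho_def
  have ho3 : o = 1 ∨ o = -1 ∨ o = 0 := by
    rw [ho]; split_ifs <;> simp
  -- Positive orientation means that `q`, the point further right, is the lower one on the left
  -- side; negative orientation means that `p` is.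
  have he₁ : (o : ℝ) = 0 ∨ ((o : ℝ) = 1 ∧ LevelsAt y k q p (x₀ - α)) ∨
      ((o : ℝ) = -1 ∧ LevelsAt y k p q (x₀ - α)) := by
    rw [ho]
    by_cases hLL : L <;> by_cases hRR : R <;> simp [hLL, hRR] at hL₁ ⊢ <;> tauto
  have he₂ : ((o : ℝ) = 0 ∧ ((LevelsAt y k p q (x₀ - α) ∧ LevelsAt y k p q (x₀ + α)) ∨
        (LevelsAt y k q p (x₀ - α) ∧ LevelsAt y k q p (x₀ + α)))) ∨
      (((o : ℝ) = 1 ∨ (o : ℝ) = -1) ∧ ((LevelsAt y k p q (x₀ - α) ∧ LevelsAt y k q p (x₀ + α)) ∨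
        (LevelsAt y k q p (x₀ - α) ∧ LevelsAt y k p q (x₀ + α)))) := by
    rw [ho]
    by_cases hLL : L <;> by_cases hRR : R <;> simp [hLL, hRR] at hL₁ hR₂ ⊢ <;> tauto
  have hfin₁ := hy.finite hfin hx₁
  have hfin₂ := hy.finite hfin hx₂
  have hcard₁ : (fibre f (x₀ - α : ℝ)).ncard = f.natDegree := (hy.ncard_fibre hx₁).trans hcard
  have hcard₂ : (fibre f (x₀ + α : ℝ)).ncard = f.natDegree := (hy.ncard_fibre hx₂).trans hcard
  have hd₁ := hy.numNonreal_eq hx₁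
  have hd₂ := hy.numNonreal_eq hx₂
  have hdn : numNonreal f x₀ ≤ f.natDegree := hd₁ ▸ numNonreal_le hfin₁ hcard₁
  have hp := hy.im_pos hx₁ hpq.im_pos
  have hq := hy.im_pos hx₁ (hpq.im_eq ▸ hpq.im_pos : 0 < (q : ℂ).im)
  -- the bounds `1 ≤ k` and `k + 1 ≤ d / 2`
  have hk : 1 ≤ k ∧ k + 1 ≤ f.natDegree := by
    have h1 := upperCount_pos hfin₁ (hy.mem hx₁ p) hp
    have h2 := upperCount_pos hfin₁ (hy.mem hx₁ q) hq
    have h3 := two_mul_upperCount_le hfin₁ (y p (x₀ - α)).im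
    have h4 := two_mul_upperCount_le hfin₁ (y q (x₀ - α)).im
    rcases hl₁ with h | h <;> rw [h.left] at * <;> rw [h.right] at * <;> omega
  -- The disc contains two distinct points.
  have hrD : 0 < rD := by
    have h1 := hyD x₀ (hy.mem_center hx₁) p.2
    have h2 := hyD x₀ (hy.mem_center hx₁) q.2
    rw [Metric.mem_closedBall] at h1 h2
    have h3 : 0 < dist (p : ℂ) q := dist_pos.2 fun e => hpq.re_lt.ne (by rw [e])
    linarith [dist_triangle_right (p : ℂ) q cD]
  have hn : (0 : ℝ) < f.natDegree + 1 := by positivity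
  obtain ⟨F₁, hF₁, hF₁y, hF₁β⟩ := hβ₁.exists_isDiscPath
  obtain ⟨F₂, hF₂, hF₂y, hF₂β⟩ := hβ₂.exists_isDiscPath
  obtain ⟨-, Φ, hΦ, hΦc, hΦ0, hΦψ⟩ := hψ
  have : Fintype (fibre f x₀) := hfin.fintype
  have h00 : (0 : ℝ) ∈ Icc (0 : ℝ) 1 := by simp
  have h01 : (1 : ℝ) ∈ Icc (0 : ℝ) 1 := by simp
  have hFdiff : IsDiffeo (F₁ 1) (Metric.closedBall cD rD)
      (Metric.closedBall (f.natDegree + 1 : ℂ) (f.natDegree + 1 : ℝ)) := by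
    simpa using hF₁.isDiffeo 1 h01
  have e0 : x₀ - α + 2 * α * 0 = x₀ - α := by ring
  have e1 : x₀ - α + 2 * α * 1 = x₀ + α := by ring
  let ℓ : ℝ → fibre f x₀ → ℂ := fun t i => y i (x₀ - α + 2 * α * t)
  have hℓ0 : ∀ i, ℓ 0 i = y i (x₀ - α) := fun i => by simp only [ℓ, e0]
  have hℓ1 : ∀ i, ℓ 1 i = y i (x₀ + α) := fun i => by simp only [ℓ, e1]
  have hℓc : ∀ i, ContinuousOn (fun t => ℓ t i) (Icc 0 1) := fun i =>
    (hy.continuousOn i).comp (by fun_prop) hX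
  have hℓ0D : ∀ i, ℓ 0 i ∈ Metric.closedBall cD rD := fun i => by
    rw [hℓ0]; exact hyD _ hx₁ (hy.mem hx₁ i)
  -- The Lefschetz family preserves the fibres only as sets; continuity in `t` and disjointness of
  -- the root paths make it follow each root.
  have hΦℓ : ∀ t ∈ Icc (0 : ℝ) 1, ∀ i, Φ t (ℓ 0 i) = ℓ t i := by
    intro t ht i
    refine eq_of_continuousOn_of_mem (g := fun t => Φ t (ℓ 0 i)) hℓc
      (fun t ht => hy.injective _ (hX t ht)) ?_ ?_ (hΦ0 (hℓ0D i)) ht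
    · exact hΦc.comp (continuousOn_id.prodMk continuousOn_const) fun t ht => ⟨ht, hℓ0D i⟩
    · intro s hs
      refine hy.exists_eq (hX s hs) ?_
      have h1 : ℓ 0 i ∈ fibre f ((x₀ - α + 2 * α * 0 : ℝ) : ℂ) := hy.mem (hX 0 h00) i
      have h2 := mem_image_of_mem (Φ s) h1
      rwa [(hΦ s hs).2.2] at h2
  set m₁ : fibre f x₀ → ℂ := fun i => modelPoint f (x₀ - α) (y i (x₀ - α)) with hm₁
  set m₂ : fibre f x₀ → ℂ := fun i => modelPoint f (x₀ + α) (y i (x₀ + α)) with hm₂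
  have hr₁ : range m₁ = modelConfig f.natDegree (numNonreal f x₀) := by
    rw [← hd₁, ← image_modelPoint hfin₁ hcard₁ hB₁, ← hy.range_eq _ hx₁, ← range_comp]; rfl
  have hr₂ : range m₂ = modelConfig f.natDegree (numNonreal f x₀) := by
    rw [← hd₂, ← image_modelPoint hfin₂ hcard₂ hB₂, ← hy.range_eq _ hx₂, ← range_comp]; rfl
  have hm₁D : ∀ i, m₁ i ∈ Metric.ball (f.natDegree + 1 : ℂ) (f.natDegree + 1 : ℝ) := fun i =>
    modelConfig_subset_ball hdn (hr₁ ▸ mem_range_self i)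
  have hm₂D : ∀ i, m₂ i ∈ Metric.ball (f.natDegree + 1 : ℂ) (f.natDegree + 1 : ℝ) := fun i =>
    modelConfig_subset_ball hdn (hr₂ ▸ mem_range_self i)
  have hF₁ℓ : ∀ t ∈ Icc (0 : ℝ) 1, ∀ i, F₁ t (ℓ 0 i) = (1 - t) * ℓ 0 i + t * m₁ i := by
    intro t ht i
    rw [hℓ0]; exact hF₁y t ht _ (hy.mem hx₁ i)
  have hF₂ℓ : ∀ t ∈ Icc (0 : ℝ) 1, ∀ i, F₂ t (ℓ 1 i) = (1 - t) * ℓ 1 i + t * m₂ i := by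
    intro t ht i
    rw [hℓ1]; exact hF₂y t ht _ (hy.mem hx₂ i)
  -- The fibres are only assumed to lie in the closed disc. The model points are interior, and
  -- diffeomorphisms of closed discs preserve interiors: `F₁ 1` brings this back to `ℓ 0` and `Φ t`
  -- carries it to `ℓ t`.
  have hℓD : ∀ t ∈ Icc (0 : ℝ) 1, ∀ i, ℓ t i ∈ Metric.ball cD rD := by
    intro t ht i
    rw [← hΦℓ t ht i]
    refine (hΦ t ht).1.mem_ball hrD ?_
    have h1 := hFdiff.symm.mem_ball hrD (hm₁D i)
    have h2 := hF₁ℓ 1 h01 i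
    simp only [Complex.ofReal_one, sub_self, zero_mul, one_mul, zero_add] at h2
    rwa [← h2, hFdiff.left_inv (hℓ0D i)] at h1
  have hcentre : ∀ i : fibre f x₀, (i : ℂ) ∈ Metric.ball cD rD := by
    intro i
    -- The segment passes through `x₀` at time `1/2`.
    have h1 := hℓD (1 / 2) ⟨by norm_num, by norm_num⟩ i
    simp only [ℓ] at h1
    rwa [show x₀ - α + 2 * α * (1 / 2) = x₀ by ring, hy.apply_self] at h1
  have hne : ∀ x ∈ Ioo (x₀ - δ) (x₀ + δ), x ≠ x₀ → (y p x).im ≠ (y q x).im := by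
    intro x hx hxne
    rcases (hB x hx hxne).2 with h | h
    · exact h.im_lt.ne
    · exact h.im_lt.ne'
  have main := sameMappingClass_of_motion hrD hn hF₁ hF₂
    ⟨fun t ht => (hΦ t ht).1, fun t ht => (hΦ t ht).2.1, hΦc⟩ hΦ0
    (isSupportedFamily_twist hk.2 (o : ℝ)) (twist_zero _ _ _) (l := ℓ) (m₁ := m₁) (m₂ := m₂)
    (c₀ := fun i => (i : ℂ)) (continuousOn_pi.2 hℓc) hℓD hcentre hm₁D hm₂D hF₁ℓ hF₂ℓ hΦℓ
    (hy.twist_modelPoint hfin hpq hx₁ hx₂ hk.1 he₂) (hr₁.trans hr₂.symm)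
    (fun t ht i j hij => hy.twist_div_mem_slitPlane hfin hpq hx₁ hk.1 hl₁ he₁ ht hij)
    (fun t ht i j hij => by
      rw [hℓ0, hℓ0]
      exact hy.segment_div_mem_slitPlane hfin hpq hx₁ (hne _ hx₁ (by linarith)) ht hij)
    (fun t ht i j hij => hy.div_mem_slitPlane hpq (hX t ht) hij)
    (fun t ht i j hij => by
      rw [hℓ1, hℓ1]
      exact hy.segment_div_mem_slitPlane hfin hpq hx₂ (hne _ hx₂ (by linarith)) ht hij)
  rw [hr₁, ← deltaCom_zpow (k + 1) hk.1 ho3] at main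
  refine main.congr_right fun z hz => ?_
  have h1 := hFdiff.symm_eqOn hβ₁.1 hF₁β hz
  have h2 := hFdiff.symm.mapsTo hz
  have h3 := (hΦ 1 h01).1.mapsTo h2
  change F₂ 1 (Φ 1 ((F₁ 1).symm z)) = β₂ (ψ (β₁.symm z))
  rw [hF₂β h3, hΦψ h2, h1]
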